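/- Let $d\ge 1$, write $\mathbb{R}^d_+=(0,\infty)^d$, let $E\subset\{1,\dots,d\}$ and let $\nu\in\mathbb{R}^d$ satisfy $0\neq\nu_i<1$ for $i\in E$ and $\nu_i>-1$ for $i\notin E$ (that is, $\nu\in A(E)$). Assume $\max_{i\in E}\nu_i<0$, where the maximum over the empty set is $-\infty$. Let $d\eta_\nu(x)=x^{2\nu+\mathbf 1}dx=\prod_{i=1}^d x_i^{2\nu_i+1}\,dx$ on $\mathbb{R}^d_+$, and in dimension one $d\eta_{\nu_i}(u)=u^{2\nu_i+1}du$ on $(0,\infty)$. For $\alpha>-1$ and $u,w>0$ put $\varphi^{\alpha}_w(u)=(uw)^{-\alpha}J_{\alpha}(uw)$, with $J_\alpha$ the Bessel function of the first kind, and for each $i$ put $\phi^{(i)}_w(u)=(uw)^{-2\nu_i}\varphi^{-\nu_i}_w(u)$ if $i\in E$ (exotic coordinate) and $\phi^{(i)}_w(u)=\varphi^{\nu_i}_w(u)$ if $i\notin E$ (classical coordinate). Let $\Phi^{\nu,E}_z(x)=\prod_{i=1}^d\phi^{(i)}_{z_i}(x_i)$, and let $\mathfrak{h}_{\nu,E}$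 be the generalized (modified) Hankel transform, i.e. the extension by continuity to $L^2(d\eta_\nu)$ of $$\mathfrak{h}_{\nu,E}f(z)=\int_{\mathbb{R}^d_+} f(x)\,\Phi^{\nu,E}_z(x)\,d\eta_\nu(x),\qquad f\in C_c(\mathbb{R}^d_+).$$ The Bessel semigroup on $L^2(d\eta_\nu)$ is $\exp(-t\mathbb{B}_{\nu,E})f=\mathfrak{h}_{\nu,E}\big(e^{-t|z|^2}\,\mathfrak{h}_{\nu,E}f(z)\big)$, $t>0$. Define further $$\mathbb{W}^{\nu,E}_t(x,y)=\prod_{i=1}^d\int_0^\infty e^{-tw^2}\phi^{(i)}_w(x_i)\,\phi^{(i)}_w(y_i)\,d\eta_{\nu_i}(w),\qquad \mathbb{W}^{\nu,E}_tf(x)=\int_{\mathbb{R}^d_+}\mathbb{W}^{\nu,E}_t(x,y)f(y)\,d\eta_\nu(y)$$ for $x,y\in\mathbb{R}^d_+$, $t>0$. **Theorem.** For all complex-valued $f$ in $L^1(d\eta_\nu)$ or in $L^2(d\eta_\nu)$, all $t>0$ and all $x\in\mathbb{R}^d_+$, the integral defining $\mathbb{W}^{\nu,E}_tf(x)$ converges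 absolutely, and for $f\in L^2(d\eta_\nu)$ one has $\exp(-t\mathbb{B}_{\nu,E})f=\mathbb{W}^{\nu,E}_tf$ in $L^2(d\eta_\nu)$. The maximal operator $\mathbb{W}^{\nu,E}_*f=\sup_{t>0}|\mathbb{W}^{\nu,E}_tf|$ is bounded from $L^1(d\eta_\nu)$ to weak $L^1(d\eta_\nu)$: there is a finite constant $C$, depending only on $d$, $E$ and $\nu$, such that for every $f\in L^1(d\eta_\nu)$ the function $\mathbb{W}^{\nu,E}_*f$ is $\eta_\nu$-measurable and $$\eta_\nu\big(\{x\in\mathbb{R}^d_+:\ \mathbb{W}^{\nu,E}_*f(x)>s\}\big)\le\frac{C}{s}\,\|f\|_{L^1(d\eta_\nu)}\qquad\text{for all } s>0.$$ -/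

import Mathlib

open MeasureTheory Set Filter Topology
open scoped ENNReal NNReal

noncomputable section

namespace ExoticBessel

/-- The Bessel function of the first kind `J_ν(x)`, for order `ν > -1` and `x > 0`. -/
def besselJ (ν x : ℝ) : ℝ :=
  ∑' m : ℕ, (-1 : ℝ) ^ m / ((m.factorial : ℝ) * Real.Gamma ((m : ℝ) + ν + 1)) *
    (x / 2) ^ (2 * (m : ℝ) + ν)

/-- The classical eigenfunction `φ_z^ν(x) = (xz)^{-ν} J_ν(xz)` of
`B_ν = -d²/dx² - ((2ν+1)/x) d/dx`, with eigenvalue `z²`. -/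
def phi (ν z x : ℝ) : ℝ := (x * z) ^ (-ν) * besselJ ν (x * z)

/-- The exotic eigenfunction `x ↦ (xz)^{-2ν} φ_z^{-ν}(x)` of `B_ν`, with eigenvalue `z²`. -/
def phiExo (ν z x : ℝ) : ℝ := (x * z) ^ (-2 * ν) * phi (-ν) z x

/-- The measure `dη_ν(x) = x^{2ν+1} dx` on the half-line `(0,∞)`. -/
def eta₁ (ν : ℝ) : Measure ℝ :=
  (volume.restrict (Ioi 0)).withDensity fun x => ENNReal.ofReal (x ^ (2 * ν + 1))

/-- The one-dimensional classical Bessel heat kernel. -/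
def kernelCls (ν t x y : ℝ) : ℝ :=
  ∫ z, Real.exp (-t * z ^ 2) * phi ν z x * phi ν z y ∂(eta₁ ν)

/-- The one-dimensional exotic Bessel heat kernel. -/
def kernelExo (ν t x y : ℝ) : ℝ :=
  ∫ z, Real.exp (-t * z ^ 2) * phiExo ν z x * phiExo ν z y ∂(eta₁ ν)

variable {d : ℕ}

/-- The set `A(E)` of multi-parameters; `E` indicates the exotic coordinates. -/
def paramSet (E : Finset (Fin d)) : Set (Fin d → ℝ) :=
  {ν | (∀ i ∈ E, ν i ≠ 0 ∧ ν i < 1) ∧ ∀ i ∉ E, -1 < ν i}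

/-- `max {ν_i : i ∈ E}`, equal to `-∞` if `E` is empty. -/
def maxExo (E : Finset (Fin d)) (ν : Fin d → ℝ) : EReal :=
  E.sup fun i => (ν i : EReal)

/-- The open orthant `(0,∞)^d`. -/
def orthant (d : ℕ) : Set (Fin d → ℝ) := {x | ∀ i, 0 < x i}

/-- The measure `dη_ν(x) = x^{2ν+1} dx = ∏ x_i^{2ν_i+1} dx` on the orthant (extended by zero). -/
def eta (ν : Fin d → ℝ) : Measure (Fin d → ℝ) :=
  (volume.restrict (orthant d)).withDensity fun x =>
    ENNReal.ofReal (∏ i, x i ^ (2 * ν i + 1))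

/-- The tensor product eigenfunctions `Φ_z^{ν,E}(x)`. -/
def Phi (E : Finset (Fin d)) (ν z x : Fin d → ℝ) : ℝ :=
  ∏ i, if i ∈ E then phiExo (ν i) (z i) (x i) else phi (ν i) (z i) (x i)

/-- The continuous functions with compact support contained in the open orthant. -/
def IsCc (f : (Fin d → ℝ) → ℂ) : Prop :=
  Continuous f ∧ HasCompactSupport f ∧ tsupport f ⊆ orthant d

/-- The generalized (modified) Hankel transform, given by its integral on `C_c`. -/
def hankel (E : Finset (Fin d)) (ν : Fin d → ℝ) (f : (Fin d → ℝ) → ℂ) (z : Fin d → ℝ) : ℂ :=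
  ∫ x, Phi E ν z x • f x ∂(eta ν)

/-- `g` is the image of `f` under the extension by continuity to `L²(dη_ν)` of the Hankel
transform on `C_c`: some `f_n ∈ C_c` satisfy `f_n → f` and `hankel f_n → g` in `L²(dη_ν)`. -/
def IsHankelL2 (E : Finset (Fin d)) (ν : Fin d → ℝ) (f g : (Fin d → ℝ) → ℂ) : Prop :=
  MemLp f 2 (eta ν) ∧ MemLp g 2 (eta ν) ∧
    ∃ F : ℕ → (Fin d → ℝ) → ℂ, (∀ n, IsCc (F n)) ∧
      Tendsto (fun n => eLpNorm (F n - f) 2 (eta ν)) atTop (𝓝 0) ∧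
      Tendsto (fun n => eLpNorm (hankel E ν (F n) - g) 2 (eta ν)) atTop (𝓝 0)

/-- `u = exp(-t 𝔹_{ν,E}) f` in `L²(dη_ν)`: `u` is the Hankel transform of `e^{-t|z|²}` times the
Hankel transform of `f`. -/
def IsSemigroupL2 (E : Finset (Fin d)) (ν : Fin d → ℝ) (t : ℝ)
    (f u : (Fin d → ℝ) → ℂ) : Prop :=
  ∃ g : (Fin d → ℝ) → ℂ, IsHankelL2 E ν f g ∧
    IsHankelL2 E ν (fun z => Real.exp (-t * ∑ i, z i ^ 2) • g z) u

/-- The integral kernel of the multi-dimensional Bessel semigroup. -/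
def kernel (E : Finset (Fin d)) (ν : Fin d → ℝ) (t : ℝ) (x y : Fin d → ℝ) : ℝ :=
  ∏ i, if i ∈ E then kernelExo (ν i) t (x i) (y i) else kernelCls (ν i) t (x i) (y i)

/-- The pointwise definition of the Bessel semigroup, for `t > 0` and `x` in the orthant. -/
def semigroup (E : Finset (Fin d)) (ν : Fin d → ℝ) (t : ℝ) (f : (Fin d → ℝ) → ℂ)
    (x : Fin d → ℝ) : ℂ :=
  ∫ y, kernel E ν t x y • f y ∂(eta ν)

/-- The maximal operator `sup_{t>0} |exp(-t 𝔹_{ν,E}) f|`. -/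
def maximal (E : Finset (Fin d)) (ν : Fin d → ℝ) (f : (Fin d → ℝ) → ℂ)
    (x : Fin d → ℝ) : ℝ≥0∞ :=
  ⨆ (t : ℝ) (_ : 0 < t), ‖semigroup E ν t f x‖ₑ

end ExoticBessel

end

/-! In each coordinate the eigenfunction is `((xz)²)^β · 2^(-α) · E_α(-(xz)²/4)`, with `E_α` entire,
where `(α, β) = (ν, 0)` in a classical and `(-ν, -ν)` in an exotic coordinate; in both cases `ν = α
- 2β`. The two extra powers `z^(2β)` turn the weight of order `ν` into the weight of order `α`, so
Weber's second exponential integral evaluates both kernels: each is `(xy)^(2β)` times the classical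
kernel of order `α`, explicit and positive.

The weak type estimate needs no singular integral theory. The kernels are symmetric, satisfy
Chapman–Kolmogorov (Weber's integral again, now with positive arguments) and have mass at most 1. In
an exotic coordinate the mass bound is an incomplete gamma estimate that requires `α > 0`, and `max
ν_i < 0` on `E` provides this. Hopf's maximal ergodic inequality then controls the averages of the
powers of `W_δ`, with a constant independent of `δ`. To pass from averages to single times, `k_t ≤ C
k_s` is proved for `t ≤ s ≤ 4t`: the kernel is a power of `t`, times a Gaussian in `|x| - |y|`,
times `e^(-u) E_α(u²/4)` at `u = |x||y|/(2t)`, and the last factor grows at most like a power of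
`u`, by Cauchy–Schwarz for the power series of `E_α`.

On `L²` the Gaussian-regularized Plancherel computation and Schur's test show that the Hankel
transform is a contraction on a class of functions containing `C_c` and stable under Gaussian times
transform. On that class Fubini gives the semigroup formula, and density of `C_c` extends it. The
abstract part, `IsHeatKernel`, uses only these kernel properties. -/

noncomputable section

namespace ExoticBessel

/-! ### The entire function behind the Bessel functions -/

/-- The coefficients of the entire function `besselE`. -/
def coeffE (α : ℝ) (m : ℕ) : ℝ := 1 / ((m.factorial : ℝ) * Real.Gamma ((m : ℝ) + α + 1))

/-- The entire function with `J_α(u) = (u/2)^α E_α(-u²/4)` and `I_α(u) = (u/2)^α E_α(u²/4)`. -/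
def besselE (α w : ℝ) : ℝ := ∑' m : ℕ, coeffE α m * w ^ m

theorem gamma_pos_of_neg_one_lt {α : ℝ} (hα : -1 < α) (m : ℕ) :
    0 < Real.Gamma ((m : ℝ) + α + 1) :=
  Real.Gamma_pos_of_pos (by have : (0 : ℝ) ≤ m := Nat.cast_nonneg m; linarith)

theorem coeffE_pos {α : ℝ} (hα : -1 < α) (m : ℕ) : 0 < coeffE α m := by
  have := gamma_pos_of_neg_one_lt hα m
  unfold coeffE
  positivity

/-- Bessel's equation on the level of coefficients. It drives the ratio test and, later, the second
moment identity in `tsum_mul_coeffE_le`. -/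
theorem coeffE_succ {α : ℝ} (hα : -1 < α) (m : ℕ) :
    ((m : ℝ) + 1) * ((m : ℝ) + 1 + α) * coeffE α (m + 1) = coeffE α m := by
  have h0 : (0 : ℝ) ≤ m := Nat.cast_nonneg m
  have h1 := gamma_pos_of_neg_one_lt hα m
  have h2 : Real.Gamma (((m + 1 : ℕ) : ℝ) + α + 1) =
      ((m : ℝ) + α + 1) * Real.Gamma ((m : ℝ) + α + 1) := by
    rw [← Real.Gamma_add_one (by linarith)]
    congr 1
    push_cast
    ring
  have h3 : (0 : ℝ) < m.factorial := by exact_mod_cast m.factorial_pos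
  have h4 : (m : ℝ) + α + 1 ≠ 0 := by linarith
  unfold coeffE
  rw [h2, Nat.factorial_succ]
  push_cast
  have h5 : (m : ℝ) + 1 + α = (m : ℝ) + α + 1 := by ring
  rw [h5]
  field_simp

/-- Ratio test with limit 0. The polynomial weight is there for the derivative (`r = 1`) and for
second moments (`r = 2`). -/
theorem summable_mul_pow_coeffE {α : ℝ} (hα : -1 < α) (r : ℕ) (w : ℝ) :
    Summable fun m : ℕ => (m : ℝ) ^ r * (coeffE α m * w ^ m) := by
  by_cases hw : w = 0
  · refine summable_of_ne_finset_zero (s := {0}) fun m hm => ?_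
    have : m ≠ 0 := by simpa using hm
    simp [hw, this]
  have hw' : 0 < |w| := abs_pos.2 hw
  refine summable_of_ratio_test_tendsto_lt_one (l := 0) one_pos ?_ ?_
  · filter_upwards [eventually_gt_atTop 0] with m hm
    have := coeffE_pos hα m
    have h2 : (0 : ℝ) < m := by exact_mod_cast hm
    positivity
  · have key : ∀ᶠ m : ℕ in atTop,
        (1 + 1 / (m : ℝ)) ^ r * (|w| * (1 / ((m : ℝ) + 1)) * (1 / ((m : ℝ) + (1 + α)))) =
        ‖((m + 1 : ℕ) : ℝ) ^ r * (coeffE α (m + 1) * w ^ (m + 1))‖ /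
          ‖(m : ℝ) ^ r * (coeffE α m * w ^ m)‖ := by
      filter_upwards [eventually_gt_atTop 0] with m hm
      have h1 := coeffE_pos hα (m + 1)
      have h2 : (0 : ℝ) < m := by exact_mod_cast hm
      have h3 : (m : ℝ) + (1 + α) ≠ 0 := by linarith
      have h3' : 0 < 1 + (m : ℝ) + α := by linarith
      rw [← coeffE_succ hα m]
      simp only [norm_mul, norm_pow, Real.norm_eq_abs, abs_of_pos h1, Nat.abs_cast]
      have e1 : |(m : ℝ) + 1 + α| = (m : ℝ) + 1 + α := abs_of_pos (by linarith)
      have e2 : |(m : ℝ) + 1| = (m : ℝ) + 1 := abs_of_pos (by linarith)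
      have e3 : (m : ℝ) + 1 + α = (m : ℝ) + (1 + α) := by ring
      have e4 : 1 + 1 / (m : ℝ) = ((m : ℝ) + 1) / m := by field_simp
      rw [e1, e2, e3, e4, div_pow]
      push_cast
      field_simp
      ring
    refine Tendsto.congr' key ?_
    have t1 : Tendsto (fun m : ℕ => (1 + 1 / (m : ℝ)) ^ r) atTop (𝓝 1) := by
      have := (tendsto_one_div_atTop_nhds_zero_nat (𝕜 := ℝ)).const_add 1
      simpa using this.pow r
    have t2 : Tendsto (fun m : ℕ => |w| * (1 / ((m : ℝ) + 1))) atTop (𝓝 (|w| * 0)) :=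
      tendsto_one_div_add_atTop_nhds_zero_nat.const_mul _
    have t3 : Tendsto (fun m : ℕ => 1 / ((m : ℝ) + (1 + α))) atTop (𝓝 0) := by
      simp only [one_div]
      exact tendsto_inv_atTop_zero.comp
        (tendsto_atTop_add_const_right _ _ tendsto_natCast_atTop_atTop)
    simpa using t1.mul (t2.mul t3)

theorem summable_coeffE {α : ℝ} (hα : -1 < α) (w : ℝ) :
    Summable fun m : ℕ => coeffE α m * w ^ m := by
  simpa using summable_mul_pow_coeffE hα 0 w

theorem hasSum_besselE {α : ℝ} (hα : -1 < α) (w : ℝ) :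
    HasSum (fun m : ℕ => coeffE α m * w ^ m) (besselE α w) :=
  (summable_coeffE hα w).hasSum

theorem besselE_pos {α : ℝ} (hα : -1 < α) {w : ℝ} (hw : 0 ≤ w) : 0 < besselE α w := by
  refine (summable_coeffE hα w).tsum_pos
    (fun m => mul_nonneg (coeffE_pos hα m).le (pow_nonneg hw m)) 0 ?_
  simpa using coeffE_pos hα 0

theorem abs_besselE_le {α : ℝ} (hα : -1 < α) (w : ℝ) : |besselE α w| ≤ besselE α |w| := by
  have h : ∀ m, ‖coeffE α m * w ^ m‖ = coeffE α m * |w| ^ m := fun m => by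
    rw [norm_mul, norm_pow, Real.norm_eq_abs, Real.norm_eq_abs, abs_of_pos (coeffE_pos hα m)]
  have := norm_tsum_le_tsum_norm (f := fun m => coeffE α m * w ^ m)
    (by simpa only [h] using summable_coeffE hα |w|)
  rw [tsum_congr h] at this
  exact this

theorem besselE_mono {α : ℝ} (hα : -1 < α) {v w : ℝ} (hv : 0 ≤ v) (h : v ≤ w) :
    besselE α v ≤ besselE α w :=
  (summable_coeffE hα v).tsum_le_tsum (fun m =>
    mul_le_mul_of_nonneg_left (pow_le_pow_left₀ hv h m) (coeffE_pos hα m).le)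
    (summable_coeffE hα w)

theorem hasDerivAt_besselE {α : ℝ} (hα : -1 < α) (w : ℝ) :
    HasDerivAt (besselE α) (∑' m : ℕ, (m : ℝ) * coeffE α m * w ^ (m - 1)) w := by
  -- A radius at least 1, so that `R ^ (m - 1) ≤ R ^ m` also under the truncated subtraction at `m =
  -- 0`.
  set R : ℝ := |w| + 1
  have hR : 1 ≤ R := by simp [R]
  refine hasDerivAt_tsum_of_isPreconnected (t := Metric.ball 0 R)
    (u := fun m : ℕ => (m : ℝ) ^ 1 * (coeffE α m * R ^ m))
    (g := fun m w => coeffE α m * w ^ m)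
    (g' := fun m w => (m : ℝ) * coeffE α m * w ^ (m - 1))
    (summable_mul_pow_coeffE hα 1 R)
    Metric.isOpen_ball (convex_ball 0 R).isPreconnected ?_ ?_ (y₀ := 0) ?_ ?_ ?_
  · intro m y _
    have h := (hasDerivAt_pow m y).const_mul (coeffE α m)
    rwa [← mul_assoc, mul_comm (coeffE α m)] at h
  · intro m y hy
    have hy' : |y| ≤ R := by simpa using (mem_ball_zero_iff.1 hy).le
    rw [norm_mul, norm_mul, norm_pow, Real.norm_eq_abs, Real.norm_eq_abs, Real.norm_eq_abs,
      abs_of_pos (coeffE_pos hα m), Nat.abs_cast, pow_one, mul_assoc]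
    refine mul_le_mul_of_nonneg_left (mul_le_mul_of_nonneg_left ?_ (coeffE_pos hα m).le)
      (Nat.cast_nonneg m)
    exact (pow_le_pow_left₀ (abs_nonneg y) hy' _).trans (pow_le_pow_right₀ hR (Nat.sub_le m 1))
  · simp [R]; positivity
  · exact summable_coeffE hα 0
  · simp [R]

theorem continuous_besselE {α : ℝ} (hα : -1 < α) : Continuous (besselE α) :=
  continuous_iff_continuousAt.2 fun w => (hasDerivAt_besselE hα w).continuousAt

/-! ### Weber's second exponential integral -/

/-- The Chu–Vandermonde identity. -/
theorem sum_choose_mul_descFactorial_div_gamma (m : ℕ) : ∀ (n : ℕ) (α : ℝ), -1 < α →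
    ∑ k ∈ Finset.range (m + 1), (m.choose k : ℝ) * (n.descFactorial k : ℝ) /
      Real.Gamma ((k : ℝ) + α + 1) =
    Real.Gamma ((m : ℝ) + n + α + 1) /
      (Real.Gamma ((m : ℝ) + α + 1) * Real.Gamma ((n : ℝ) + α + 1)) := by
  induction m with
  | zero =>
    intro n α hα
    have h1 := (gamma_pos_of_neg_one_lt hα n).ne'
    have h2 := (gamma_pos_of_neg_one_lt hα 0).ne'
    simp only [Nat.cast_zero, zero_add] at h2
    simp
    field_simp
  | succ m ih =>
    intro n α hα
    -- Pascal's rule. The shifted half is a sum of the same kind with `α + 1` in place of `α` and,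
    -- once a factor `n` is taken out of the descending factorial, `n - 1` in place of `n`; hence
    -- the induction keeps `n` and `α` general.
    have step : ∑ k ∈ Finset.range (m + 1 + 1), ((m + 1).choose k : ℝ) *
        (n.descFactorial k : ℝ) / Real.Gamma ((k : ℝ) + α + 1) =
        (∑ k ∈ Finset.range (m + 1), (m.choose k : ℝ) * (n.descFactorial k : ℝ) /
          Real.Gamma ((k : ℝ) + α + 1)) +
        ∑ k ∈ Finset.range (m + 1), (m.choose k : ℝ) * (n.descFactorial (k + 1) : ℝ) /
          Real.Gamma ((k : ℝ) + (α + 1) + 1) := by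
      have e1 : ∑ k ∈ Finset.range (m + 1), (m.choose k : ℝ) * (n.descFactorial k : ℝ) /
          Real.Gamma ((k : ℝ) + α + 1) = ∑ k ∈ Finset.range (m + 1 + 1),
          (m.choose k : ℝ) * (n.descFactorial k : ℝ) / Real.Gamma ((k : ℝ) + α + 1) := by
        rw [Finset.sum_range_succ _ (m + 1)]
        simp
      rw [e1, Finset.sum_range_succ', Finset.sum_range_succ' _ (m + 1)]
      rw [add_right_comm (Finset.sum _ _), ← Finset.sum_add_distrib]
      congr 1
      · refine Finset.sum_congr rfl fun k _ => ?_
        rw [Nat.choose_succ_succ]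
        have : ((k + 1 : ℕ) : ℝ) + α + 1 = (k : ℝ) + (α + 1) + 1 := by push_cast; ring
        rw [this]
        push_cast
        ring
      · simp
    rw [step, ih n α hα]
    have hm : (0 : ℝ) ≤ m := Nat.cast_nonneg m
    have hn : (0 : ℝ) ≤ n := Nat.cast_nonneg n
    have g1 := (gamma_pos_of_neg_one_lt hα m).ne'
    have g2 := (gamma_pos_of_neg_one_lt hα n).ne'
    have e1 : Real.Gamma (((m + 1 : ℕ) : ℝ) + α + 1) =
        ((m : ℝ) + α + 1) * Real.Gamma ((m : ℝ) + α + 1) := by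
      rw [← Real.Gamma_add_one (by linarith)]; congr 1; push_cast; ring
    have e2 : Real.Gamma (((m + 1 : ℕ) : ℝ) + n + α + 1) =
        ((m : ℝ) + n + α + 1) * Real.Gamma ((m : ℝ) + n + α + 1) := by
      rw [← Real.Gamma_add_one (by linarith)]; congr 1; push_cast; ring
    have hne : (m : ℝ) + α + 1 ≠ 0 := by linarith
    rw [e1, e2]
    cases n with
    | zero =>
      simp only [Nat.zero_descFactorial_succ, Nat.cast_zero, mul_zero, zero_div,
        Finset.sum_const_zero, add_zero]
      simp only [Nat.cast_zero] at g2
      field_simp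
    | succ n =>
      have e3 := ih n (α + 1) (by linarith)
      have e4 : ∑ k ∈ Finset.range (m + 1), (m.choose k : ℝ) *
          ((n + 1).descFactorial (k + 1) : ℝ) / Real.Gamma ((k : ℝ) + (α + 1) + 1) =
          ((n : ℝ) + 1) * ∑ k ∈ Finset.range (m + 1), (m.choose k : ℝ) *
          (n.descFactorial k : ℝ) / Real.Gamma ((k : ℝ) + (α + 1) + 1) := by
        rw [Finset.mul_sum]
        refine Finset.sum_congr rfl fun k _ => ?_
        rw [Nat.succ_descFactorial_succ]
        push_cast
        ring
      rw [e4, e3]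
      have f1 : (m : ℝ) + n + (α + 1) + 1 = (m : ℝ) + (n + 1 : ℕ) + α + 1 := by push_cast; ring
      have f2 : Real.Gamma ((m : ℝ) + (α + 1) + 1) =
          ((m : ℝ) + α + 1) * Real.Gamma ((m : ℝ) + α + 1) := by
        rw [← Real.Gamma_add_one (by linarith)]; congr 1; ring
      have f3 : (n : ℝ) + (α + 1) + 1 = ((n + 1 : ℕ) : ℝ) + α + 1 := by push_cast; ring
      rw [f1, f2, f3]
      field_simp
      push_cast
      ring

/-- The left side is the coefficient of `A^m B^n` in `e^A e^B E_α(AB)`, with `k` the power of `AB`.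
Multiplication by `m! n!` turns it into the Chu–Vandermonde sum, whose terms with `k > n` vanish. -/
theorem sum_inv_factorial_mul_coeffE {α : ℝ} (hα : -1 < α) (m n : ℕ) :
    ∑ k ∈ Finset.range (m + 1), (if k ≤ n then
      1 / ((m - k).factorial : ℝ) * (1 / ((n - k).factorial : ℝ)) * coeffE α k else 0) =
    coeffE α m * coeffE α n * Real.Gamma ((m : ℝ) + n + α + 1) := by
  have h := sum_choose_mul_descFactorial_div_gamma m n α hα
  have hm : (0 : ℝ) < m.factorial := by exact_mod_cast m.factorial_pos
  have hn : (0 : ℝ) < n.factorial := by exact_mod_cast n.factorial_pos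
  have : coeffE α m * coeffE α n * Real.Gamma ((m : ℝ) + n + α + 1) =
      1 / ((m.factorial : ℝ) * n.factorial) * (Real.Gamma ((m : ℝ) + n + α + 1) /
      (Real.Gamma ((m : ℝ) + α + 1) * Real.Gamma ((n : ℝ) + α + 1))) := by
    unfold coeffE
    ring
  rw [this, ← h, Finset.mul_sum]
  refine Finset.sum_congr rfl fun k hk => ?_
  have hk' : k ≤ m := Nat.lt_succ_iff.1 (Finset.mem_range.1 hk)
  split_ifs with hkn
  · have e1 : (m.choose k : ℝ) * k.factorial * (m - k).factorial = m.factorial := by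
      exact_mod_cast Nat.choose_mul_factorial_mul_factorial hk'
    have e2 : ((n - k).factorial : ℝ) * n.descFactorial k = n.factorial := by
      exact_mod_cast Nat.factorial_mul_descFactorial hkn
    have hk0 : (0 : ℝ) < k.factorial := by exact_mod_cast k.factorial_pos
    have h1 : (0 : ℝ) < (m - k).factorial := by exact_mod_cast (m - k).factorial_pos
    have h2 : (0 : ℝ) < (n - k).factorial := by exact_mod_cast (n - k).factorial_pos
    have g := (gamma_pos_of_neg_one_lt hα k).ne'
    have c0 : (m.choose k : ℝ) ≠ 0 := by exact_mod_cast (Nat.choose_pos hk').ne'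
    have d0 : (n.descFactorial k : ℝ) ≠ 0 := fun h => by rw [h, mul_zero] at e2; linarith
    unfold coeffE
    rw [← e1, ← e2]
    field_simp
  · rw [Nat.descFactorial_of_lt (not_le.1 hkn)]
    simp

theorem hasSum_coeffE_mul_coeffE_mul_gamma {α : ℝ} (hα : -1 < α) (A B : ℝ) :
    HasSum (fun p : ℕ × ℕ => coeffE α p.1 * coeffE α p.2 *
        Real.Gamma ((p.1 : ℝ) + p.2 + α + 1) * (A ^ p.1 * B ^ p.2))
      (Real.exp (A + B) * besselE α (A * B)) := by
  have hexp : ∀ x : ℝ, HasSum (fun i : ℕ => 1 / (i.factorial : ℝ) * x ^ i) (Real.exp x) := by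
    intro x
    have := NormedSpace.expSeries_div_hasSum_exp x
    rw [← Real.exp_eq_exp_ℝ] at this
    refine this.congr_fun fun i => ?_
    ring
  let fA : ℕ → ℝ := fun i => 1 / (i.factorial : ℝ) * A ^ i
  let fB : ℕ → ℝ := fun i => 1 / (i.factorial : ℝ) * B ^ i
  let fE : ℕ → ℝ := fun i => coeffE α i * (A * B) ^ i
  have hA : HasSum fA (Real.exp A) := hexp A
  have hB : HasSum fB (Real.exp B) := hexp B
  have hE : HasSum fE (besselE α (A * B)) := hasSum_besselE hα (A * B)
  let fAB : ℕ × ℕ → ℝ := fun q => fA q.1 * fB q.2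
  have sAB : Summable fAB := summable_mul_of_summable_norm hA.summable.norm hB.summable.norm
  have h1 : HasSum fAB (Real.exp A * Real.exp B) := hA.mul hB sAB
  let fABE : (ℕ × ℕ) × ℕ → ℝ := fun q => fAB q.1 * fE q.2
  have sABE : Summable fABE := summable_mul_of_summable_norm sAB.norm hE.summable.norm
  have h2 : HasSum fABE (Real.exp A * Real.exp B * besselE α (A * B)) := h1.mul hE sABE
  -- The absolutely convergent triple series is reindexed by the total exponents of `A` and `B`;
  -- summing over the fibres, that is over `k`, then gives the double series.
  let e : (ℕ × ℕ) × ℕ → (ℕ × ℕ) × ℕ := fun q => ((q.1.1 + q.2, q.1.2 + q.2), q.2)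
  have he : Function.Injective e := by
    rintro ⟨⟨a, b⟩, c⟩ ⟨⟨a', b'⟩, c'⟩ h
    simp only [e, Prod.mk.injEq] at h ⊢
    omega
  let G : (ℕ × ℕ) × ℕ → ℝ := fun q => if q.2 ≤ q.1.1 ∧ q.2 ≤ q.1.2 then
    1 / ((q.1.1 - q.2).factorial : ℝ) * (1 / ((q.1.2 - q.2).factorial : ℝ)) * coeffE α q.2 *
      (A ^ q.1.1 * B ^ q.1.2) else 0
  have h3 : HasSum G (Real.exp A * Real.exp B * besselE α (A * B)) := by
    refine (he.hasSum_iff ?_).1 ?_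
    · rintro ⟨⟨m, n⟩, k⟩ hq
      simp only [G]
      rw [if_neg]
      rintro ⟨hm, hn'⟩
      refine hq ⟨((m - k, n - k), k), ?_⟩
      simp only [e, Prod.mk.injEq, and_true]
      omega
    · have hGe : G ∘ e = fABE := by
        funext ⟨⟨m, n⟩, k⟩
        simp only [fABE, fAB, fA, fB, fE, G, e, Function.comp, Nat.le_add_left, and_self, if_true,
          Nat.add_sub_cancel]
        rw [mul_pow, pow_add, pow_add]
        ring
      rwa [hGe]
  rw [Real.exp_add]
  refine h3.prod_fiberwise fun p => ?_
  have : coeffE α p.1 * coeffE α p.2 * Real.Gamma ((p.1 : ℝ) + p.2 + α + 1) *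
      (A ^ p.1 * B ^ p.2) = ∑ k ∈ Finset.range (p.1 + 1), G (p, k) := by
    rw [← sum_inv_factorial_mul_coeffE hα, Finset.sum_mul]
    refine Finset.sum_congr rfl fun k hk => ?_
    have hk' : k ≤ p.1 := Nat.lt_succ_iff.1 (Finset.mem_range.1 hk)
    simp only [G, hk', true_and]
    split_ifs <;> simp
  rw [this]
  refine hasSum_sum_of_ne_finset_zero fun k hk => ?_
  have hk' : ¬ k ≤ p.1 := fun h => hk (Finset.mem_range.2 (Nat.lt_succ_iff.2 h))
  simp [G, hk']

theorem integral_pow_mul_gaussian {α t : ℝ} (hα : -1 < α) (ht : 0 < t) (n : ℕ) :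
    ∫ z in Ioi (0 : ℝ), z ^ (2 * n) * (Real.exp (-t * z ^ 2) * z ^ (2 * α + 1)) =
      1 / 2 * t ^ (-(α + 1)) * ((1 / t) ^ n * Real.Gamma ((n : ℝ) + α + 1)) := by
  have hn : (0 : ℝ) ≤ n := Nat.cast_nonneg n
  have h := integral_rpow_mul_exp_neg_mul_rpow (p := 2) (q := 2 * n + 2 * α + 1) (b := t)
    two_pos (by linarith) ht
  have e1 : (2 * (n : ℝ) + 2 * α + 1 + 1) / 2 = (n : ℝ) + α + 1 := by ring
  have e2 : -(2 * (n : ℝ) + 2 * α + 1 + 1) / 2 = -(α + 1) + -(n : ℝ) := by ring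
  rw [e1, e2, Real.rpow_add ht, Real.rpow_neg ht.le (n : ℝ), Real.rpow_natCast] at h
  have e3 : ∫ z in Ioi (0 : ℝ), z ^ (2 * n) * (Real.exp (-t * z ^ 2) * z ^ (2 * α + 1)) =
      ∫ z in Ioi (0 : ℝ), z ^ (2 * (n : ℝ) + 2 * α + 1) * Real.exp (-t * z ^ (2 : ℝ)) := by
    refine setIntegral_congr_fun measurableSet_Ioi fun z hz => ?_
    have hz : 0 < z := hz
    have : z ^ (2 * (n : ℝ) + 2 * α + 1) = z ^ (2 * n) * z ^ (2 * α + 1) := by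
      rw [add_assoc, Real.rpow_add hz]
      congr 1
      exact_mod_cast Real.rpow_natCast z (2 * n)
    simp only [this, Real.rpow_two]
    ring
  rw [e3, h, one_div t, inv_pow]
  ring

theorem integrable_pow_mul_gaussian {α t : ℝ} (hα : -1 < α) (ht : 0 < t) (n : ℕ) :
    IntegrableOn (fun z : ℝ => z ^ (2 * n) * (Real.exp (-t * z ^ 2) * z ^ (2 * α + 1)))
      (Ioi 0) := by
  -- The integral of a nonintegrable function is 0 by convention, so a nonzero value proves
  -- integrability.
  refine not_imp_comm.1 integral_undef ?_
  rw [integral_pow_mul_gaussian hα ht]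
  have := gamma_pos_of_neg_one_lt hα n
  positivity

/-- The coefficients of the double series of `E_α(a z²) E_α(b z²)`. -/
def coeffProd (α a b : ℝ) (p : ℕ × ℕ) : ℝ := (coeffE α p.1 * a ^ p.1) * (coeffE α p.2 * b ^ p.2)

theorem abs_coeffProd {α : ℝ} (hα : -1 < α) (a b : ℝ) (p : ℕ × ℕ) :
    |coeffProd α a b p| = coeffProd α |a| |b| p := by
  simp only [coeffProd, abs_mul, abs_pow, abs_of_pos (coeffE_pos hα _)]

/-- Each Gaussian moment contributes `Γ(m + n + α + 1)`, so the integrated series is the double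
series for `e^(A+B) E_α(AB)` at `A = a/t`, `B = b/t`. -/
theorem hasSum_integral_coeffProd {α t : ℝ} (hα : -1 < α) (ht : 0 < t) (a b : ℝ) :
    HasSum (fun p : ℕ × ℕ => ∫ z in Ioi (0 : ℝ), coeffProd α a b p * (z ^ (2 * (p.1 + p.2)) *
        (Real.exp (-t * z ^ 2) * z ^ (2 * α + 1))))
      (1 / 2 * t ^ (-(α + 1)) * (Real.exp ((a + b) / t) * besselE α (a * b / t ^ 2))) := by
  have h := (hasSum_coeffE_mul_coeffE_mul_gamma hα (a / t) (b / t)).mul_left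
    (1 / 2 * t ^ (-(α + 1)))
  have e1 : a / t + b / t = (a + b) / t := by ring
  have e2 : a / t * (b / t) = a * b / t ^ 2 := by ring
  rw [e1, e2] at h
  refine h.congr_fun fun p => ?_
  rw [integral_const_mul, integral_pow_mul_gaussian hα ht, coeffProd]
  push_cast
  rw [one_div t, inv_pow, div_pow a, div_pow b, pow_add]
  field_simp

theorem besselE_mul_besselE {α : ℝ} (hα : -1 < α) (a b z : ℝ) :
    besselE α (a * z ^ 2) * besselE α (b * z ^ 2) =
      ∑' p : ℕ × ℕ, coeffProd α a b p * z ^ (2 * (p.1 + p.2)) := by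
  have h1 := summable_coeffE hα (a * z ^ 2)
  have h2 := summable_coeffE hα (b * z ^ 2)
  unfold besselE
  rw [h1.tsum_mul_tsum h2 (summable_mul_of_summable_norm h1.norm h2.norm)]
  refine tsum_congr fun p => ?_
  rw [coeffProd, mul_pow, mul_pow, ← pow_mul, ← pow_mul, mul_add, pow_add]
  ring

/-- Weber's second exponential integral. -/
theorem integral_gaussian_mul_besselE {α t : ℝ} (hα : -1 < α) (ht : 0 < t) (a b : ℝ) :
    ∫ z in Ioi (0 : ℝ), (besselE α (a * z ^ 2) * besselE α (b * z ^ 2)) *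
        (Real.exp (-t * z ^ 2) * z ^ (2 * α + 1)) =
      1 / 2 * t ^ (-(α + 1)) * (Real.exp ((a + b) / t) * besselE α (a * b / t ^ 2)) := by
  have hint : ∀ p : ℕ × ℕ, IntegrableOn (fun z : ℝ => coeffProd α a b p *
      (z ^ (2 * (p.1 + p.2)) * (Real.exp (-t * z ^ 2) * z ^ (2 * α + 1)))) (Ioi 0) :=
    fun p => (integrable_pow_mul_gaussian hα ht (p.1 + p.2)).const_mul _
  -- The norms are the same terms for `|a|` and `|b|`, so the evaluated series itself provides the
  -- summability that justifies integration term by term.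
  have hsum : Summable fun p : ℕ × ℕ => ∫ z in Ioi (0 : ℝ), ‖coeffProd α a b p *
      (z ^ (2 * (p.1 + p.2)) * (Real.exp (-t * z ^ 2) * z ^ (2 * α + 1)))‖ := by
    refine (hasSum_integral_coeffProd hα ht |a| |b|).summable.congr fun p => ?_
    refine setIntegral_congr_fun measurableSet_Ioi fun z hz => ?_
    have hz : 0 < z := hz
    have hp : 0 ≤ z ^ (2 * (p.1 + p.2)) * (Real.exp (-t * z ^ 2) * z ^ (2 * α + 1)) := by
      positivity
    simp only [norm_mul, Real.norm_eq_abs, abs_coeffProd hα] at hp ⊢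
    rw [← abs_mul, ← abs_mul, abs_of_nonneg hp]
  have h := hasSum_integral_of_summable_integral_norm hint hsum
  rw [← h.unique (hasSum_integral_coeffProd hα ht a b)]
  refine integral_congr_ae (Eventually.of_forall fun z => ?_)
  simp only [← mul_assoc]
  simp only [tsum_mul_right, ← besselE_mul_besselE hα]

theorem integrable_gaussian_mul_besselE {α t : ℝ} (hα : -1 < α) (ht : 0 < t) (a b : ℝ) :
    IntegrableOn (fun z : ℝ => (besselE α (a * z ^ 2) * besselE α (b * z ^ 2)) *
        (Real.exp (-t * z ^ 2) * z ^ (2 * α + 1))) (Ioi 0) := by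
  have hpos : IntegrableOn (fun z : ℝ => (besselE α (|a| * z ^ 2) * besselE α (|b| * z ^ 2)) *
        (Real.exp (-t * z ^ 2) * z ^ (2 * α + 1))) (Ioi 0) := by
    refine not_imp_comm.1 integral_undef ?_
    rw [integral_gaussian_mul_besselE hα ht]
    have : 0 < besselE α (|a| * |b| / t ^ 2) := besselE_pos hα (by positivity)
    positivity
  refine hpos.mono' ?_ ?_
  · have := (continuous_besselE hα).measurable
    refine Measurable.aestronglyMeasurable ?_
    fun_prop
  · filter_upwards [ae_restrict_mem measurableSet_Ioi] with z hz
    have hz : 0 < z := hz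
    have h1 : |besselE α (a * z ^ 2)| ≤ besselE α (|a| * z ^ 2) := by
      have h := abs_besselE_le hα (a * z ^ 2)
      have e : |a * z ^ 2| = |a| * z ^ 2 := by rw [abs_mul, abs_of_nonneg (sq_nonneg z)]
      rwa [e] at h
    have h2 : |besselE α (b * z ^ 2)| ≤ besselE α (|b| * z ^ 2) := by
      have h := abs_besselE_le hα (b * z ^ 2)
      have e : |b * z ^ 2| = |b| * z ^ 2 := by rw [abs_mul, abs_of_nonneg (sq_nonneg z)]
      rwa [e] at h
    have hp : 0 ≤ Real.exp (-t * z ^ 2) * z ^ (2 * α + 1) := by positivity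
    rw [norm_mul, norm_mul, Real.norm_eq_abs, Real.norm_eq_abs, Real.norm_eq_abs,
      abs_of_nonneg hp]
    exact mul_le_mul_of_nonneg_right (mul_le_mul h1 h2 (abs_nonneg _)
      ((abs_nonneg _).trans h1)) hp

/-! ### The mass of the exotic kernel -/

/-- An incomplete gamma bound. In `∫ x^(μ-1) e^(w(1-x)) dx` over `(0,1)`, the expansion of the
exponential yields beta integrals `Γ(μ) m!/Γ(m+μ+1)`, while over `(0,∞)` the value is `e^w w^(-μ)
Γ(μ)`. -/
theorem sum_rpow_div_gamma_le_exp {μ w : ℝ} (hμ : 0 < μ) (hw : 0 ≤ w) (N : ℕ) :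
    w ^ μ * ∑ m ∈ Finset.range N, w ^ m / Real.Gamma ((m : ℝ) + μ + 1) ≤ Real.exp w := by
  rcases hw.eq_or_lt with rfl | hw
  · simp [Real.zero_rpow hμ.ne']
  have hΓ : 0 < Real.Gamma μ := Real.Gamma_pos_of_pos hμ
  have hbeta : ∀ m : ℕ, ∫⁻ x in Ioo (0 : ℝ) 1, ENNReal.ofReal (x ^ (μ - 1) * (1 - x) ^ m) =
      ENNReal.ofReal (ProbabilityTheory.beta μ (m + 1)) := by
    intro m
    have hm : (0 : ℝ) < m + 1 := by positivity
    have hb := ProbabilityTheory.beta_pos hμ hm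
    have h1 := ProbabilityTheory.lintegral_betaPDF_eq_one hμ hm
    rw [ProbabilityTheory.lintegral_betaPDF] at h1
    have : ∀ x : ℝ, ENNReal.ofReal (x ^ (μ - 1) * (1 - x) ^ m) =
        ENNReal.ofReal (ProbabilityTheory.beta μ (m + 1)) *
        ENNReal.ofReal (1 / ProbabilityTheory.beta μ (m + 1) * x ^ (μ - 1) *
          (1 - x) ^ ((m : ℝ) + 1 - 1)) := by
      intro x
      rw [← ENNReal.ofReal_mul hb.le, add_sub_cancel_right, Real.rpow_natCast]
      congr 1
      field_simp
    simp_rw [this]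
    rw [lintegral_const_mul _ (by fun_prop), h1, mul_one]
  have hexp : ∫⁻ x in Ioi (0 : ℝ), ENNReal.ofReal (x ^ (μ - 1) * Real.exp (-(w * x))) =
      ENNReal.ofReal ((1 / w) ^ μ * Real.Gamma μ) := by
    rw [← Real.integral_rpow_mul_exp_neg_mul_Ioi hμ hw, ofReal_integral_eq_lintegral_ofReal]
    · refine not_imp_comm.1 integral_undef ?_
      rw [Real.integral_rpow_mul_exp_neg_mul_Ioi hμ hw]
      positivity
    · filter_upwards [ae_restrict_mem measurableSet_Ioi] with x hx
      have hx : 0 < x := hx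
      simp only [Pi.zero_apply]
      positivity
  have key : ENNReal.ofReal (∑ m ∈ Finset.range N,
      w ^ m / m.factorial * ProbabilityTheory.beta μ (m + 1)) ≤
      ENNReal.ofReal (Real.exp w * ((1 / w) ^ μ * Real.Gamma μ)) := by
    rw [ENNReal.ofReal_sum_of_nonneg fun m _ => mul_nonneg (by positivity)
      (ProbabilityTheory.beta_pos hμ (by positivity)).le, ENNReal.ofReal_mul (Real.exp_pos w).le,
      ← hexp, ← lintegral_const_mul _ (by fun_prop)]
    have : ∀ m : ℕ, ENNReal.ofReal (w ^ m / m.factorial * ProbabilityTheory.beta μ (m + 1)) =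
        ∫⁻ x in Ioo (0 : ℝ) 1, ENNReal.ofReal (w ^ m / m.factorial) *
          ENNReal.ofReal (x ^ (μ - 1) * (1 - x) ^ m) := by
      intro m
      rw [lintegral_const_mul _ (by fun_prop), hbeta, ← ENNReal.ofReal_mul (by positivity)]
    simp_rw [this]
    rw [← lintegral_finsetSum _ (by fun_prop)]
    refine le_trans ?_ (lintegral_mono_set (Ioo_subset_Ioi_self : Ioo (0 : ℝ) 1 ⊆ Ioi 0))
    refine setLIntegral_mono' measurableSet_Ioo fun x hx => ?_
    have hx0 : 0 < x := hx.1
    have hx1 : 0 < 1 - x := by linarith [hx.2]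
    simp_rw [← ENNReal.ofReal_mul' (show 0 ≤ x ^ (μ - 1) * (1 - x) ^ _ by positivity)]
    rw [← ENNReal.ofReal_sum_of_nonneg fun m _ => by positivity,
      ← ENNReal.ofReal_mul (Real.exp_pos w).le]
    refine ENNReal.ofReal_le_ofReal ?_
    have h1 := Real.sum_le_exp_of_nonneg (mul_nonneg hw.le hx1.le) N
    have h2 : Real.exp (w * (1 - x)) = Real.exp w * Real.exp (-(w * x)) := by
      rw [← Real.exp_add]; congr 1; ring
    rw [h2] at h1
    have h3 := mul_le_mul_of_nonneg_left h1 (show 0 ≤ x ^ (μ - 1) by positivity)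
    calc _ = x ^ (μ - 1) * ∑ i ∈ Finset.range N, (w * (1 - x)) ^ i / i.factorial := by
          rw [Finset.mul_sum]
          refine Finset.sum_congr rfl fun m _ => ?_
          rw [mul_pow]
          ring
      _ ≤ _ := h3
      _ = _ := by ring
  rw [ENNReal.ofReal_le_ofReal_iff (by positivity)] at key
  have e : ∑ m ∈ Finset.range N, w ^ m / m.factorial * ProbabilityTheory.beta μ (m + 1) =
      Real.Gamma μ * ∑ m ∈ Finset.range N, w ^ m / Real.Gamma ((m : ℝ) + μ + 1) := by
    rw [Finset.mul_sum]
    refine Finset.sum_congr rfl fun m _ => ?_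
    have hm : (0 : ℝ) < m.factorial := by exact_mod_cast m.factorial_pos
    rw [ProbabilityTheory.beta, Real.Gamma_nat_eq_factorial]
    have : μ + ((m : ℝ) + 1) = (m : ℝ) + μ + 1 := by ring
    rw [this]
    field_simp
  have e2 : (1 / w) ^ μ = (w ^ μ)⁻¹ := by rw [one_div, Real.inv_rpow hw.le]
  have hwμ : 0 < w ^ μ := by positivity
  rw [e, e2] at key
  have : Real.exp w * ((w ^ μ)⁻¹ * Real.Gamma μ) = Real.Gamma μ * (Real.exp w / w ^ μ) := by
    field_simp
  rw [this] at key
  have := le_of_mul_le_mul_left key hΓ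
  rw [le_div_iff₀ hwμ] at this
  linarith

/-- Bound behind the sub-Markov property of the exotic kernel. -/
theorem lintegral_gaussian_mul_besselE_mul_id_le {μ t x : ℝ} (hμ : 0 < μ) (ht : 0 < t) :
    ENNReal.ofReal (2 * (4 * t) ^ (-μ - 1) * Real.exp (-x ^ 2 / (4 * t)) * (x ^ 2) ^ μ) *
      ∫⁻ y in Ioi (0 : ℝ), ENNReal.ofReal
        (Real.exp (-(1 / (4 * t)) * y ^ 2) * besselE μ (x ^ 2 / (16 * t ^ 2) * y ^ 2) * y) ≤ 1 := by
  have hμ' : -1 < μ := by linarith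
  have hb : 0 ≤ x ^ 2 / (16 * t ^ 2) := by positivity
  have ht' : 0 < 1 / (4 * t) := by positivity
  -- Against the weight `y` the Gaussian moments are multiples of `m!`, which cancels the factorial
  -- in `coeffE` and leaves only `1/Γ(m+μ+1)`.
  have e1 : ∫⁻ y in Ioi (0 : ℝ), ENNReal.ofReal
        (Real.exp (-(1 / (4 * t)) * y ^ 2) * besselE μ (x ^ 2 / (16 * t ^ 2) * y ^ 2) * y) =
      ∑' m : ℕ, ENNReal.ofReal (2 * t * ((x ^ 2 / (4 * t)) ^ m /
        Real.Gamma ((m : ℝ) + μ + 1))) := by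
    have : ∀ y ∈ Ioi (0 : ℝ), ENNReal.ofReal (Real.exp (-(1 / (4 * t)) * y ^ 2) *
        besselE μ (x ^ 2 / (16 * t ^ 2) * y ^ 2) * y) =
        ∑' m : ℕ, ENNReal.ofReal (coeffE μ m * (x ^ 2 / (16 * t ^ 2)) ^ m *
          (y ^ (2 * m) * (Real.exp (-(1 / (4 * t)) * y ^ 2) * y ^ (2 * (0 : ℝ) + 1)))) := by
      intro y hy
      have hy : 0 < y := hy
      have hs := (summable_coeffE hμ' (x ^ 2 / (16 * t ^ 2) * y ^ 2)).mul_left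
        (Real.exp (-(1 / (4 * t)) * y ^ 2) * y)
      have h0 := fun m => coeffE_pos hμ' m
      have e : ∀ m : ℕ, Real.exp (-(1 / (4 * t)) * y ^ 2) * y *
          (coeffE μ m * (x ^ 2 / (16 * t ^ 2) * y ^ 2) ^ m) =
          coeffE μ m * (x ^ 2 / (16 * t ^ 2)) ^ m *
          (y ^ (2 * m) * (Real.exp (-(1 / (4 * t)) * y ^ 2) * y ^ (2 * (0 : ℝ) + 1))) := by
        intro m
        rw [mul_zero, zero_add, Real.rpow_one, mul_pow, ← pow_mul]
        ring
      rw [mul_right_comm, besselE, ← tsum_mul_left, ENNReal.ofReal_tsum_of_nonneg _ hs]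
      · exact tsum_congr fun m => by rw [e]
      · intro m
        have := h0 m
        positivity
    rw [setLIntegral_congr_fun measurableSet_Ioi this, lintegral_tsum (by fun_prop)]
    refine tsum_congr fun m => ?_
    have h0 := coeffE_pos hμ' m
    rw [← ofReal_integral_eq_lintegral_ofReal, integral_const_mul,
      integral_pow_mul_gaussian (by norm_num) ht']
    · congr 1
      have hm : (0 : ℝ) < m.factorial := by exact_mod_cast m.factorial_pos
      have hg := gamma_pos_of_neg_one_lt hμ' m
      rw [add_zero, Real.Gamma_nat_eq_factorial, zero_add, Real.rpow_neg_one, coeffE,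
        one_div_one_div,
        div_pow, div_pow, mul_pow 16]
      have : (16 : ℝ) ^ m = 4 ^ m * 4 ^ m := by rw [← mul_pow]; norm_num
      rw [this, mul_pow 4]
      field_simp
      ring
    · exact (integrable_pow_mul_gaussian (by norm_num) ht' m).const_mul _
    · filter_upwards [ae_restrict_mem measurableSet_Ioi] with y hy
      have hy : 0 < y := hy
      simp only [Pi.zero_apply]
      positivity
  set w : ℝ := x ^ 2 / (4 * t)
  have hw : 0 ≤ w := by positivity
  rw [e1, ← ENNReal.tsum_mul_left]
  refine ENNReal.tsum_le_of_sum_range_le fun N => ?_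
  have hg := fun m => gamma_pos_of_neg_one_lt hμ' m
  have e2 : ∀ m : ℕ, 0 ≤ 2 * t * (w ^ m / Real.Gamma ((m : ℝ) + μ + 1)) := fun m => by
    have := hg m
    positivity
  rw [← Finset.mul_sum, ← ENNReal.ofReal_sum_of_nonneg fun m _ => e2 m,
    ← ENNReal.ofReal_mul (by positivity), ← ENNReal.ofReal_one]
  refine ENNReal.ofReal_le_ofReal ?_
  have h := sum_rpow_div_gamma_le_exp hμ hw N
  have e3 : w ^ μ = (x ^ 2) ^ μ * ((4 * t) ^ μ)⁻¹ := by
    rw [Real.div_rpow (by positivity) (by positivity)]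
    rfl
  have e4 : (4 * t) ^ (-μ - 1) = ((4 * t) ^ μ)⁻¹ * (4 * t)⁻¹ := by
    rw [Real.rpow_sub (by positivity), Real.rpow_neg (by positivity), Real.rpow_one]
    rfl
  have e5 : -x ^ 2 / (4 * t) = - w := by simp only [w]; ring
  rw [e4, e5, ← Finset.mul_sum]
  rw [e3] at h
  set S := ∑ m ∈ Finset.range N, w ^ m / Real.Gamma ((m : ℝ) + μ + 1)
  have h2 := mul_le_mul_of_nonneg_left h (Real.exp_pos (-w)).le
  rw [← Real.exp_add, neg_add_cancel, Real.exp_zero] at h2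
  refine le_of_eq_of_le ?_ h2
  field_simp
  ring

/-! ### Growth of the Bessel series -/

/-- Regard `coeffE α m * w^m`, with `w = u²/4`, as unnormalized probabilities. The recurrence says
that `m(m+α)` has mean `w`, and Cauchy–Schwarz bounds the squared mean of `m` by the mean of `m²`;
so `mean² ≤ w + |α| mean`, whence `mean ≤ u/2 + |α|`. Twice the mean is `u` times the logarithmic
derivative of `E_α(u²/4)`. -/
theorem tsum_mul_coeffE_le {α : ℝ} (hα : -1 < α) {u : ℝ} (hu : 0 ≤ u) :
    2 * ∑' m : ℕ, (m : ℝ) * (coeffE α m * (u ^ 2 / 4) ^ m) ≤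
      (u + 2 * |α|) * besselE α (u ^ 2 / 4) := by
  set w : ℝ := u ^ 2 / 4
  have hw : 0 ≤ w := by positivity
  set S := besselE α w
  have hS : 0 < S := besselE_pos hα hw
  have s1 : Summable fun m : ℕ => (m : ℝ) * (coeffE α m * w ^ m) := by
    simpa using summable_mul_pow_coeffE hα 1 w
  have s2 := summable_mul_pow_coeffE hα 2 w
  set M := ∑' m : ℕ, (m : ℝ) * (coeffE α m * w ^ m)
  set Q := ∑' m : ℕ, (m : ℝ) ^ 2 * (coeffE α m * w ^ m)
  have h0 := hasSum_besselE hα w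
  have hM0 : 0 ≤ M := tsum_nonneg fun m => by
    have := coeffE_pos hα m
    positivity
  have hQ : HasSum (fun m : ℕ => (m : ℝ) * ((m : ℝ) + α) * (coeffE α m * w ^ m)) (Q + α * M) := by
    have := s2.hasSum.add (s1.hasSum.mul_left α)
    refine this.congr_fun fun m => ?_
    ring
  have hQ' : HasSum (fun m : ℕ => (m : ℝ) * ((m : ℝ) + α) * (coeffE α m * w ^ m)) (w * S) := by
    rw [← hasSum_nat_add_iff' 1]
    simp only [Finset.range_one, Finset.sum_singleton, Nat.cast_zero, zero_mul, sub_zero]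
    refine (h0.mul_left w).congr_fun fun m => ?_
    rw [← coeffE_succ hα m]
    push_cast
    ring
  have hQe : Q + α * M = w * S := hQ.unique hQ'
  -- The second moment about `r`; the choice `r = M / S`, the mean, gives Cauchy–Schwarz.
  have hsq : ∀ r : ℝ, 0 ≤ Q - 2 * r * M + r ^ 2 * S := by
    intro r
    have h := (s2.hasSum.sub (s1.hasSum.mul_left (2 * r))).add (h0.mul_left (r ^ 2))
    refine h.nonneg fun m => ?_
    have := coeffE_pos hα m
    have e : (m : ℝ) ^ 2 * (coeffE α m * w ^ m) - 2 * r * ((m : ℝ) * (coeffE α m * w ^ m)) +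
      r ^ 2 * (coeffE α m * w ^ m) = ((m : ℝ) - r) ^ 2 * (coeffE α m * w ^ m) := by ring
    rw [e]
    positivity
  have hCS : M ^ 2 ≤ S * Q := by
    have h := hsq (M / S)
    have e : Q - 2 * (M / S) * M + (M / S) ^ 2 * S = (S * Q - M ^ 2) / S := by
      field_simp
      ring
    rw [e] at h
    have := (div_nonneg_iff.1 h).resolve_right fun h => absurd hS (not_lt.2 h.2)
    linarith [this.1]
  have hα' : -α * M ≤ |α| * M := mul_le_mul_of_nonneg_right (neg_le_abs α) hM0
  have hCS2 : M ^ 2 ≤ S * (w * S + |α| * M) :=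
    hCS.trans (mul_le_mul_of_nonneg_left (by linarith) hS.le)
  by_contra hcon
  rw [not_le] at hcon
  have h1 : u / 2 * S < M - |α| * S := by linarith
  have h2 : u / 2 * S < M := by
    have : 0 ≤ |α| * S := by positivity
    linarith
  have h3 : 0 ≤ u / 2 * S := by positivity
  have h4 : (u / 2 * S) * (u / 2 * S) < (M - |α| * S) * M := mul_lt_mul'' h1 h2 h3 h3
  have h5 : (u / 2 * S) * (u / 2 * S) = S * (w * S) := by simp only [w]; ring
  nlinarith

/-- The function `e^{-u} E_α(u²/4)`. -/
def scaledE (α u : ℝ) : ℝ := Real.exp (-u) * besselE α (u ^ 2 / 4)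

/-- An exponent controlling the growth of `scaledE`. -/
def growthExp (α : ℝ) : ℕ := ⌈2 * |α|⌉₊ + 1

theorem scaledE_pos {α : ℝ} (hα : -1 < α) (u : ℝ) : 0 < scaledE α u :=
  mul_pos (Real.exp_pos _) (besselE_pos hα (by positivity))

/-- The logarithmic derivative of `E_α(u²/4)` is at most `1 + 2|α|/u`. The factor `e^(-u)` removes
the 1, and division by `u^p` with `p ≥ 2|α|` removes the rest. -/
theorem antitoneOn_scaledE_div {α : ℝ} (hα : -1 < α) :
    AntitoneOn (fun u => scaledE α u / u ^ growthExp α) (Ioi 0) := by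
  set p := growthExp α with hp
  have hp1 : 2 * |α| ≤ p := by
    rw [hp, growthExp]
    push_cast
    linarith [Nat.le_ceil (2 * |α|)]
  have hder : ∀ u ∈ Ioi (0 : ℝ), HasDerivAt (fun u => scaledE α u / u ^ p)
      (((Real.exp (-u) * (-1) * besselE α (u ^ 2 / 4) + Real.exp (-u) *
        ((∑' m : ℕ, (m : ℝ) * coeffE α m * (u ^ 2 / 4) ^ (m - 1)) *
          (((2 : ℕ) : ℝ) * u ^ (2 - 1) / 4))) * u ^ p -
        scaledE α u * (p * u ^ (p - 1))) / (u ^ p) ^ 2) u := by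
    intro u hu
    have hu : 0 < u := hu
    have h1 := (hasDerivAt_besselE hα (u ^ 2 / 4)).comp u ((hasDerivAt_pow 2 u).div_const 4)
    have h2 := (hasDerivAt_neg u).exp
    exact (h2.mul h1).div (hasDerivAt_pow p u) (by positivity)
  refine antitoneOn_of_deriv_nonpos (convex_Ioi 0)
    (fun u hu => (hder u hu).continuousAt.continuousWithinAt)
    (fun u hu => (hder u (interior_subset hu)).differentiableAt.differentiableWithinAt) ?_
  intro u hu
  rw [interior_Ioi] at hu
  rw [(hder u hu).deriv]
  have hu : 0 < u := hu
  refine div_nonpos_of_nonpos_of_nonneg ?_ (by positivity)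
  have hM : u * ((∑' m : ℕ, (m : ℝ) * coeffE α m * (u ^ 2 / 4) ^ (m - 1)) *
      (((2 : ℕ) : ℝ) * u ^ (2 - 1) / 4)) =
      2 * ∑' m : ℕ, (m : ℝ) * (coeffE α m * (u ^ 2 / 4) ^ m) := by
    rw [mul_comm, mul_assoc, ← tsum_mul_right, ← tsum_mul_left]
    refine tsum_congr fun m => ?_
    cases m with
    | zero => simp
    | succ m =>
      simp only [Nat.add_sub_cancel, pow_succ]
      push_cast
      ring
  have hle := tsum_mul_coeffE_le hα hu.le
  rw [← hM] at hle
  set D := (∑' m : ℕ, (m : ℝ) * coeffE α m * (u ^ 2 / 4) ^ (m - 1)) *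
      (((2 : ℕ) : ℝ) * u ^ (2 - 1) / 4)
  have hS := besselE_pos hα (show 0 ≤ u ^ 2 / 4 by positivity)
  have hpow : u ^ p = u * u ^ (p - 1) := by
    rw [← pow_succ']
    rfl
  have hkey : u * D - (u + p) * besselE α (u ^ 2 / 4) ≤ 0 := by
    have := mul_le_mul_of_nonneg_right hp1 hS.le
    linarith
  have e : (Real.exp (-u) * (-1) * besselE α (u ^ 2 / 4) + Real.exp (-u) * D) * u ^ p -
      scaledE α u * (p * u ^ (p - 1)) =
      Real.exp (-u) * u ^ (p - 1) * (u * D - (u + p) * besselE α (u ^ 2 / 4)) := by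
    rw [hpow, scaledE]
    ring
  rw [e]
  exact mul_nonpos_of_nonneg_of_nonpos (by positivity) hkey

theorem scaledE_le_of_le {α : ℝ} (hα : -1 < α) {v c : ℝ} (hv : 0 ≤ v) (hc : 1 ≤ c) :
    scaledE α (c * v) ≤ c ^ growthExp α * scaledE α v := by
  rcases hv.eq_or_lt with rfl | hv
  · rw [mul_zero]
    exact le_mul_of_one_le_left (scaledE_pos hα 0).le (one_le_pow₀ hc)
  · have h := antitoneOn_scaledE_div hα (show v ∈ Ioi (0 : ℝ) from hv)
      (show c * v ∈ Ioi (0 : ℝ) from by have : 0 < c * v := by positivity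
                                        exact this) (le_mul_of_one_le_left hv.le hc)
    simp only at h
    rw [div_le_div_iff₀ (by positivity) (by positivity), mul_pow] at h
    have hvp : 0 < v ^ growthExp α := by positivity
    refine le_of_mul_le_mul_right ?_ hvp
    linarith

/-- On `[0,1]` the series is monotone and `e^(-u) ≤ 1`; beyond 1 the dilation bound is applied from
the point 1. -/
theorem scaledE_le {α : ℝ} (hα : -1 < α) {u : ℝ} (hu : 0 ≤ u) :
    scaledE α u ≤ besselE α (1 / 4) * (1 + u) ^ growthExp α := by
  have h1 : 0 < besselE α (1 / 4) := besselE_pos hα (by norm_num)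
  rcases le_total u 1 with hu1 | hu1
  · have h2 : scaledE α u ≤ 1 * besselE α (1 / 4) := by
      refine mul_le_mul (Real.exp_le_one_iff.2 (by linarith))
        (besselE_mono hα (by positivity) ?_) (besselE_pos hα (by positivity)).le zero_le_one
      nlinarith
    rw [one_mul] at h2
    exact h2.trans (le_mul_of_one_le_right h1.le (one_le_pow₀ (by linarith)))
  · have h2 := scaledE_le_of_le hα zero_le_one hu1
    rw [mul_one] at h2
    have h3 : scaledE α 1 ≤ besselE α (1 / 4) := by
      have : scaledE α 1 = Real.exp (-1) * besselE α (1 / 4) := by simp [scaledE]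
      rw [this]
      exact mul_le_of_le_one_left h1.le (Real.exp_le_one_iff.2 (by norm_num))
    have h4 : u ^ growthExp α ≤ (1 + u) ^ growthExp α := pow_le_pow_left₀ hu (by linarith) _
    calc _ ≤ _ := h2
      _ ≤ (1 + u) ^ growthExp α * besselE α (1 / 4) :=
        mul_le_mul h4 h3 (scaledE_pos hα 1).le (by positivity)
      _ = _ := mul_comm _ _

/-! ### The closed form of the heat kernel and its dependence on time -/

/-- The one-dimensional Bessel heat kernel of type `α`, in closed form. -/
def heatCls (α t x y : ℝ) : ℝ :=
  2 * (4 * t) ^ (-α - 1) * Real.exp (-(x ^ 2 + y ^ 2) / (4 * t)) *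
    besselE α (x ^ 2 * y ^ 2 / (16 * t ^ 2))

/-- The heat kernel of type `α` multiplied by `(xy)^{2β}`. For `β = 0` and `α = β` these are the
classical and the exotic kernels. -/
def heatK (α β t x y : ℝ) : ℝ := (x ^ 2) ^ β * (y ^ 2) ^ β * heatCls α t x y

/-- Completing the square isolates a genuine Gaussian in `|x| - |y|`; what remains, `scaledE`, has
only polynomial growth. -/
theorem heatCls_eq (α : ℝ) {t : ℝ} (ht : 0 < t) (x y : ℝ) :
    heatCls α t x y = 2 * (4 * t) ^ (-α - 1) * (Real.exp (-(|x| - |y|) ^ 2 / (4 * t)) *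
      scaledE α (|x| * |y| / (2 * t))) := by
  have e1 : (|x| * |y| / (2 * t)) ^ 2 / 4 = x ^ 2 * y ^ 2 / (16 * t ^ 2) := by
    rw [div_pow, mul_pow, sq_abs, sq_abs]
    field_simp
    ring
  have e2 : -(x ^ 2 + y ^ 2) / (4 * t) =
      -(|x| - |y|) ^ 2 / (4 * t) + -(|x| * |y| / (2 * t)) := by
    rw [← sq_abs x, ← sq_abs y]
    field_simp
    ring
  rw [heatCls, scaledE, e1, e2, Real.exp_add]
  ring

theorem heatCls_pos {α : ℝ} (hα : -1 < α) {t : ℝ} (ht : 0 < t) (x y : ℝ) :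
    0 < heatCls α t x y := by
  have := besselE_pos hα (show 0 ≤ x ^ 2 * y ^ 2 / (16 * t ^ 2) by positivity)
  unfold heatCls
  positivity

theorem heatK_nonneg {α : ℝ} (hα : -1 < α) (β : ℝ) {t : ℝ} (ht : 0 < t) (x y : ℝ) :
    0 ≤ heatK α β t x y := by
  have := heatCls_pos hα ht x y
  unfold heatK
  positivity

theorem heatK_symm (α β t x y : ℝ) : heatK α β t x y = heatK α β t y x := by
  unfold heatK heatCls
  rw [add_comm (x ^ 2), mul_comm (x ^ 2) (y ^ 2), mul_comm ((x ^ 2) ^ β)]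

theorem continuous_heatK {α β : ℝ} (hα : -1 < α) (hβ : 0 ≤ β) (t : ℝ) :
    Continuous fun p : ℝ × ℝ => heatK α β t p.1 p.2 := by
  have h := continuous_besselE hα
  unfold heatK heatCls
  refine (Continuous.mul ?_ ?_).mul ((Continuous.mul continuous_const ?_).mul ?_)
  · exact (continuous_fst.pow 2).rpow_const fun _ => Or.inr hβ
  · exact (continuous_snd.pow 2).rpow_const fun _ => Or.inr hβ
  · fun_prop
  · fun_prop

theorem continuousAt_heatK_time {α : ℝ} (hα : -1 < α) (β x y : ℝ) {t : ℝ} (ht : 0 < t) :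
    ContinuousAt (fun t => heatK α β t x y) t := by
  have h := continuous_besselE hα
  unfold heatK heatCls
  have h4 : 4 * t ≠ 0 := by positivity
  have h16 : 16 * t ^ 2 ≠ 0 := by positivity
  refine continuousAt_const.mul ((continuousAt_const.mul ?_).mul ?_ |>.mul ?_)
  · exact (continuousAt_const.mul continuousAt_id).rpow_const (Or.inl h4)
  · exact (continuousAt_const.div (continuousAt_const.mul continuousAt_id) h4).rexp
  · exact h.continuousAt.comp (f := fun t => x ^ 2 * y ^ 2 / (16 * t ^ 2))
      (continuousAt_const.div (continuousAt_const.mul (continuousAt_id.pow 2)) h16)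

/-- The constant in the comparison of heat kernels at comparable times. -/
def timeConst (α : ℝ) : ℝ := 4 ^ (α + 1) * 4 ^ growthExp α

theorem timeConst_nonneg (α : ℝ) : 0 ≤ timeConst α := by
  unfold timeConst
  positivity

/-- With `c = s/t ≤ 4`, the power of `t` costs `c^(α+1)`, the Gaussian increases with time, and the
argument of `scaledE` shrinks by the factor `c`, which costs `c^p`. The factor `(xy)^(2β)` does not
involve time. -/
theorem heatK_le_of_le {α : ℝ} (hα : -1 < α) (β : ℝ) {t s : ℝ} (ht : 0 < t) (hts : t ≤ s)
    (hst : s ≤ 4 * t) (x y : ℝ) : heatK α β t x y ≤ timeConst α * heatK α β s x y := by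
  have hs : 0 < s := ht.trans_le hts
  suffices h : heatCls α t x y ≤ timeConst α * heatCls α s x y by
    unfold heatK
    have := mul_le_mul_of_nonneg_left h (show 0 ≤ (x ^ 2) ^ β * (y ^ 2) ^ β by positivity)
    linarith
  set c := s / t with hc
  have hc1 : 1 ≤ c := (one_le_div ht).2 hts
  have hc4 : c ≤ 4 := (div_le_iff₀ ht).2 hst
  have hs' : s = c * t := by rw [hc]; field_simp
  rw [heatCls_eq α ht, heatCls_eq α hs]
  have e1 : (4 * t) ^ (-α - 1) = c ^ (α + 1) * (4 * s) ^ (-α - 1) := by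
    have : 4 * s = c * (4 * t) := by rw [hs']; ring
    rw [this, Real.mul_rpow (x := c) (y := 4 * t) (by positivity) (by positivity), ← mul_assoc,
      ← Real.rpow_add (by positivity)]
    have : α + 1 + (-α - 1) = 0 := by ring
    rw [this, Real.rpow_zero, one_mul]
  have e2 : |x| * |y| / (2 * t) = c * (|x| * |y| / (2 * s)) := by
    rw [hc]; field_simp
  have h1 : c ^ (α + 1) ≤ 4 ^ (α + 1) :=
    Real.rpow_le_rpow (by positivity) hc4 (by linarith)
  have h2 : Real.exp (-(|x| - |y|) ^ 2 / (4 * t)) ≤ Real.exp (-(|x| - |y|) ^ 2 / (4 * s)) := by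
    refine Real.exp_le_exp.2 ?_
    rw [neg_div, neg_div]
    exact neg_le_neg (div_le_div_of_nonneg_left (sq_nonneg _) (by positivity) (by linarith))
  have h3 : scaledE α (|x| * |y| / (2 * t)) ≤
      4 ^ growthExp α * scaledE α (|x| * |y| / (2 * s)) := by
    rw [e2]
    refine (scaledE_le_of_le hα (by positivity) hc1).trans ?_
    exact mul_le_mul_of_nonneg_right (pow_le_pow_left₀ (by linarith) hc4 _) (scaledE_pos hα _).le
  have h5 := (scaledE_pos hα (|x| * |y| / (2 * t))).le
  have h6 := (scaledE_pos hα (|x| * |y| / (2 * s))).le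
  calc 2 * (4 * t) ^ (-α - 1) * (Real.exp (-(|x| - |y|) ^ 2 / (4 * t)) *
      scaledE α (|x| * |y| / (2 * t)))
      ≤ 2 * (4 ^ (α + 1) * (4 * s) ^ (-α - 1)) * (Real.exp (-(|x| - |y|) ^ 2 / (4 * s)) *
      (4 ^ growthExp α * scaledE α (|x| * |y| / (2 * s)))) := by
        rw [e1]
        gcongr
    _ = _ := by
      unfold timeConst
      ring

/-! ### The one-dimensional measure and eigenfunctions -/

instance sigmaFinite_eta₁ (ν : ℝ) : SigmaFinite (eta₁ ν) := by
  unfold eta₁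
  infer_instance

theorem ae_eta₁_pos (ν : ℝ) : ∀ᵐ z ∂(eta₁ ν), 0 < z := by
  refine (withDensity_absolutelyContinuous _ _).ae_le ?_
  exact ae_restrict_mem measurableSet_Ioi

theorem lintegral_eta₁ (ν : ℝ) (f : ℝ → ℝ≥0∞) :
    ∫⁻ z, f z ∂(eta₁ ν) = ∫⁻ z in Ioi (0 : ℝ), ENNReal.ofReal (z ^ (2 * ν + 1)) * f z := by
  unfold eta₁
  rw [lintegral_withDensity_eq_lintegral_mul_non_measurable _ (by fun_prop)
    (Eventually.of_forall fun _ => ENNReal.ofReal_lt_top)]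
  rfl

theorem integral_eta₁ (ν : ℝ) (f : ℝ → ℝ) :
    ∫ z, f z ∂(eta₁ ν) = ∫ z in Ioi (0 : ℝ), z ^ (2 * ν + 1) * f z := by
  unfold eta₁
  rw [integral_withDensity_eq_integral_toReal_smul (by fun_prop)
    (Eventually.of_forall fun _ => ENNReal.ofReal_lt_top)]
  refine setIntegral_congr_fun measurableSet_Ioi fun z hz => ?_
  have hz : 0 < z := hz
  simp only [smul_eq_mul]
  rw [ENNReal.toReal_ofReal (by positivity)]

theorem integrable_eta₁_iff (ν : ℝ) (f : ℝ → ℝ) :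
    Integrable f (eta₁ ν) ↔ IntegrableOn (fun z => z ^ (2 * ν + 1) * f z) (Ioi 0) := by
  unfold eta₁
  rw [integrable_withDensity_iff_integrable_smul₀' (by fun_prop)
    (Eventually.of_forall fun _ => ENNReal.ofReal_lt_top)]
  refine integrableOn_congr_fun (fun z hz => ?_) measurableSet_Ioi
  have hz : 0 < z := hz
  simp only [smul_eq_mul]
  rw [ENNReal.toReal_ofReal (by positivity)]

/-- The one-dimensional eigenfunctions: classical for `β = 0` and exotic for `β = α`. -/
def eigenfun (α β z x : ℝ) : ℝ :=
  ((x * z) ^ 2) ^ β * (2 ^ (-α) * besselE α (-(x * z) ^ 2 / 4))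

theorem eigenfun_symm (α β z x : ℝ) : eigenfun α β z x = eigenfun α β x z := by
  unfold eigenfun
  rw [mul_comm x z]

theorem continuous_eigenfun {α β : ℝ} (hα : -1 < α) (hβ : 0 ≤ β) :
    Continuous fun p : ℝ × ℝ => eigenfun α β p.1 p.2 := by
  have h := continuous_besselE hα
  unfold eigenfun
  refine Continuous.mul ?_ (by fun_prop)
  exact Continuous.rpow_const (by fun_prop) fun _ => Or.inr hβ

/-- The power factors of two eigenfunctions raise the order of the weight from `α - 2β` to `α`; this
reduces the exotic integrals to classical ones of order `α`. -/
theorem rpow_weight_mul {α β z : ℝ} (hz : 0 < z) :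
    z ^ (2 * (α - 2 * β) + 1) * ((z ^ 2) ^ β * (z ^ 2) ^ β) = z ^ (2 * α + 1) := by
  have : (z ^ 2) ^ β = z ^ (2 * β) := by
    rw [Real.rpow_mul hz.le]
    norm_cast
  rw [this, ← Real.rpow_add hz, ← Real.rpow_add hz]
  congr 1
  ring

theorem weber_integrand {α β t x y z : ℝ} (hz : 0 < z) :
    z ^ (2 * (α - 2 * β) + 1) *
      (Real.exp (-t * z ^ 2) * eigenfun α β z x * eigenfun α β z y) =
    ((x ^ 2) ^ β * (y ^ 2) ^ β * (2 ^ (-α) * 2 ^ (-α))) *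
      ((besselE α (-x ^ 2 / 4 * z ^ 2) * besselE α (-y ^ 2 / 4 * z ^ 2)) *
        (Real.exp (-t * z ^ 2) * z ^ (2 * α + 1))) := by
  have e : ∀ u : ℝ, ((u * z) ^ 2) ^ β = (u ^ 2) ^ β * (z ^ 2) ^ β := fun u => by
    rw [mul_pow, Real.mul_rpow (by positivity) (by positivity)]
  have e2 : ∀ u : ℝ, -(u * z) ^ 2 / 4 = -u ^ 2 / 4 * z ^ 2 := fun u => by ring
  unfold eigenfun
  rw [e, e, e2, e2, ← rpow_weight_mul (α := α) (β := β) hz]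
  ring

theorem integrable_gaussian_mul_eigenfun {α t : ℝ} (hα : -1 < α) (β : ℝ) (ht : 0 < t) (x y : ℝ) :
    Integrable (fun z => Real.exp (-t * z ^ 2) * eigenfun α β z x * eigenfun α β z y)
      (eta₁ (α - 2 * β)) := by
  rw [integrable_eta₁_iff]
  refine (integrableOn_congr_fun (fun z hz => weber_integrand hz) measurableSet_Ioi).2 ?_
  exact (integrable_gaussian_mul_besselE hα ht _ _).const_mul _

theorem integral_gaussian_mul_eigenfun {α t : ℝ} (hα : -1 < α) (β : ℝ) (ht : 0 < t) (x y : ℝ) :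
    ∫ z, Real.exp (-t * z ^ 2) * eigenfun α β z x * eigenfun α β z y ∂(eta₁ (α - 2 * β)) =
      heatK α β t x y := by
  rw [integral_eta₁, setIntegral_congr_fun measurableSet_Ioi (fun z hz => weber_integrand hz),
    integral_const_mul, integral_gaussian_mul_besselE hα ht, heatK, heatCls]
  have e1 : (-x ^ 2 / 4 + -y ^ 2 / 4) / t = -(x ^ 2 + y ^ 2) / (4 * t) := by
    field_simp
    ring
  have e2 : -x ^ 2 / 4 * (-y ^ 2 / 4) / t ^ 2 = x ^ 2 * y ^ 2 / (16 * t ^ 2) := by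
    field_simp
    ring
  have e3 : (4 * t) ^ (-α - 1) = 2 ^ (-α) * 2 ^ (-α) * 4⁻¹ * t ^ (-(α + 1)) := by
    have h4 : (4 : ℝ) = 2 * 2 := by norm_num
    have h5 : -α - 1 = -(α + 1) := by ring
    have h6 : (4 : ℝ) ^ (-α - 1) = 2 ^ (-α) * 2 ^ (-α) * 4⁻¹ := by
      rw [Real.rpow_sub_one (by norm_num), ← Real.mul_rpow (by norm_num) (by norm_num), ← h4,
        div_eq_mul_inv]
    rw [Real.mul_rpow (by norm_num) ht.le, h6, h5]
  rw [e1, e2, e3]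
  ring

/-! ### Semigroup law, mass and bounds in dimension one -/

/-- The Chapman–Kolmogorov identity in dimension one. -/
theorem lintegral_heatK_mul_heatK {α s t : ℝ} (hα : -1 < α) (β : ℝ) (hs : 0 < s) (ht : 0 < t)
    (x z : ℝ) :
    ∫⁻ y, ENNReal.ofReal (heatK α β s x y) * ENNReal.ofReal (heatK α β t y z)
      ∂(eta₁ (α - 2 * β)) = ENNReal.ofReal (heatK α β (s + t) x z) := by
  -- In `y` the product of the kernels is a Gaussian with exponent `τ` times two values of `E_α` at
  -- positive multiples of `y²`, so Weber's integral applies again with `τ` as its time.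
  set τ := 1 / (4 * s) + 1 / (4 * t) with hτ
  have hτ0 : 0 < τ := by positivity
  set c : ℝ := (x ^ 2) ^ β * (z ^ 2) ^ β * (2 * (4 * s) ^ (-α - 1) * (2 * (4 * t) ^ (-α - 1))) *
    Real.exp (-x ^ 2 / (4 * s) + -z ^ 2 / (4 * t)) with hc
  have hc0 : 0 ≤ c := by positivity
  have e : ∀ y ∈ Ioi (0 : ℝ), ENNReal.ofReal (y ^ (2 * (α - 2 * β) + 1)) *
      (ENNReal.ofReal (heatK α β s x y) * ENNReal.ofReal (heatK α β t y z)) =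
      ENNReal.ofReal (c * ((besselE α (x ^ 2 / (16 * s ^ 2) * y ^ 2) *
        besselE α (z ^ 2 / (16 * t ^ 2) * y ^ 2)) *
        (Real.exp (-τ * y ^ 2) * y ^ (2 * α + 1)))) := by
    intro y hy
    have hy : 0 < y := hy
    rw [← ENNReal.ofReal_mul (heatK_nonneg hα β hs x y), ← ENNReal.ofReal_mul (by positivity)]
    congr 1
    have e1 : Real.exp (-(x ^ 2 + y ^ 2) / (4 * s)) * Real.exp (-(y ^ 2 + z ^ 2) / (4 * t)) =
        Real.exp (-x ^ 2 / (4 * s) + -z ^ 2 / (4 * t)) * Real.exp (-τ * y ^ 2) := by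
      rw [← Real.exp_add, ← Real.exp_add]
      congr 1
      rw [hτ]
      field_simp
      ring
    have e2 : x ^ 2 * y ^ 2 / (16 * s ^ 2) = x ^ 2 / (16 * s ^ 2) * y ^ 2 := by ring
    have e3 : y ^ 2 * z ^ 2 / (16 * t ^ 2) = z ^ 2 / (16 * t ^ 2) * y ^ 2 := by ring
    rw [hc, ← rpow_weight_mul (α := α) (β := β) hy, heatK, heatK, heatCls, heatCls, e2, e3]
    calc _ = (y ^ (2 * (α - 2 * β) + 1) * ((y ^ 2) ^ β * (y ^ 2) ^ β)) *
          ((x ^ 2) ^ β * (z ^ 2) ^ β * (2 * (4 * s) ^ (-α - 1) * (2 * (4 * t) ^ (-α - 1)))) *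
          (besselE α (x ^ 2 / (16 * s ^ 2) * y ^ 2) * besselE α (z ^ 2 / (16 * t ^ 2) * y ^ 2)) *
          (Real.exp (-(x ^ 2 + y ^ 2) / (4 * s)) * Real.exp (-(y ^ 2 + z ^ 2) / (4 * t))) := by
            ring
      _ = _ := by
        rw [e1]
        ring
  rw [lintegral_eta₁, setLIntegral_congr_fun measurableSet_Ioi e,
    ← ofReal_integral_eq_lintegral_ofReal, integral_const_mul,
    integral_gaussian_mul_besselE hα hτ0]
  · congr 1
    have e1 : τ = (s + t) / (4 * s * t) := by
      rw [hτ]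
      field_simp
      ring
    have e2 : x ^ 2 / (16 * s ^ 2) * (z ^ 2 / (16 * t ^ 2)) / τ ^ 2 =
        x ^ 2 * z ^ 2 / (16 * (s + t) ^ 2) := by
      rw [e1]
      field_simp
      ring
    have e3 : Real.exp (-x ^ 2 / (4 * s) + -z ^ 2 / (4 * t)) *
        Real.exp ((x ^ 2 / (16 * s ^ 2) + z ^ 2 / (16 * t ^ 2)) / τ) =
        Real.exp (-(x ^ 2 + z ^ 2) / (4 * (s + t))) := by
      rw [← Real.exp_add, e1]
      congr 1
      field_simp
      ring
    have e4 : (4 * s) ^ (-α - 1) * (4 * t) ^ (-α - 1) * τ ^ (-(α + 1)) =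
        (4 * (s + t)) ^ (-α - 1) := by
      have : -(α + 1) = -α - 1 := by ring
      rw [this, ← Real.mul_rpow (by positivity) (by positivity),
        ← Real.mul_rpow (by positivity) (by positivity), e1]
      congr 1
      field_simp
    rw [e2, heatK, heatCls, ← e3, ← e4, hc]
    ring
  · exact (integrable_gaussian_mul_besselE hα hτ0 _ _).const_mul _
  · filter_upwards [ae_restrict_mem measurableSet_Ioi] with y hy
    have hy : 0 < y := hy
    have h1 := besselE_pos hα (show 0 ≤ x ^ 2 / (16 * s ^ 2) * y ^ 2 by positivity)
    have h2 := besselE_pos hα (show 0 ≤ z ^ 2 / (16 * t ^ 2) * y ^ 2 by positivity)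
    simp only [Pi.zero_apply]
    positivity

/-- Weber's integral with `b = 0`, after inserting the constant `E_α(0)` and dividing by it. The
mass is in fact exactly 1. -/
theorem lintegral_heatK_cls {α t : ℝ} (hα : -1 < α) (ht : 0 < t) (x : ℝ) :
    ∫⁻ y, ENNReal.ofReal (heatK α 0 t x y) ∂(eta₁ (α - 2 * 0)) ≤ 1 := by
  have hτ0 : 0 < 1 / (4 * t) := by positivity
  have hE0 : 0 < besselE α 0 := besselE_pos hα le_rfl
  set c : ℝ := 2 * (4 * t) ^ (-α - 1) * Real.exp (-x ^ 2 / (4 * t)) * (besselE α 0)⁻¹ with hc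
  have hc0 : 0 ≤ c := by positivity
  have e : ∀ y ∈ Ioi (0 : ℝ), ENNReal.ofReal (y ^ (2 * (α - 2 * 0) + 1)) *
      ENNReal.ofReal (heatK α 0 t x y) =
      ENNReal.ofReal (c * ((besselE α (x ^ 2 / (16 * t ^ 2) * y ^ 2) * besselE α (0 * y ^ 2)) *
        (Real.exp (-(1 / (4 * t)) * y ^ 2) * y ^ (2 * α + 1)))) := by
    intro y hy
    have hy : 0 < y := hy
    rw [← ENNReal.ofReal_mul (by positivity)]
    congr 1
    have e1 : Real.exp (-(x ^ 2 + y ^ 2) / (4 * t)) =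
        Real.exp (-x ^ 2 / (4 * t)) * Real.exp (-(1 / (4 * t)) * y ^ 2) := by
      rw [← Real.exp_add]
      congr 1
      field_simp
      ring
    have e2 : x ^ 2 * y ^ 2 / (16 * t ^ 2) = x ^ 2 / (16 * t ^ 2) * y ^ 2 := by ring
    rw [heatK, heatCls, e1, e2, hc, zero_mul, mul_zero, sub_zero, Real.rpow_zero, Real.rpow_zero]
    field_simp
  rw [lintegral_eta₁, setLIntegral_congr_fun measurableSet_Ioi e,
    ← ofReal_integral_eq_lintegral_ofReal, integral_const_mul,
    integral_gaussian_mul_besselE hα hτ0]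
  · rw [← ENNReal.ofReal_one]
    refine ENNReal.ofReal_le_ofReal (le_of_eq ?_)
    have e3 : (4 * t) ^ (-α - 1) * (1 / (4 * t)) ^ (-(α + 1)) = 1 := by
      have : -(α + 1) = -α - 1 := by ring
      rw [this, ← Real.mul_rpow (by positivity) (by positivity)]
      have : 4 * t * (1 / (4 * t)) = 1 := by field_simp
      rw [this, Real.one_rpow]
    have e4 : (x ^ 2 / (16 * t ^ 2) + 0) / (1 / (4 * t)) = x ^ 2 / (4 * t) := by
      field_simp
      norm_num
    have e5 : Real.exp (-x ^ 2 / (4 * t)) * Real.exp (x ^ 2 / (4 * t)) = 1 := by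
      rw [← Real.exp_add, neg_div, neg_add_cancel, Real.exp_zero]
    rw [hc, e4, mul_zero, zero_div]
    calc _ = ((4 * t) ^ (-α - 1) * (1 / (4 * t)) ^ (-(α + 1))) *
          (Real.exp (-x ^ 2 / (4 * t)) * Real.exp (x ^ 2 / (4 * t))) *
          ((besselE α 0)⁻¹ * besselE α 0) := by ring
      _ = 1 := by rw [e3, e5, inv_mul_cancel₀ hE0.ne', mul_one, mul_one]
  · exact (integrable_gaussian_mul_besselE hα hτ0 _ _).const_mul _
  · filter_upwards [ae_restrict_mem measurableSet_Ioi] with y hy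
    have hy : 0 < y := hy
    have h1 := besselE_pos hα (show 0 ≤ x ^ 2 / (16 * t ^ 2) * y ^ 2 by positivity)
    simp only [Pi.zero_apply, zero_mul]
    positivity

/-- The weight `y^(1-2α)` and the factor `(y²)^α` combine to `y`, which leaves the incomplete gamma
estimate. Its proof relies on `0 < α`, that is, on a negative exotic parameter. -/
theorem lintegral_heatK_exo {α t : ℝ} (hα : 0 < α) (ht : 0 < t) (x : ℝ) :
    ∫⁻ y, ENNReal.ofReal (heatK α α t x y) ∂(eta₁ (α - 2 * α)) ≤ 1 := by
  refine le_of_eq_of_le ?_ (lintegral_gaussian_mul_besselE_mul_id_le (x := x) hα ht)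
  have hE := continuous_besselE (show -1 < α by linarith)
  rw [lintegral_eta₁, ← lintegral_const_mul _ (by fun_prop)]
  refine setLIntegral_congr_fun measurableSet_Ioi fun y hy => ?_
  have hy : 0 < y := hy
  rw [← ENNReal.ofReal_mul (by positivity), ← ENNReal.ofReal_mul (by positivity)]
  congr 1
  have e1 : Real.exp (-(x ^ 2 + y ^ 2) / (4 * t)) =
      Real.exp (-x ^ 2 / (4 * t)) * Real.exp (-(1 / (4 * t)) * y ^ 2) := by
    rw [← Real.exp_add]
    congr 1
    field_simp
    ring
  have e2 : x ^ 2 * y ^ 2 / (16 * t ^ 2) = x ^ 2 / (16 * t ^ 2) * y ^ 2 := by ring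
  have e3 : y ^ (2 * (α - 2 * α) + 1) * (y ^ 2) ^ α = y := by
    have : (y ^ 2) ^ α = y ^ (2 * α) := by
      rw [Real.rpow_mul hy.le]
      norm_cast
    rw [this, ← Real.rpow_add hy]
    have : 2 * (α - 2 * α) + 1 + 2 * α = 1 := by ring
    rw [this, Real.rpow_one]
  rw [heatK, heatCls, e1, e2]
  calc _ = (y ^ (2 * (α - 2 * α) + 1) * (y ^ 2) ^ α) * ((x ^ 2) ^ α *
        (2 * (4 * t) ^ (-α - 1) * (Real.exp (-x ^ 2 / (4 * t)) *
        Real.exp (-(1 / (4 * t)) * y ^ 2)) * besselE α (x ^ 2 / (16 * t ^ 2) * y ^ 2))) := by ring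
    _ = _ := by
      rw [e3]
      ring

theorem exists_heatK_le {α β t : ℝ} (hα : -1 < α) (hβ : 0 ≤ β) (ht : 0 < t) (x : ℝ) :
    ∃ C : ℝ, 0 ≤ C ∧ ∀ y, heatK α β t x y ≤ C := by
  set a : ℝ := |x| / (2 * t) with ha
  have ha0 : 0 ≤ a := by positivity
  set p := growthExp α
  set b : ℝ := 2 * β + p * a with hb
  have hb0 : 0 ≤ b := by positivity
  have hE := besselE_pos hα (show (0 : ℝ) ≤ 1 / 4 by norm_num)
  refine ⟨(x ^ 2) ^ β * (2 * (4 * t) ^ (-α - 1) * besselE α (1 / 4) *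
    Real.exp (b * |x| + b ^ 2 * t)), by positivity, fun y => ?_⟩
  have hy : |x| * |y| / (2 * t) = a * |y| := by rw [ha]; ring
  have h1 : (y ^ 2) ^ β ≤ Real.exp (2 * β * |y|) := by
    rcases (abs_nonneg y).eq_or_lt with h | h
    · have hy0 : y = 0 := abs_eq_zero.1 h.symm
      subst hy0
      simp only [abs_zero, mul_zero, Real.exp_zero]
      exact Real.rpow_le_one (by norm_num) (by norm_num) hβ
    · calc (y ^ 2) ^ β ≤ (Real.exp (2 * |y|)) ^ β := by
            refine Real.rpow_le_rpow (sq_nonneg y) ?_ hβ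
            have h2 : |y| ≤ Real.exp |y| := by linarith [Real.add_one_le_exp |y|]
            rw [← sq_abs, two_mul, Real.exp_add, ← sq]
            exact pow_le_pow_left₀ h.le h2 2
        _ = _ := by
          rw [← Real.exp_mul]
          congr 1
          ring
  have h2 : scaledE α (|x| * |y| / (2 * t)) ≤
      besselE α (1 / 4) * Real.exp (p * (a * |y|)) := by
    refine (scaledE_le hα (by positivity)).trans (mul_le_mul_of_nonneg_left ?_ hE.le)
    rw [hy, Real.exp_nat_mul]
    exact pow_le_pow_left₀ (by positivity) (by linarith [Real.add_one_le_exp (a * |y|)]) _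
  have h3 : Real.exp (2 * β * |y|) * (Real.exp (-(|x| - |y|) ^ 2 / (4 * t)) *
      Real.exp (p * (a * |y|))) ≤ Real.exp (b * |x| + b ^ 2 * t) := by
    rw [← Real.exp_add, ← Real.exp_add]
    refine Real.exp_le_exp.2 ?_
    -- Both growing factors are at most exponential in `|y|`, with total rate `b`; the square shows
    -- that `b|y| - (|x|-|y|)²/(4t) ≤ b|x| + b²t`.
    have h4 : 0 ≤ ((|x| - |y|) + 2 * b * t) ^ 2 / (4 * t) := by positivity
    have h5 : ((|x| - |y|) + 2 * b * t) ^ 2 / (4 * t) =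
        (|x| - |y|) ^ 2 / (4 * t) + b * (|x| - |y|) + b ^ 2 * t := by
      field_simp
      ring
    rw [h5] at h4
    rw [neg_div]
    have h6 : 2 * β * |y| + (-((|x| - |y|) ^ 2 / (4 * t)) + p * (a * |y|)) =
      b * |y| - (|x| - |y|) ^ 2 / (4 * t) := by
      rw [hb]
      ring
    rw [h6]
    linarith
  rw [heatK, heatCls_eq α ht, mul_assoc]
  refine mul_le_mul_of_nonneg_left ?_ (by positivity)
  calc (y ^ 2) ^ β * (2 * (4 * t) ^ (-α - 1) * (Real.exp (-(|x| - |y|) ^ 2 / (4 * t)) *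
        scaledE α (|x| * |y| / (2 * t))))
      ≤ Real.exp (2 * β * |y|) * (2 * (4 * t) ^ (-α - 1) *
        (Real.exp (-(|x| - |y|) ^ 2 / (4 * t)) *
        (besselE α (1 / 4) * Real.exp (p * (a * |y|))))) := by
        have := (scaledE_pos hα (|x| * |y| / (2 * t))).le
        gcongr
    _ = 2 * (4 * t) ^ (-α - 1) * besselE α (1 / 4) * (Real.exp (2 * β * |y|) *
        (Real.exp (-(|x| - |y|) ^ 2 / (4 * t)) * Real.exp (p * (a * |y|)))) := by ring
    _ ≤ _ := mul_le_mul_of_nonneg_left h3 (by positivity)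

/-- On the diagonal `scaledE` grows polynomially and is absorbed by half of the Gaussian. The bound
makes a Gaussian times a transform again admissible for the transform. -/
theorem lintegral_gaussian_mul_heatK_diag_lt_top {α s t : ℝ} (hα : -1 < α) (β : ℝ) (hs : 0 < s)
    (ht : 0 < t) :
    ∫⁻ z, ENNReal.ofReal (Real.exp (-s * z ^ 2)) * ENNReal.ofReal (heatK α β t z z)
      ∂(eta₁ (α - 2 * β)) < ∞ := by
  set p := growthExp α
  have hE := besselE_pos hα (show (0 : ℝ) ≤ 1 / 4 by norm_num)
  -- Chosen so that `c · z²/(2t) = (s/2) z²`.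
  set c : ℝ := s / 2 * (2 * t) with hc
  have hc0 : 0 < c := by positivity
  obtain ⟨D, hD0, hD⟩ : ∃ D : ℝ, 0 ≤ D ∧ ∀ v : ℝ, 0 ≤ v → (1 + v) ^ p ≤ D * Real.exp (c * v) := by
    refine ⟨p.factorial * (1 / c) ^ p * Real.exp c, by positivity, fun v hv => ?_⟩
    have h := Real.pow_div_factorial_le_exp (c * (1 + v)) (by positivity) p
    have hp : (0 : ℝ) < p.factorial := by exact_mod_cast p.factorial_pos
    rw [div_le_iff₀ hp, mul_pow, mul_add, mul_one, Real.exp_add] at h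
    rw [div_pow, one_pow]
    have hcp : 0 < c ^ p := by positivity
    calc (1 + v) ^ p = c ^ p * (1 + v) ^ p / c ^ p := by field_simp
      _ ≤ (Real.exp c * Real.exp (c * v) * p.factorial) / c ^ p := by gcongr
      _ = _ := by ring
  have hbound : ∀ z ∈ Ioi (0 : ℝ), ENNReal.ofReal (z ^ (2 * (α - 2 * β) + 1)) *
      (ENNReal.ofReal (Real.exp (-s * z ^ 2)) * ENNReal.ofReal (heatK α β t z z)) ≤
      ENNReal.ofReal (2 * (4 * t) ^ (-α - 1) * besselE α (1 / 4) * D *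
        (z ^ (2 * 0) * (Real.exp (-(s / 2) * z ^ 2) * z ^ (2 * α + 1)))) := by
    intro z hz
    have hz : 0 < z := hz
    rw [← ENNReal.ofReal_mul (by positivity), ← ENNReal.ofReal_mul (by positivity)]
    refine ENNReal.ofReal_le_ofReal ?_
    have h1 : scaledE α (|z| * |z| / (2 * t)) ≤
        besselE α (1 / 4) * (D * Real.exp (s / 2 * z ^ 2)) := by
      refine (scaledE_le hα (by positivity)).trans (mul_le_mul_of_nonneg_left ?_ hE.le)
      refine (hD _ (by positivity)).trans (le_of_eq ?_)
      congr 2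
      rw [hc, abs_of_pos hz]
      field_simp
    have h2 : Real.exp (-s * z ^ 2) * Real.exp (s / 2 * z ^ 2) =
        Real.exp (-(s / 2) * z ^ 2) := by
      rw [← Real.exp_add]
      congr 1
      ring
    rw [heatK, heatCls_eq α ht, sub_self, mul_zero, pow_zero, one_mul]
    have h3 : Real.exp (-0 ^ 2 / (4 * t)) = 1 := by simp
    rw [h3, one_mul]
    calc z ^ (2 * (α - 2 * β) + 1) * (Real.exp (-s * z ^ 2) * ((z ^ 2) ^ β * (z ^ 2) ^ β *
          (2 * (4 * t) ^ (-α - 1) * scaledE α (|z| * |z| / (2 * t)))))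
        ≤ z ^ (2 * (α - 2 * β) + 1) * (Real.exp (-s * z ^ 2) * ((z ^ 2) ^ β * (z ^ 2) ^ β *
          (2 * (4 * t) ^ (-α - 1) * (besselE α (1 / 4) * (D * Real.exp (s / 2 * z ^ 2)))))) := by
          gcongr
      _ = 2 * (4 * t) ^ (-α - 1) * besselE α (1 / 4) * D *
          ((Real.exp (-s * z ^ 2) * Real.exp (s / 2 * z ^ 2)) *
          (z ^ (2 * (α - 2 * β) + 1) * ((z ^ 2) ^ β * (z ^ 2) ^ β))) := by ring
      _ = _ := by rw [h2, rpow_weight_mul hz]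
  rw [lintegral_eta₁]
  refine (setLIntegral_mono' measurableSet_Ioi hbound).trans_lt ?_
  rw [← ofReal_integral_eq_lintegral_ofReal]
  · exact ENNReal.ofReal_lt_top
  · exact (integrable_pow_mul_gaussian hα (by positivity) 0).const_mul _
  · filter_upwards [ae_restrict_mem measurableSet_Ioi] with y hy
    have hy : 0 < y := hy
    simp only [Pi.zero_apply]
    positivity

/-! ### Products, and the abstract notion of a heat kernel -/

variable {d : ℕ}

theorem lintegral_pi_prod : ∀ {n : ℕ} (μ : Fin n → Measure ℝ) [∀ i, SigmaFinite (μ i)]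
    {f : Fin n → ℝ → ℝ≥0∞}, (∀ i, Measurable (f i)) →
    ∫⁻ x : Fin n → ℝ, ∏ i, f i (x i) ∂(Measure.pi μ) = ∏ i, ∫⁻ x, f i x ∂(μ i) := by
  intro n
  induction n with
  | zero => intro μ _ f _; simp
  | succ n ih =>
    intro μ _ f hf
    have hm : Measurable fun x : Fin n → ℝ => ∏ i : Fin n, f (Fin.succ i) (x i) :=
      Finset.measurable_fun_prod _ fun i _ => (hf _).comp (measurable_pi_apply i)
    calc
      _ = ∫⁻ x : ℝ × (Fin n → ℝ), f 0 x.1 * ∏ i : Fin n, f (Fin.succ i) (x.2 i)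
          ∂((μ 0).prod (Measure.pi (fun i => μ i.succ))) := by
        rw [← ((measurePreserving_piFinSuccAbove μ 0).symm).lintegral_comp_emb
          (MeasurableEquiv.measurableEmbedding _)]
        simp_rw [MeasurableEquiv.piFinSuccAbove_symm_apply, Fin.insertNthEquiv,
          Fin.prod_univ_succ, Fin.insertNth_zero, Equiv.coe_fn_mk, Fin.cons_succ,
          Fin.zero_succAbove, cast_eq, Fin.cons_zero]
      _ = (∫⁻ x, f 0 x ∂μ 0) * ∏ i : Fin n, ∫⁻ x : ℝ, f (Fin.succ i) x ∂(μ i.succ) := by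
        rw [← ih (fun i => μ i.succ) (fun i => hf i.succ),
          ← lintegral_prod_mul (hf 0).aemeasurable hm.aemeasurable]
      _ = _ := by rw [Fin.prod_univ_succ]

theorem orthant_eq_pi (d : ℕ) : orthant d = Set.pi univ fun _ => Ioi 0 := by
  ext x
  simp [orthant]

theorem isOpen_orthant (d : ℕ) : IsOpen (orthant d) := by
  rw [orthant_eq_pi]
  exact isOpen_set_pi finite_univ fun _ _ => isOpen_Ioi

theorem eta_eq_pi (ν : Fin d → ℝ) : eta ν = Measure.pi fun i => eta₁ (ν i) := by
  symm
  refine Measure.pi_eq fun s hs => ?_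
  have h1 : volume.restrict (orthant d) =
      Measure.pi fun _ : Fin d => (volume : Measure ℝ).restrict (Ioi 0) := by
    rw [orthant_eq_pi, volume_pi, Measure.restrict_pi_pi]
  have hms : MeasurableSet (Set.pi univ s) := MeasurableSet.univ_pi hs
  rw [eta, withDensity_apply _ hms, h1, Measure.restrict_pi_pi]
  have h2 : ∀ i, eta₁ (ν i) (s i) = ∫⁻ u in s i, ENNReal.ofReal (u ^ (2 * ν i + 1))
      ∂(volume.restrict (Ioi 0)) := fun i => by rw [eta₁, withDensity_apply _ (hs i)]
  simp_rw [h2]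
  rw [← lintegral_pi_prod _ (fun i => by fun_prop)]
  rw [← Measure.restrict_pi_pi, ← h1]
  refine lintegral_congr_ae ?_
  refine (ae_restrict_of_ae (ae_restrict_mem (isOpen_orthant d).measurableSet)).mono fun x hx => ?_
  simp only
  rw [ENNReal.ofReal_prod_of_nonneg]
  intro i _
  have := hx i
  positivity

instance sigmaFinite_eta (ν : Fin d → ℝ) : SigmaFinite (eta ν) := by
  unfold eta
  infer_instance

theorem ae_eta_mem_orthant (ν : Fin d → ℝ) : ∀ᵐ x ∂(eta ν), x ∈ orthant d :=
  (withDensity_absolutelyContinuous _ _).ae_le (ae_restrict_mem (isOpen_orthant d).measurableSet)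

theorem besselJ_eq (ν : ℝ) {u : ℝ} (hu : 0 < u) :
    besselJ ν u = (u / 2) ^ ν * besselE ν (-u ^ 2 / 4) := by
  unfold besselJ besselE
  rw [← tsum_mul_left]
  refine tsum_congr fun m => ?_
  have h1 : (u / 2) ^ (2 * (m : ℝ) + ν) = (u / 2) ^ ν * (u ^ 2 / 4) ^ m := by
    rw [Real.rpow_add (by positivity), mul_comm]
    congr 1
    have : (2 : ℝ) * m = (2 * m : ℕ) := by push_cast; ring
    rw [this, Real.rpow_natCast, pow_mul, div_pow]
    norm_num
  have h2 : (-u ^ 2 / 4) ^ m = (-1) ^ m * (u ^ 2 / 4) ^ m := by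
    rw [← mul_pow]
    congr 1
    ring
  rw [h1, h2, coeffE]
  ring

theorem phi_eq_eigenfun (ν : ℝ) {z x : ℝ} (hz : 0 < z) (hx : 0 < x) :
    phi ν z x = eigenfun ν 0 z x := by
  have hu : 0 < x * z := by positivity
  rw [phi, eigenfun, besselJ_eq ν hu, Real.rpow_zero, one_mul, ← mul_assoc]
  congr 1
  rw [Real.div_rpow hu.le (by norm_num), Real.rpow_neg hu.le, Real.rpow_neg (by norm_num)]
  field_simp

theorem phiExo_eq_eigenfun (ν : ℝ) {z x : ℝ} (hz : 0 < z) (hx : 0 < x) :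
    phiExo ν z x = eigenfun (-ν) (-ν) z x := by
  have hu : 0 < x * z := by positivity
  rw [phiExo, phi_eq_eigenfun (-ν) hz hx, eigenfun, eigenfun, Real.rpow_zero, one_mul]
  congr 1
  have : -2 * ν = 2 * -ν := by ring
  rw [this, Real.rpow_mul hu.le]
  norm_cast

theorem kernelCls_eq {ν t x y : ℝ} (hν : -1 < ν) (ht : 0 < t) (hx : 0 < x) (hy : 0 < y) :
    kernelCls ν t x y = heatK ν 0 t x y := by
  have h := integral_gaussian_mul_eigenfun hν 0 ht x y
  have e : ν - 2 * 0 = ν := by ring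
  rw [e] at h
  rw [← h, kernelCls]
  refine integral_congr_ae ((ae_eta₁_pos ν).mono fun z hz => ?_)
  simp only
  rw [phi_eq_eigenfun ν hz hx, phi_eq_eigenfun ν hz hy]

theorem kernelExo_eq {ν t x y : ℝ} (hν : ν < 1) (ht : 0 < t) (hx : 0 < x) (hy : 0 < y) :
    kernelExo ν t x y = heatK (-ν) (-ν) t x y := by
  have h := integral_gaussian_mul_eigenfun (α := -ν) (by linarith) (-ν) ht x y
  have e : -ν - 2 * -ν = ν := by ring
  rw [e] at h
  rw [← h, kernelExo]
  refine integral_congr_ae ((ae_eta₁_pos ν).mono fun z hz => ?_)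
  simp only
  rw [phiExo_eq_eigenfun ν hz hx, phiExo_eq_eigenfun ν hz hy]

/-- The product heat kernel with multi-parameters `α`, `β`. -/
def heatProd (α β : Fin d → ℝ) (t : ℝ) (x y : Fin d → ℝ) : ℝ :=
  ∏ i, heatK (α i) (β i) t (x i) (y i)

/-- The product eigenfunction with multi-parameters `α`, `β`. -/
def eigenProd (α β : Fin d → ℝ) (z x : Fin d → ℝ) : ℝ :=
  ∏ i, eigenfun (α i) (β i) (z i) (x i)

/-- A symmetric heat kernel `k` on `(X, m)`, sub-Markovian, and diagonalized by the symmetric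
eigenfunctions `Φ` with eigenvalues `q`. -/
structure IsHeatKernel {X : Type*} [MeasurableSpace X] (m : Measure X) (q : X → ℝ)
    (Φ : X → X → ℝ) (k : ℝ → X → X → ℝ) : Prop where
  measurable_q : Measurable q
  q_nonneg : ∀ z, 0 ≤ q z
  measurable_eigen : Measurable (Function.uncurry Φ)
  eigen_symm : ∀ z x, Φ z x = Φ x z
  measurable_kernel : ∀ t, 0 < t → Measurable (Function.uncurry (k t))
  nonneg : ∀ t, 0 < t → ∀ x y, 0 ≤ k t x y
  symm : ∀ t x y, k t x y = k t y x
  subMarkov : ∀ t, 0 < t → ∀ x, ∫⁻ y, ENNReal.ofReal (k t x y) ∂m ≤ 1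
  chapmanKolmogorov : ∀ s t, 0 < s → 0 < t → ∀ x z,
    ∫⁻ y, ENNReal.ofReal (k s x y) * ENNReal.ofReal (k t y z) ∂m = ENNReal.ofReal (k (s + t) x z)
  comparable : ∃ C : ℝ≥0, ∀ t s, 0 < t → t ≤ s → s ≤ 4 * t → ∀ x y, k t x y ≤ C * k s x y
  bounded : ∀ t, 0 < t → ∀ x, ∃ C : ℝ, ∀ y, k t x y ≤ C
  integrable_eigen : ∀ t, 0 < t → ∀ x y,
    Integrable (fun z => Real.exp (-t * q z) * Φ z x * Φ z y) m
  integral_eigen : ∀ t, 0 < t → ∀ x y,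
    ∫ z, Real.exp (-t * q z) * Φ z x * Φ z y ∂m = k t x y
  lintegral_diag : ∀ s t, 0 < s → 0 < t →
    ∫⁻ z, ENNReal.ofReal (Real.exp (-s * q z)) * ENNReal.ofReal (k t z z) ∂m < ∞

section Product

variable {α β : Fin d → ℝ}

theorem heatProd_nonneg (hα : ∀ i, -1 < α i) {t : ℝ} (ht : 0 < t) (x y : Fin d → ℝ) :
    0 ≤ heatProd α β t x y :=
  Finset.prod_nonneg fun i _ => heatK_nonneg (hα i) (β i) ht _ _

theorem ofReal_heatProd (hα : ∀ i, -1 < α i) {t : ℝ} (ht : 0 < t) (x y : Fin d → ℝ) :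
    ENNReal.ofReal (heatProd α β t x y) = ∏ i, ENNReal.ofReal (heatK (α i) (β i) t (x i) (y i)) :=
  ENNReal.ofReal_prod_of_nonneg fun i _ => heatK_nonneg (hα i) (β i) ht _ _

theorem continuous_heatProd (hα : ∀ i, -1 < α i) (hβ : ∀ i, 0 ≤ β i) (t : ℝ) :
    Continuous fun p : (Fin d → ℝ) × (Fin d → ℝ) => heatProd α β t p.1 p.2 :=
  continuous_finsetProd _ fun i _ => (continuous_heatK (hα i) (hβ i) t).comp
    (f := fun p : (Fin d → ℝ) × (Fin d → ℝ) => (p.1 i, p.2 i))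
    (((continuous_apply i).comp continuous_fst).prodMk
      ((continuous_apply i).comp continuous_snd))

theorem continuousAt_heatProd_time (hα : ∀ i, -1 < α i) (x y : Fin d → ℝ) {t : ℝ} (ht : 0 < t) :
    ContinuousAt (fun t => heatProd α β t x y) t :=
  tendsto_finsetProd _ fun i _ => continuousAt_heatK_time (hα i) (β i) (x i) (y i) ht

theorem continuous_eigenProd (hα : ∀ i, -1 < α i) (hβ : ∀ i, 0 ≤ β i) :
    Continuous fun p : (Fin d → ℝ) × (Fin d → ℝ) => eigenProd α β p.1 p.2 :=
  continuous_finsetProd _ fun i _ => (continuous_eigenfun (hα i) (hβ i)).comp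
    (f := fun p : (Fin d → ℝ) × (Fin d → ℝ) => (p.1 i, p.2 i))
    (((continuous_apply i).comp continuous_fst).prodMk
      ((continuous_apply i).comp continuous_snd))

theorem gaussian_mul_eigenProd (t : ℝ) (x y z : Fin d → ℝ) :
    Real.exp (-t * ∑ i, z i ^ 2) * eigenProd α β z x * eigenProd α β z y =
      ∏ i, Real.exp (-t * z i ^ 2) * eigenfun (α i) (β i) (z i) (x i) *
        eigenfun (α i) (β i) (z i) (y i) := by
  rw [Finset.prod_mul_distrib, Finset.prod_mul_distrib, Finset.mul_sum, Real.exp_sum]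
  rfl

/-- Every property tensorizes by Tonelli or Fubini. Only the mass bound distinguishes the two kinds
of coordinates. -/
theorem isHeatKernel_heatProd (hα : ∀ i, -1 < α i) (hβ : ∀ i, 0 ≤ β i)
    (hαβ : ∀ i, β i = 0 ∨ β i = α i ∧ 0 < α i) :
    IsHeatKernel (eta fun i => α i - 2 * β i) (fun z => ∑ i, z i ^ 2) (eigenProd α β)
      (heatProd α β) where
  measurable_q := by fun_prop
  q_nonneg z := Finset.sum_nonneg fun i _ => sq_nonneg _
  measurable_eigen := (continuous_eigenProd hα hβ).measurable
  eigen_symm z x := Finset.prod_congr rfl fun i _ => eigenfun_symm _ _ _ _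
  measurable_kernel t _ := (continuous_heatProd hα hβ t).measurable
  nonneg t ht := heatProd_nonneg hα ht
  symm t x y := Finset.prod_congr rfl fun i _ => heatK_symm _ _ _ _ _
  subMarkov t ht x := by
    simp_rw [ofReal_heatProd hα ht]
    rw [eta_eq_pi, lintegral_pi_prod (fun i => eta₁ (α i - 2 * β i)) (f := fun i y =>
      ENNReal.ofReal (heatK (α i) (β i) t (x i) y))]
    · refine Finset.prod_le_one' fun i _ => ?_
      rcases hαβ i with h | ⟨h, h0⟩
      · rw [h]
        exact lintegral_heatK_cls (hα i) ht _
      · rw [h]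
        exact lintegral_heatK_exo h0 ht _
    · intro i
      exact ((continuous_heatK (hα i) (hβ i) t).comp
        (Continuous.prodMk_right _)).measurable.ennreal_ofReal
  chapmanKolmogorov s t hs ht x z := by
    simp_rw [ofReal_heatProd hα hs, ofReal_heatProd hα ht, ofReal_heatProd hα (add_pos hs ht),
      ← Finset.prod_mul_distrib]
    rw [eta_eq_pi, lintegral_pi_prod (fun i => eta₁ (α i - 2 * β i)) (f := fun i y =>
      ENNReal.ofReal (heatK (α i) (β i) s (x i) y) * ENNReal.ofReal (heatK (α i) (β i) t y (z i)))]
    · exact Finset.prod_congr rfl fun i _ => lintegral_heatK_mul_heatK (hα i) (β i) hs ht _ _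
    · intro i
      exact ((continuous_heatK (hα i) (hβ i) s).comp
        (Continuous.prodMk_right _)).measurable.ennreal_ofReal.mul
        ((continuous_heatK (hα i) (hβ i) t).comp
          (Continuous.prodMk_left _)).measurable.ennreal_ofReal
  comparable := by
    refine ⟨(∏ i, timeConst (α i)).toNNReal, fun t s ht hts hst x y => ?_⟩
    rw [Real.coe_toNNReal _ (Finset.prod_nonneg fun i _ => timeConst_nonneg _), heatProd, heatProd,
      ← Finset.prod_mul_distrib]
    exact Finset.prod_le_prod (fun i _ => heatK_nonneg (hα i) (β i) ht _ _)
      fun i _ => heatK_le_of_le (hα i) (β i) ht hts hst _ _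
  bounded t ht x := by
    choose C hC0 hC using fun i => exists_heatK_le (hα i) (hβ i) ht (x i)
    exact ⟨∏ i, C i, fun y => Finset.prod_le_prod
      (fun i _ => heatK_nonneg (hα i) (β i) ht _ _) fun i _ => hC i _⟩
  integrable_eigen t ht x y := by
    simp_rw [gaussian_mul_eigenProd]
    rw [eta_eq_pi]
    exact Integrable.fintype_prod
      fun i => integrable_gaussian_mul_eigenfun (hα i) (β i) ht (x i) (y i)
  integral_eigen t ht x y := by
    simp_rw [gaussian_mul_eigenProd]
    rw [eta_eq_pi, integral_fintype_prod_eq_prod (𝕜 := ℝ) (fun i u =>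
      Real.exp (-t * u ^ 2) * eigenfun (α i) (β i) u (x i) * eigenfun (α i) (β i) u (y i))]
    exact Finset.prod_congr rfl
      fun i _ => integral_gaussian_mul_eigenfun (hα i) (β i) ht (x i) (y i)
  lintegral_diag s t hs ht := by
    have h : ∀ z : Fin d → ℝ, ENNReal.ofReal (Real.exp (-s * ∑ i, z i ^ 2)) *
        ENNReal.ofReal (heatProd α β t z z) = ∏ i, ENNReal.ofReal (Real.exp (-s * z i ^ 2)) *
        ENNReal.ofReal (heatK (α i) (β i) t (z i) (z i)) := fun z => by
      rw [Finset.prod_mul_distrib, ofReal_heatProd hα ht, Finset.mul_sum, Real.exp_sum,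
        ENNReal.ofReal_prod_of_nonneg fun i _ => (Real.exp_pos _).le]
    simp_rw [h]
    rw [eta_eq_pi, lintegral_pi_prod (fun i => eta₁ (α i - 2 * β i))
      (f := fun i u => ENNReal.ofReal (Real.exp (-s * u ^ 2)) *
        ENNReal.ofReal (heatK (α i) (β i) t u u))]
    · exact ENNReal.prod_lt_top fun i _ =>
        lintegral_gaussian_mul_heatK_diag_lt_top (hα i) (β i) hs ht
    · intro i
      have hg : Measurable fun u : ℝ => ENNReal.ofReal (Real.exp (-s * u ^ 2)) := by fun_prop
      exact hg.mul ((continuous_heatK (hα i) (hβ i) t).comp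
        (continuous_id.prodMk continuous_id)).measurable.ennreal_ofReal

end Product

/-! ### Hopf's maximal ergodic inequality -/

section Ergodic

variable {X : Type*} [MeasurableSpace X] {m : Measure X}

/-- A positive operator on nonnegative functions that contracts both `L¹(m)` and `L^∞(m)`. -/
structure IsSubMarkovOperator (m : Measure X) (T : (X → ℝ≥0∞) → X → ℝ≥0∞) : Prop where
  measurable : ∀ f, Measurable f → Measurable (T f)
  map_add : ∀ f g, Measurable f → Measurable g → T (f + g) = T f + T g
  mono : ∀ f g, f ≤ g → T f ≤ T g
  lintegral_le : ∀ f, Measurable f → ∫⁻ x, T f x ∂m ≤ ∫⁻ x, f x ∂m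
  const_le : ∀ c : ℝ≥0∞, T (fun _ => c) ≤ fun _ => c

/-- The partial sums `∑_{k<n} T^k f`. -/
def orbitSum (T : (X → ℝ≥0∞) → X → ℝ≥0∞) (f : X → ℝ≥0∞) : ℕ → X → ℝ≥0∞
  | 0 => 0
  | n + 1 => f + T (orbitSum T f n)

namespace IsSubMarkovOperator

variable {T : (X → ℝ≥0∞) → X → ℝ≥0∞} (hT : IsSubMarkovOperator m T)
include hT

theorem map_zero : T 0 = 0 := le_antisymm (hT.const_le 0) (by intro x; simp)

theorem measurable_iterate {f : X → ℝ≥0∞} (hf : Measurable f) (n : ℕ) : Measurable (T^[n] f) := by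
  induction n with
  | zero => exact hf
  | succ n ih =>
    rw [Function.iterate_succ_apply']
    exact hT.measurable _ ih

theorem measurable_orbitSum {f : X → ℝ≥0∞} (hf : Measurable f) (n : ℕ) :
    Measurable (orbitSum T f n) := by
  induction n with
  | zero => exact measurable_zero
  | succ n ih => exact hf.add (hT.measurable _ ih)

theorem orbitSum_succ {f : X → ℝ≥0∞} (hf : Measurable f) (n : ℕ) :
    orbitSum T f (n + 1) = orbitSum T f n + T^[n] f := by
  induction n with
  | zero =>
    have h : orbitSum T f (0 + 1) = f + T 0 := rfl
    rw [h, hT.map_zero]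
    simp [orbitSum]
  | succ n ih =>
    have h : orbitSum T f (n + 1 + 1) = f + T (orbitSum T f (n + 1)) := rfl
    rw [h, ih, hT.map_add _ _ (hT.measurable_orbitSum hf n) (hT.measurable_iterate hf n),
      Function.iterate_succ_apply', ← add_assoc, ← ih]
    rfl

theorem orbitSum_eq_sum {f : X → ℝ≥0∞} (hf : Measurable f) (n : ℕ) (x : X) :
    orbitSum T f n x = ∑ k ∈ Finset.range n, T^[k] f x := by
  induction n with
  | zero => rfl
  | succ n ih => rw [hT.orbitSum_succ hf, Finset.sum_range_succ, ← ih]; rfl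

theorem lintegral_orbitSum_le {f : X → ℝ≥0∞} (hf : Measurable f) (n : ℕ) :
    ∫⁻ x, orbitSum T f n x ∂m ≤ n * ∫⁻ x, f x ∂m := by
  induction n with
  | zero => simp [orbitSum]
  | succ n ih =>
    calc ∫⁻ x, orbitSum T f (n + 1) x ∂m
        = ∫⁻ x, f x ∂m + ∫⁻ x, T (orbitSum T f n) x ∂m := by
          rw [← lintegral_add_left hf]
          rfl
      _ ≤ ∫⁻ x, f x ∂m + n * ∫⁻ x, f x ∂m := by
          gcongr
          exact (hT.lintegral_le _ (hT.measurable_orbitSum hf n)).trans ih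
      _ = _ := by
        push_cast
        ring

theorem orbitSum_le_of_le {f : X → ℝ≥0∞} {s : ℝ≥0∞} (hf : ∀ x, f x ≤ s) (n : ℕ) (x : X) :
    orbitSum T f n x ≤ s * n := by
  induction n generalizing x with
  | zero => simp [orbitSum]
  | succ n ih =>
    calc orbitSum T f (n + 1) x = f x + T (orbitSum T f n) x := rfl
      _ ≤ s + s * n := add_le_add (hf x) ((hT.mono _ (fun _ => s * n) ih x).trans (hT.const_le _ x))
      _ = _ := by
        push_cast
        ring

/-- Hopf's maximal ergodic inequality, for finitely many averages. -/
theorem mul_measure_exists_le_lt_orbitSum_le {f : X → ℝ≥0∞} (hf : Measurable f)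
    (hfin : ∫⁻ x, f x ∂m ≠ ∞) {s : ℝ≥0∞} (hs : s ≠ ∞) (N : ℕ) :
    s * m {x | ∃ n ≤ N, s * n < orbitSum T f n x} ≤ ∫⁻ x, f x ∂m := by
  set A := {x | ∃ n ≤ N, s * n < orbitSum T f n x} with hA
  have hAm : MeasurableSet A := by
    have : A = ⋃ n ∈ Finset.range (N + 1), {x | s * n < orbitSum T f n x} := by
      ext x
      simp [hA]
    rw [this]
    exact Finset.measurableSet_biUnion _ fun n _ =>
      measurableSet_lt measurable_const (hT.measurable_orbitSum hf n)
  -- Garsia's argument, arranged for values in `ℝ≥0∞`: the orbit sums of `s · 1_A` are subtracted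
  -- rather than `s · n`. They are at most `s · n`, hence finite, and `g` contributes exactly `s · m
  -- A` upon integration.
  set g : X → ℝ≥0∞ := A.indicator fun _ => s with hg
  have hgm : Measurable g := measurable_const.indicator hAm
  have hgs : ∀ x, g x ≤ s := fun x => indicator_le_self' (fun _ _ => zero_le) x
  set a := orbitSum T f
  set b := orbitSum T g
  have hbs : ∀ n x, b n x ≤ s * n := hT.orbitSum_le_of_le hgs
  have hbfin : ∀ n : ℕ, s * (n : ℝ≥0∞) ≠ ∞ := fun n =>
    ENNReal.mul_ne_top hs (ENNReal.natCast_ne_top n)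
  set M : X → ℝ≥0∞ := fun x => (Finset.range (N + 1)).sup fun n => a n x - b n x with hM
  have hMm : Measurable M := by
    have : M = (Finset.range (N + 1)).sup fun n x => a n x - b n x := by
      funext x
      rw [hM, Finset.sup_apply]
    rw [this]
    refine Finset.sup_induction (p := fun h : X → ℝ≥0∞ => Measurable h) measurable_const
      (fun _ h1 _ h2 => h1.sup h2) fun n _ => ?_
    exact (hT.measurable_orbitSum hf n).sub (hT.measurable_orbitSum hgm n)
  have hle : ∀ n ≤ N, ∀ x, a n x ≤ b n x + M x := by
    intro n hn x
    have h : a n x - b n x ≤ M x :=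
      Finset.le_sup (f := fun n => a n x - b n x) (Finset.mem_range.2 (Nat.lt_succ_of_le hn))
    exact tsub_le_iff_left.1 h
  -- If `M x = 0` then `x ∉ A` and the left side is 0. Otherwise the maximum is attained at some `i
  -- + 1`; unfolding one step of both orbit sums and using `a_i ≤ b_i + M` gives the claim after
  -- cancelling the finite `T b_i`.
  have hkey : ∀ x, M x + g x ≤ f x + T M x := by
    intro x
    by_cases hMx : M x = 0
    · have hxA : x ∉ A := by
        rintro ⟨n, hn, hlt⟩
        have h1 := hle n hn x
        rw [hMx, add_zero] at h1
        exact absurd (hlt.trans_le (h1.trans (hbs n x))) (lt_irrefl _)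
      simp [hMx, hg, hxA]
    · obtain ⟨j, hj, hMj⟩ := Finset.exists_mem_eq_sup (Finset.range (N + 1)) ⟨0, by simp⟩
        fun n => a n x - b n x
      have hMj : M x = a j x - b j x := hMj
      cases j with
      | zero => exact absurd (hMj.trans (by simp [a, b, orbitSum])) hMx
      | succ i =>
        have hi : i ≤ N := by
          have := Finset.mem_range.1 hj
          omega
        have hlt : b (i + 1) x ≤ a (i + 1) x := by
          by_contra hcon
          exact hMx (hMj.trans (tsub_eq_zero_of_le (not_le.1 hcon).le))
        have h1 : M x + (g x + T (b i) x) = f x + T (a i) x := by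
          rw [hMj]
          exact tsub_add_cancel_of_le hlt
        have h2 : T (a i) x ≤ T (b i) x + T M x := by
          have h := hT.mono (a i) (b i + M) (hle i hi) x
          rwa [hT.map_add _ _ (hT.measurable_orbitSum hgm i) hMm] at h
        have h3 : T (b i) x ≠ ∞ := ne_top_of_le_ne_top (hbfin i)
          ((hT.mono _ (fun _ => s * i) (hbs i) x).trans (hT.const_le _ x))
        refine (ENNReal.add_le_add_iff_right h3).1 ?_
        calc M x + g x + T (b i) x = f x + T (a i) x := by rw [add_assoc, h1]
          _ ≤ f x + (T (b i) x + T M x) := by gcongr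
          _ = f x + T M x + T (b i) x := by ring
  -- Needed to cancel `∫ M` at the end, since `∫ T M ≤ ∫ M`.
  have hMfin : ∫⁻ x, M x ∂m ≠ ∞ := by
    have h1 : ∀ x, M x ≤ ∑ n ∈ Finset.range (N + 1), a n x := by
      intro x
      refine Finset.sup_le fun n hn => tsub_le_self.trans ?_
      exact Finset.single_le_sum (f := fun n => a n x) (fun _ _ => zero_le) hn
    refine ne_top_of_le_ne_top ?_ (lintegral_mono h1)
    rw [lintegral_finsetSum _ fun n _ => hT.measurable_orbitSum hf n]
    exact ENNReal.sum_ne_top.2 fun n _ => ne_top_of_le_ne_top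
      (ENNReal.mul_ne_top (ENNReal.natCast_ne_top n) hfin) (hT.lintegral_orbitSum_le hf n)
  have hint := lintegral_mono (μ := m) hkey
  rw [lintegral_add_left hMm, lintegral_add_left hf, hg, lintegral_indicator_const hAm] at hint
  refine (ENNReal.add_le_add_iff_left hMfin).1 ?_
  calc ∫⁻ x, M x ∂m + s * m A ≤ ∫⁻ x, f x ∂m + ∫⁻ x, T M x ∂m := hint
    _ ≤ ∫⁻ x, f x ∂m + ∫⁻ x, M x ∂m := by
      exact add_le_add_right (hT.lintegral_le M hMm) _
    _ = _ := add_comm _ _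

/-- Hopf's maximal ergodic inequality. -/
theorem mul_measure_exists_lt_orbitSum_le {f : X → ℝ≥0∞} (hf : Measurable f)
    (hfin : ∫⁻ x, f x ∂m ≠ ∞) {s : ℝ≥0∞} (hs : s ≠ ∞) :
    s * m {x | ∃ n : ℕ, s * n < orbitSum T f n x} ≤ ∫⁻ x, f x ∂m := by
  have h : {x | ∃ n : ℕ, s * n < orbitSum T f n x} =
      ⋃ N : ℕ, {x | ∃ n ≤ N, s * n < orbitSum T f n x} := by
    ext x
    simp only [mem_ofPred_eq, mem_iUnion]
    exact ⟨fun ⟨n, hn⟩ => ⟨n, n, le_rfl, hn⟩, fun ⟨_, n, _, hn⟩ => ⟨n, hn⟩⟩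
  have hmono : Monotone fun N : ℕ => {x | ∃ n ≤ N, s * n < orbitSum T f n x} :=
    fun N N' hN x ⟨n, hn, hx⟩ => ⟨n, hn.trans hN, hx⟩
  rw [h, hmono.measure_iUnion, ENNReal.mul_iSup]
  exact iSup_le fun N => hT.mul_measure_exists_le_lt_orbitSum_le hf hfin hs N

end IsSubMarkovOperator

end Ergodic

/-! ### From ergodic averages to the maximal operator -/

namespace IsHeatKernel

variable {X : Type*} [MeasurableSpace X] {m : Measure X} {q : X → ℝ}
  {Φ : X → X → ℝ} {k : ℝ → X → X → ℝ}

/-- The action of a kernel on nonnegative functions. -/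
def kernelOp (m : Measure X) (k : ℝ → X → X → ℝ) (t : ℝ) (f : X → ℝ≥0∞) (x : X) : ℝ≥0∞ :=
  ∫⁻ y, ENNReal.ofReal (k t x y) * f y ∂m

variable (hk : IsHeatKernel m q Φ k)
include hk

theorem measurable_ofReal_kernel {t : ℝ} (ht : 0 < t) :
    Measurable fun p : X × X => ENNReal.ofReal (k t p.1 p.2) :=
  (hk.measurable_kernel t ht).ennreal_ofReal

theorem measurable_ofReal_kernel_left {t : ℝ} (ht : 0 < t) (x : X) :
    Measurable fun y : X => ENNReal.ofReal (k t x y) :=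
  (hk.measurable_ofReal_kernel ht).comp measurable_prodMk_left

theorem kernelOp_le {C : ℝ≥0} (hC : ∀ t s, 0 < t → t ≤ s → s ≤ 4 * t → ∀ x y,
    k t x y ≤ C * k s x y) {t s : ℝ} (ht : 0 < t) (hts : t ≤ s) (hst : s ≤ 4 * t)
    {f : X → ℝ≥0∞} (hf : Measurable f) (x : X) :
    kernelOp m k t f x ≤ C * kernelOp m k s f x := by
  have hs : 0 < s := ht.trans_le hts
  unfold kernelOp
  have hm : Measurable fun y => ENNReal.ofReal (k s x y) * f y :=
    (hk.measurable_ofReal_kernel_left hs x).mul hf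
  rw [← lintegral_const_mul _ hm]
  refine lintegral_mono fun y => ?_
  rw [← mul_assoc]
  refine mul_le_mul_left ?_ _
  rw [← ENNReal.ofReal_coe_nnreal, ← ENNReal.ofReal_mul C.coe_nonneg]
  exact ENNReal.ofReal_le_ofReal (hC t s ht hts hst x y)

variable [SFinite m]

theorem measurable_kernelOp {t : ℝ} (ht : 0 < t) {f : X → ℝ≥0∞} (hf : Measurable f) :
    Measurable (kernelOp m k t f) :=
  Measurable.lintegral_prod_right' (f := fun p : X × X => ENNReal.ofReal (k t p.1 p.2) * f p.2)
    ((hk.measurable_ofReal_kernel ht).mul (hf.comp measurable_snd))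

theorem kernelOp_kernelOp {s t : ℝ} (hs : 0 < s) (ht : 0 < t) {f : X → ℝ≥0∞} (hf : Measurable f) :
    kernelOp m k s (kernelOp m k t f) = kernelOp m k (s + t) f := by
  funext x
  have h1 : ∀ y, Measurable fun z => ENNReal.ofReal (k t y z) * f z := fun y =>
    (hk.measurable_ofReal_kernel_left ht y).mul hf
  have h2 : Measurable fun p : X × X =>
      ENNReal.ofReal (k s x p.1) * (ENNReal.ofReal (k t p.1 p.2) * f p.2) :=
    ((hk.measurable_ofReal_kernel_left hs x).comp measurable_fst).mul
      ((hk.measurable_ofReal_kernel ht).mul (hf.comp measurable_snd))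
  unfold kernelOp
  simp_rw [← lintegral_const_mul _ (h1 _)]
  rw [lintegral_lintegral_swap h2.aemeasurable]
  refine lintegral_congr fun z => ?_
  have h3 : Measurable fun y => ENNReal.ofReal (k s x y) * ENNReal.ofReal (k t y z) :=
    (hk.measurable_ofReal_kernel_left hs x).mul
      ((hk.measurable_ofReal_kernel ht).comp measurable_prodMk_right)
  simp_rw [← mul_assoc]
  rw [lintegral_mul_const _ h3, hk.chapmanKolmogorov s t hs ht]

/-- Symmetry turns the mass bound in the second variable into one in the first, which is the
contraction on `L¹`. -/
theorem isSubMarkovOperator {t : ℝ} (ht : 0 < t) : IsSubMarkovOperator m (kernelOp m k t) where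
  measurable f hf := hk.measurable_kernelOp ht hf
  map_add f g hf hg := by
    funext x
    simp only [kernelOp, Pi.add_apply, mul_add]
    exact lintegral_add_left ((hk.measurable_ofReal_kernel_left ht x).mul hf) _
  mono f g hfg x := lintegral_mono fun y => mul_le_mul_right (hfg y) _
  lintegral_le f hf := by
    have h : Measurable fun p : X × X => ENNReal.ofReal (k t p.1 p.2) * f p.2 :=
      (hk.measurable_ofReal_kernel ht).mul (hf.comp measurable_snd)
    unfold kernelOp
    rw [lintegral_lintegral_swap h.aemeasurable]
    refine lintegral_mono fun y => ?_
    have h3 : Measurable fun x => ENNReal.ofReal (k t x y) :=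
      (hk.measurable_ofReal_kernel ht).comp measurable_prodMk_right
    rw [lintegral_mul_const _ h3]
    simp_rw [hk.symm t _ y]
    exact mul_le_of_le_one_left zero_le (hk.subMarkov t ht y)
  const_le c x := by
    simp only [kernelOp]
    rw [lintegral_mul_const _ (hk.measurable_ofReal_kernel_left ht x)]
    exact mul_le_of_le_one_left zero_le (hk.subMarkov t ht x)

theorem iterate_kernelOp {δ : ℝ} (hδ : 0 < δ) {f : X → ℝ≥0∞} (hf : Measurable f) (n : ℕ) :
    (kernelOp m k δ)^[n + 1] f = kernelOp m k ((n + 1 : ℕ) * δ) f := by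
  induction n with
  | zero => simp
  | succ n ih =>
    rw [Function.iterate_succ_apply', ih, hk.kernelOp_kernelOp hδ (by positivity) hf]
    congr 1
    push_cast
    ring

/-- The maximal operator of a symmetric sub-Markovian semigroup whose kernels at comparable times
are comparable is of weak type `(1,1)`. -/
theorem exists_weakType :
    ∃ C : ℝ≥0, ∀ f : X → ℝ≥0∞, Measurable f → ∫⁻ x, f x ∂m ≠ ∞ → ∀ s : ℝ≥0∞, s ≠ ∞ →
      s * m {x | s < ⨆ (t : ℝ) (_ : 0 < t), kernelOp m k t f x} ≤ C * ∫⁻ x, f x ∂m := by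
  obtain ⟨C, hC⟩ := hk.comparable
  -- The 2 compares a block of `n` powers with the `2n` powers of the orbit sum containing it; `C +
  -- 1` instead of `C` permits division.
  refine ⟨2 * (C + 1), fun f hf hfin s hs => ?_⟩
  set D : ℝ≥0∞ := ((2 * (C + 1) : ℝ≥0) : ℝ≥0∞) with hD
  have hD0 : D ≠ 0 := by
    rw [hD]
    exact_mod_cast (by positivity : (2 * (C + 1) : ℝ≥0) ≠ 0)
  have hDtop : D ≠ ∞ := ENNReal.coe_ne_top
  have hsD : s / D ≠ ∞ := ENNReal.div_ne_top hs hD0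
  have hDs : D * (s / D) = s := ENNReal.mul_div_cancel hD0 hDtop
  -- Times are restricted to `t ≥ δ = 1/(j+1)`. The sets increase with `j` and the estimate below
  -- has a constant independent of `δ`.
  have hset : {x | s < ⨆ (t : ℝ) (_ : 0 < t), kernelOp m k t f x} =
      ⋃ j : ℕ, {x | ∃ t : ℝ, 1 / ((j : ℝ) + 1) ≤ t ∧ s < kernelOp m k t f x} := by
    ext x
    simp only [mem_ofPred_eq, mem_iUnion, lt_iSup_iff]
    constructor
    · rintro ⟨t, ht, hlt⟩
      obtain ⟨j, hj⟩ := exists_nat_one_div_lt ht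
      exact ⟨j, t, hj.le, hlt⟩
    · rintro ⟨j, t, ht, hlt⟩
      exact ⟨t, lt_of_lt_of_le (by positivity) ht, hlt⟩
  have hmono : Monotone fun j : ℕ =>
      {x | ∃ t : ℝ, 1 / ((j : ℝ) + 1) ≤ t ∧ s < kernelOp m k t f x} := by
    rintro j j' hj x ⟨t, ht, hlt⟩
    exact ⟨t, (Nat.one_div_le_one_div hj).trans ht, hlt⟩
  rw [hset, hmono.measure_iUnion, ENNReal.mul_iSup]
  refine iSup_le fun j => ?_
  set δ : ℝ := 1 / ((j : ℝ) + 1) with hδdef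
  have hδ : 0 < δ := by positivity
  have hT := hk.isSubMarkovOperator hδ
  have hsub : {x | ∃ t : ℝ, δ ≤ t ∧ s < kernelOp m k t f x} ⊆
      {x | ∃ n : ℕ, s / D * n < orbitSum (kernelOp m k δ) f n x} := by
    rintro x ⟨t, hδt, hlt⟩
    have ht : 0 < t := hδ.trans_le hδt
    -- As `δ ≤ t`, this gives `t ≤ nδ ≤ 2t`, so the times `iδ` with `n ≤ i < 2n` all lie in `[t,
    -- 4t]`, where the kernels dominate `k_t`.
    set n := ⌈t / δ⌉₊ with hn
    have hn0 : 0 < n := Nat.ceil_pos.2 (by positivity)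
    have hn1 : t ≤ n * δ := (div_le_iff₀ hδ).1 (Nat.le_ceil _)
    have hn2 : n * δ ≤ 2 * t := by
      have h : (n : ℝ) < t / δ + 1 := Nat.ceil_lt_add_one (by positivity)
      have h2 : (n : ℝ) * δ < (t / δ + 1) * δ := mul_lt_mul_of_pos_right h hδ
      have h3 : (t / δ + 1) * δ = t + δ := by field_simp
      linarith
    refine ⟨2 * n, ?_⟩
    by_contra hcon
    rw [not_lt] at hcon
    have hterm : ∀ i ∈ Finset.Ico n (2 * n), kernelOp m k t f x ≤
        ((C + 1 : ℝ≥0) : ℝ≥0∞) * (kernelOp m k δ)^[i] f x := by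
      intro i hi
      rw [Finset.mem_Ico] at hi
      obtain ⟨i, rfl⟩ : ∃ i', i = i' + 1 := ⟨i - 1, by omega⟩
      rw [hk.iterate_kernelOp hδ hf]
      have h1 : ((n : ℕ) : ℝ) ≤ ((i + 1 : ℕ) : ℝ) := by exact_mod_cast hi.1
      have h2 : ((i + 1 : ℕ) : ℝ) ≤ 2 * (n : ℝ) := by exact_mod_cast hi.2.le
      have h3 := mul_le_mul_of_nonneg_right h1 hδ.le
      have h4 := mul_le_mul_of_nonneg_right h2 hδ.le
      refine (hk.kernelOp_le hC ht (hn1.trans h3) (by linarith) hf x).trans ?_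
      gcongr
      simp
    have hsum := Finset.sum_le_sum hterm
    rw [Finset.sum_const, Nat.card_Ico, ← Finset.mul_sum, nsmul_eq_mul] at hsum
    have hcard : 2 * n - n = n := by omega
    rw [hcard] at hsum
    have hle : ∑ i ∈ Finset.Ico n (2 * n), (kernelOp m k δ)^[i] f x ≤
        orbitSum (kernelOp m k δ) f (2 * n) x := by
      rw [hT.orbitSum_eq_sum hf, Finset.range_eq_Ico]
      exact Finset.sum_le_sum_of_subset (Finset.Ico_subset_Ico_left (Nat.zero_le n))
    have hfinal : (n : ℝ≥0∞) * kernelOp m k t f x ≤ n * s := by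
      calc (n : ℝ≥0∞) * kernelOp m k t f x
          ≤ ((C + 1 : ℝ≥0) : ℝ≥0∞) * (s / D * ((2 * n : ℕ) : ℝ≥0∞)) :=
            hsum.trans (mul_le_mul_right (hle.trans hcon) _)
        _ = n * (D * (s / D)) := by
          rw [hD]
          push_cast
          ring
        _ = n * s := by rw [hDs]
    have hne : (n : ℝ≥0∞) ≠ 0 := by exact_mod_cast hn0.ne'
    exact absurd hlt (not_lt.2 ((ENNReal.mul_le_mul_iff_right hne
      (ENNReal.natCast_ne_top n)).1 hfinal))
  calc s * m {x | ∃ t : ℝ, δ ≤ t ∧ s < kernelOp m k t f x}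
      ≤ s * m {x | ∃ n : ℕ, s / D * n < orbitSum (kernelOp m k δ) f n x} := by gcongr
    _ = D * (s / D * m {x | ∃ n : ℕ, s / D * n < orbitSum (kernelOp m k δ) f n x}) := by
      rw [← mul_assoc, hDs]
    _ ≤ D * ∫⁻ x, f x ∂m := by
      gcongr
      exact hT.mul_measure_exists_lt_orbitSum_le hf hfin hsD

end IsHeatKernel

/-! ### Absolute convergence and `L²` bounds -/

section CauchySchwarz

variable {X : Type*} [MeasurableSpace X] {m : Measure X}

theorem lintegral_mul_le_sqrt_mul_sqrt {f g : X → ℝ≥0∞} (hf : AEMeasurable f m)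
    (hg : AEMeasurable g m) : ∫⁻ x, f x * g x ∂m ≤
      (∫⁻ x, f x ^ 2 ∂m) ^ (1 / 2 : ℝ) * (∫⁻ x, g x ^ 2 ∂m) ^ (1 / 2 : ℝ) := by
  have h := ENNReal.lintegral_mul_le_Lp_mul_Lq m Real.HolderConjugate.two_two hf hg
  simpa only [Pi.mul_apply, ENNReal.rpow_two] using h

theorem sq_lintegral_mul_le {f g : X → ℝ≥0∞} (hf : AEMeasurable f m)
    (hg : AEMeasurable g m) : (∫⁻ x, f x * g x ∂m) ^ 2 ≤
      (∫⁻ x, f x ^ 2 ∂m) * (∫⁻ x, g x ^ 2 ∂m) := by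
  have h := pow_le_pow_left₀ zero_le (lintegral_mul_le_sqrt_mul_sqrt hf hg) 2
  rw [mul_pow, ← ENNReal.rpow_natCast, ← ENNReal.rpow_natCast, ← ENNReal.rpow_natCast,
    ← ENNReal.rpow_mul, ← ENNReal.rpow_mul] at h
  norm_num at h
  exact_mod_cast h

theorem eLpNorm_two_eq (f : X → ℂ) :
    eLpNorm f 2 m = (∫⁻ x, ‖f x‖ₑ ^ 2 ∂m) ^ (1 / 2 : ℝ) := by
  rw [eLpNorm_eq_lintegral_rpow_enorm_toReal (by norm_num) (by norm_num)]
  simp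

theorem eLpNorm_two_le_of_lintegral_le {f g : X → ℂ}
    (h : ∫⁻ x, ‖f x‖ₑ ^ 2 ∂m ≤ ∫⁻ x, ‖g x‖ₑ ^ 2 ∂m) : eLpNorm f 2 m ≤ eLpNorm g 2 m := by
  rw [eLpNorm_two_eq, eLpNorm_two_eq]
  exact ENNReal.rpow_le_rpow h (by norm_num)

theorem MemLp.lintegral_sq_ne_top {f : X → ℂ} (hf : MemLp f 2 m) :
    ∫⁻ x, ‖f x‖ₑ ^ 2 ∂m ≠ ∞ := by
  have h := hf.2.ne
  rw [eLpNorm_two_eq] at h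
  intro h'
  rw [h'] at h
  exact h (ENNReal.top_rpow_of_pos (by norm_num))

end CauchySchwarz

namespace IsHeatKernel

variable {X : Type*} [MeasurableSpace X] {m : Measure X} {q : X → ℝ}
  {Φ : X → X → ℝ} {k : ℝ → X → X → ℝ}

/-- The integral transform with kernel `Φ`. -/
def transform (m : Measure X) (Φ : X → X → ℝ) (f : X → ℂ) (z : X) : ℂ := ∫ x, Φ z x • f x ∂m

/-- The integral operator with kernel `k t`. -/
def heatOp (m : Measure X) (k : ℝ → X → X → ℝ) (t : ℝ) (f : X → ℂ) (x : X) : ℂ :=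
  ∫ y, k t x y • f y ∂m

/-- The square root of the kernel on the diagonal. -/
def sqrtDiag (k : ℝ → X → X → ℝ) (t : ℝ) (x : X) : ℝ≥0∞ :=
  ENNReal.ofReal (k t x x) ^ (1 / 2 : ℝ)

/-- Square integrable functions for which the transform converges absolutely and the Plancherel
computation can be carried out. -/
structure IsNice (m : Measure X) (k : ℝ → X → X → ℝ) (f : X → ℂ) : Prop where
  measurable : Measurable f
  memLp : MemLp f 2 m
  lintegral_lt_top : ∀ t, 0 < t → ∫⁻ x, ‖f x‖ₑ * sqrtDiag k t x ∂m < ∞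

variable (hk : IsHeatKernel m q Φ k)
include hk

theorem measurable_eigen_left (z : X) : Measurable (Φ z) :=
  hk.measurable_eigen.comp measurable_prodMk_left

theorem measurable_eigen_right (x : X) : Measurable fun z => Φ z x :=
  hk.measurable_eigen.comp measurable_prodMk_right

theorem measurable_sqrtDiag {t : ℝ} (ht : 0 < t) : Measurable (sqrtDiag k t) :=
  ((hk.measurable_ofReal_kernel ht).comp (measurable_id.prodMk measurable_id)).pow_const _

theorem measurable_gaussian (t : ℝ) : Measurable fun z => ENNReal.ofReal (Real.exp (-t * q z)) := by
  have := hk.measurable_q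
  fun_prop

theorem lintegral_gaussian_mul_sq_eigen {t : ℝ} (ht : 0 < t) (x : X) :
    ∫⁻ z, ENNReal.ofReal (Real.exp (-t * q z)) * ‖Φ z x‖ₑ ^ 2 ∂m = ENNReal.ofReal (k t x x) := by
  rw [← hk.integral_eigen t ht x x, ofReal_integral_eq_lintegral_ofReal
    (hk.integrable_eigen t ht x x)]
  · refine lintegral_congr fun z => ?_
    rw [mul_assoc, ENNReal.ofReal_mul (Real.exp_pos _).le, ← abs_mul_abs_self, ← sq,
      ENNReal.ofReal_pow (abs_nonneg _), Real.enorm_eq_ofReal_abs]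
  · filter_upwards with z
    simp only [Pi.zero_apply]
    rw [mul_assoc]
    exact mul_nonneg (Real.exp_pos _).le (mul_self_nonneg _)

/-- Cauchy–Schwarz for the measure `e^(-tq) dm`, in which `Φ(·, x)` has norm `sqrtDiag k t x`. -/
theorem lintegral_gaussian_mul_eigen_mul_le {t : ℝ} (ht : 0 < t) (x : X) {f : X → ℝ≥0∞}
    (hf : AEMeasurable f m) :
    ∫⁻ z, ENNReal.ofReal (Real.exp (-t * q z)) * (‖Φ z x‖ₑ * f z) ∂m ≤
      sqrtDiag k t x *
        (∫⁻ z, ENNReal.ofReal (Real.exp (-t * q z)) * f z ^ 2 ∂m) ^ (1 / 2 : ℝ) := by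
  have hG := hk.measurable_gaussian (t / 2)
  have hΦ := (hk.measurable_eigen_right x).enorm
  have hsq : ∀ z, ENNReal.ofReal (Real.exp (-t * q z)) =
      ENNReal.ofReal (Real.exp (-(t / 2) * q z)) ^ 2 := fun z => by
    rw [← ENNReal.ofReal_pow (Real.exp_pos _).le, ← Real.exp_nat_mul]
    congr 2
    push_cast
    ring
  have h := lintegral_mul_le_sqrt_mul_sqrt (m := m) (hG.mul hΦ).aemeasurable
    (hG.aemeasurable.mul hf)
  simp only [Pi.mul_apply, mul_pow, ← hsq] at h
  rw [hk.lintegral_gaussian_mul_sq_eigen ht] at h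
  refine le_trans (le_of_eq ?_) h
  refine lintegral_congr fun z => ?_
  rw [hsq]
  ring

theorem lintegral_gaussian_mul_eigen_mul_eigen_le {t : ℝ} (ht : 0 < t) (x y : X) :
    ∫⁻ z, ENNReal.ofReal (Real.exp (-t * q z)) * (‖Φ z x‖ₑ * ‖Φ z y‖ₑ) ∂m ≤
      sqrtDiag k t x * sqrtDiag k t y := by
  have h := hk.lintegral_gaussian_mul_eigen_mul_le ht x
    (hk.measurable_eigen_right y).enorm.aemeasurable
  rwa [hk.lintegral_gaussian_mul_sq_eigen ht] at h

variable [SFinite m]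

theorem measurable_absTransform {F : X → ℝ≥0∞} (hF : Measurable F) :
    Measurable fun z => ∫⁻ x, ‖Φ z x‖ₑ * F x ∂m :=
  Measurable.lintegral_prod_right' (f := fun p : X × X => ‖Φ p.1 p.2‖ₑ * F p.2)
    (hk.measurable_eigen.enorm.mul (hF.comp measurable_snd))

theorem lintegral_gaussian_mul_eigen_mul_absTransform_le {t : ℝ} (ht : 0 < t) (x : X)
    {F : X → ℝ≥0∞} (hF : Measurable F) :
    ∫⁻ z, ENNReal.ofReal (Real.exp (-t * q z)) * (‖Φ z x‖ₑ * ∫⁻ y, ‖Φ z y‖ₑ * F y ∂m) ∂m ≤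
      sqrtDiag k t x * ∫⁻ y, F y * sqrtDiag k t y ∂m := by
  have hG := hk.measurable_gaussian t
  have h1 : ∀ z, Measurable fun y => ‖Φ z y‖ₑ * F y := fun z =>
    (hk.measurable_eigen_left z).enorm.mul hF
  have h2 : Measurable fun p : X × X => ENNReal.ofReal (Real.exp (-t * q p.1)) *
      (‖Φ p.1 x‖ₑ * (‖Φ p.1 p.2‖ₑ * F p.2)) :=
    (hG.comp measurable_fst).mul (((hk.measurable_eigen_right x).enorm.comp measurable_fst).mul
      (hk.measurable_eigen.enorm.mul (hF.comp measurable_snd)))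
  simp_rw [← lintegral_const_mul _ (h1 _)]
  have h3 : ∀ z, Measurable fun y => ‖Φ z x‖ₑ * (‖Φ z y‖ₑ * F y) := fun z =>
    (h1 z).const_mul _
  simp_rw [← lintegral_const_mul _ (h3 _)]
  have hS : Measurable fun y => F y * sqrtDiag k t y := hF.mul (hk.measurable_sqrtDiag ht)
  rw [lintegral_lintegral_swap h2.aemeasurable, ← lintegral_const_mul _ hS]
  refine lintegral_mono fun y => ?_
  have h4 : ∀ z, ENNReal.ofReal (Real.exp (-t * q z)) * (‖Φ z x‖ₑ * (‖Φ z y‖ₑ * F y)) =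
      ENNReal.ofReal (Real.exp (-t * q z)) * (‖Φ z x‖ₑ * ‖Φ z y‖ₑ) * F y := fun z => by ring
  simp_rw [h4]
  have h5 : Measurable fun z => ENNReal.ofReal (Real.exp (-t * q z)) * (‖Φ z x‖ₑ * ‖Φ z y‖ₑ) :=
    hG.mul ((hk.measurable_eigen_right x).enorm.mul (hk.measurable_eigen_right y).enorm)
  rw [lintegral_mul_const _ h5]
  calc _ ≤ sqrtDiag k t x * sqrtDiag k t y * F y :=
        mul_le_mul_left (hk.lintegral_gaussian_mul_eigen_mul_eigen_le ht x y) _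
    _ = _ := by ring

/-- One factor of the square is written out as an integral and Tonelli reduces to the preceding
estimate. For functions in `IsNice` this supplies the absolute convergence behind the Plancherel
computation. -/
theorem lintegral_gaussian_mul_sq_absTransform_le {t : ℝ} (ht : 0 < t)
    {F : X → ℝ≥0∞} (hF : Measurable F) :
    ∫⁻ z, ENNReal.ofReal (Real.exp (-t * q z)) * (∫⁻ y, ‖Φ z y‖ₑ * F y ∂m) ^ 2 ∂m ≤
      (∫⁻ y, F y * sqrtDiag k t y ∂m) ^ 2 := by
  have hG := hk.measurable_gaussian t
  have hA := hk.measurable_absTransform hF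
  have h1 : ∀ z, Measurable fun y => ‖Φ z y‖ₑ * F y := fun z =>
    (hk.measurable_eigen_left z).enorm.mul hF
  have e : ∀ z, ENNReal.ofReal (Real.exp (-t * q z)) * (∫⁻ y, ‖Φ z y‖ₑ * F y ∂m) ^ 2 =
      ∫⁻ x, ENNReal.ofReal (Real.exp (-t * q z)) * (‖Φ z x‖ₑ * ∫⁻ y, ‖Φ z y‖ₑ * F y ∂m) * F x
        ∂m := by
    intro z
    have : ∀ x, ENNReal.ofReal (Real.exp (-t * q z)) *
        (‖Φ z x‖ₑ * ∫⁻ y, ‖Φ z y‖ₑ * F y ∂m) * F x =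
        (ENNReal.ofReal (Real.exp (-t * q z)) * ∫⁻ y, ‖Φ z y‖ₑ * F y ∂m) * (‖Φ z x‖ₑ * F x) :=
      fun x => by ring
    simp_rw [this]
    rw [lintegral_const_mul _ (h1 z)]
    ring
  simp_rw [e]
  have h2 : Measurable fun p : X × X => ENNReal.ofReal (Real.exp (-t * q p.1)) *
      (‖Φ p.1 p.2‖ₑ * ∫⁻ y, ‖Φ p.1 y‖ₑ * F y ∂m) * F p.2 :=
    ((hG.comp measurable_fst).mul (hk.measurable_eigen.enorm.mul (hA.comp measurable_fst))).mul
      (hF.comp measurable_snd)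
  rw [lintegral_lintegral_swap h2.aemeasurable]
  have h3 : ∀ x, Measurable fun z => ENNReal.ofReal (Real.exp (-t * q z)) *
      (‖Φ z x‖ₑ * ∫⁻ y, ‖Φ z y‖ₑ * F y ∂m) := fun x =>
    hG.mul ((hk.measurable_eigen_right x).enorm.mul hA)
  simp_rw [lintegral_mul_const _ (h3 _)]
  have hS : Measurable fun y => F y * sqrtDiag k t y := hF.mul (hk.measurable_sqrtDiag ht)
  calc _ ≤ ∫⁻ x, (sqrtDiag k t x * ∫⁻ y, F y * sqrtDiag k t y ∂m) * F x ∂m :=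
        lintegral_mono fun x => mul_le_mul_left
          (hk.lintegral_gaussian_mul_eigen_mul_absTransform_le ht x hF) _
    _ = ∫⁻ x, (F x * sqrtDiag k t x) * ∫⁻ y, F y * sqrtDiag k t y ∂m ∂m :=
        lintegral_congr fun x => by ring
    _ = _ := by rw [lintegral_mul_const _ hS, sq]

/-- Schur's test. -/
theorem lintegral_sq_kernelOp_le {t : ℝ} (ht : 0 < t) {F : X → ℝ≥0∞} (hF : Measurable F) :
    ∫⁻ x, kernelOp m k t F x ^ 2 ∂m ≤ ∫⁻ x, F x ^ 2 ∂m := by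
  refine le_trans (lintegral_mono fun x => ?_)
    ((hk.isSubMarkovOperator ht).lintegral_le (fun x => F x ^ 2) (hF.pow_const 2))
  have hK := (hk.measurable_ofReal_kernel_left ht x)
  have hsq : ∀ y, (ENNReal.ofReal (k t x y) ^ (1 / 2 : ℝ)) ^ 2 = ENNReal.ofReal (k t x y) :=
    fun y => by
      rw [← ENNReal.rpow_natCast, ← ENNReal.rpow_mul]
      norm_num
  -- Splitting `k = k^(1/2) · k^(1/2)` gives `(T F)² ≤ (T 1)(T F²) ≤ T F²`, and `T` contracts `L¹`.
  have h := sq_lintegral_mul_le (m := m) (hK.pow_const (1 / 2 : ℝ)).aemeasurable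
    ((hK.pow_const (1 / 2 : ℝ)).mul hF).aemeasurable
  simp only [Pi.mul_apply, mul_pow, hsq, ← mul_assoc] at h
  simp only [← sq, hsq] at h
  exact h.trans (mul_le_of_le_one_left zero_le (hk.subMarkov t ht x))

omit [SFinite m] in
-- For fixed `x` the kernel is bounded and integrable in `y`, hence square integrable.
theorem kernelOp_lt_top_of_lintegral_sq {t : ℝ} (ht : 0 < t) {F : X → ℝ≥0∞}
    (hF : AEMeasurable F m) (hfin : ∫⁻ x, F x ^ 2 ∂m ≠ ∞) (x : X) : kernelOp m k t F x < ∞ := by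
  obtain ⟨C, hC⟩ := hk.bounded t ht x
  have hK := (hk.measurable_ofReal_kernel_left ht x)
  have h := lintegral_mul_le_sqrt_mul_sqrt (m := m) hK.aemeasurable hF
  refine h.trans_lt (ENNReal.mul_lt_top (ENNReal.rpow_lt_top_of_nonneg (by norm_num) ?_)
    (ENNReal.rpow_lt_top_of_nonneg (by norm_num) hfin))
  have h2 : ∫⁻ y, ENNReal.ofReal (k t x y) ^ 2 ∂m ≤
      ENNReal.ofReal C * ∫⁻ y, ENNReal.ofReal (k t x y) ∂m := by
    rw [← lintegral_const_mul _ hK]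
    refine lintegral_mono fun y => ?_
    rw [sq]
    exact mul_le_mul_left (ENNReal.ofReal_le_ofReal (hC y)) _
  exact ne_top_of_le_ne_top (ENNReal.mul_ne_top ENNReal.ofReal_ne_top
    (ne_top_of_le_ne_top ENNReal.one_ne_top (hk.subMarkov t ht x))) h2

omit [SFinite m] in
theorem kernelOp_lt_top_of_lintegral {t : ℝ} (ht : 0 < t) {F : X → ℝ≥0∞}
    (hfin : ∫⁻ x, F x ∂m ≠ ∞) (x : X) : kernelOp m k t F x < ∞ := by
  obtain ⟨C, hC⟩ := hk.bounded t ht x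
  refine (lintegral_mono fun y => mul_le_mul_left (ENNReal.ofReal_le_ofReal (hC y)) _).trans_lt ?_
  rw [lintegral_const_mul' _ _ ENNReal.ofReal_ne_top]
  exact ENNReal.mul_lt_top ENNReal.ofReal_lt_top hfin.lt_top

omit [SFinite m] in
theorem integrable_kernel_smul {t : ℝ} (ht : 0 < t) {f : X → ℂ} (hf : AEStronglyMeasurable f m)
    {x : X} (hfin : kernelOp m k t (fun y => ‖f y‖ₑ) x < ∞) :
    Integrable (fun y => k t x y • f y) m := by
  refine ⟨((hk.measurable_kernel t ht).comp
    measurable_prodMk_left).aestronglyMeasurable.smul hf, ?_⟩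
  refine lt_of_eq_of_lt (lintegral_congr fun y => ?_) hfin
  rw [enorm_smul, Real.enorm_eq_ofReal (hk.nonneg t ht x y)]

omit [SFinite m] in
theorem enorm_heatOp_le {t : ℝ} (ht : 0 < t) (f : X → ℂ) (x : X) :
    ‖heatOp m k t f x‖ₑ ≤ kernelOp m k t (fun y => ‖f y‖ₑ) x := by
  refine (enorm_integral_le_lintegral_enorm _).trans (le_of_eq (lintegral_congr fun y => ?_))
  rw [enorm_smul, Real.enorm_eq_ofReal (hk.nonneg t ht x y)]

theorem eLpNorm_heatOp_le {t : ℝ} (ht : 0 < t) {f : X → ℂ} (hf : MemLp f 2 m) :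
    eLpNorm (heatOp m k t f) 2 m ≤ eLpNorm f 2 m := by
  obtain ⟨g, hg, hfg⟩ := hf.1.aemeasurable
  have e : heatOp m k t f = heatOp m k t g := by
    funext x
    exact integral_congr_ae (hfg.mono fun y hy => by simp only [hy])
  rw [e, eLpNorm_congr_ae hfg]
  refine eLpNorm_two_le_of_lintegral_le ?_
  exact (lintegral_mono fun x => pow_le_pow_left₀ zero_le (hk.enorm_heatOp_le ht g x) 2).trans
    (hk.lintegral_sq_kernelOp_le ht hg.enorm)

theorem aestronglyMeasurable_heatOp {t : ℝ} (ht : 0 < t) {f : X → ℂ}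
    (hf : AEStronglyMeasurable f m) : AEStronglyMeasurable (heatOp m k t f) m := by
  obtain ⟨g, hg, hfg⟩ := hf
  have e : heatOp m k t f = heatOp m k t g := by
    funext x
    exact integral_congr_ae (hfg.mono fun y hy => by simp only [hy])
  rw [e]
  have : StronglyMeasurable fun p : X × X => k t p.1 p.2 • g p.2 :=
    (hk.measurable_kernel t ht).stronglyMeasurable.smul (hg.comp_measurable measurable_snd)
  exact this.integral_prod_right.aestronglyMeasurable

theorem memLp_heatOp {t : ℝ} (ht : 0 < t) {f : X → ℂ} (hf : MemLp f 2 m) :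
    MemLp (heatOp m k t f) 2 m :=
  ⟨hk.aestronglyMeasurable_heatOp ht hf.1, (hk.eLpNorm_heatOp_le ht hf).trans_lt hf.2⟩

theorem measurable_transform {f : X → ℂ} (hf : Measurable f) : Measurable (transform m Φ f) := by
  have : StronglyMeasurable fun p : X × X => Φ p.1 p.2 • f p.2 :=
    hk.measurable_eigen.stronglyMeasurable.smul
      (hf.stronglyMeasurable.comp_measurable measurable_snd)
  exact this.integral_prod_right.measurable

/-- The Gaussian-weighted square integral is finite and the Gaussian never vanishes. Convergence is
obtained only almost everywhere, and so is linearity in `transform_sub`. -/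
theorem ae_absTransform_lt_top {f : X → ℂ} (hf : IsNice m k f) :
    ∀ᵐ z ∂m, ∫⁻ x, ‖Φ z x‖ₑ * ‖f x‖ₑ ∂m < ∞ := by
  have hA := hk.measurable_absTransform hf.measurable.enorm
  have h := (hk.lintegral_gaussian_mul_sq_absTransform_le one_pos hf.measurable.enorm).trans_lt
    (ENNReal.pow_lt_top (hf.lintegral_lt_top 1 one_pos))
  filter_upwards [ae_lt_top ((hk.measurable_gaussian 1).mul (hA.pow_const 2)) h.ne] with z hz
  by_contra hcon
  rw [not_lt, top_le_iff] at hcon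
  simp only [Pi.mul_apply, hcon] at hz
  have h0 : ENNReal.ofReal (Real.exp (-1 * q z)) ≠ 0 := by
    simpa using Real.exp_pos _
  rw [ENNReal.top_pow (by norm_num), ENNReal.mul_top h0] at hz
  exact lt_irrefl _ hz

theorem ae_integrable_eigen_smul {f : X → ℂ} (hf : IsNice m k f) :
    ∀ᵐ z ∂m, Integrable (fun x => Φ z x • f x) m := by
  filter_upwards [hk.ae_absTransform_lt_top hf] with z hz
  refine ⟨(hk.measurable_eigen_left z).aestronglyMeasurable.smul hf.memLp.1, ?_⟩
  refine lt_of_eq_of_lt (lintegral_congr fun y => ?_) hz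
  rw [enorm_smul]

omit [SFinite m] in
theorem IsNice.sub {f g : X → ℂ} (hf : IsNice m k f) (hg : IsNice m k g) :
    IsNice m k (f - g) where
  measurable := hf.measurable.sub hg.measurable
  memLp := hf.memLp.sub hg.memLp
  lintegral_lt_top t ht := by
    refine lt_of_le_of_lt ?_ (ENNReal.add_lt_top.2
      ⟨hf.lintegral_lt_top t ht, hg.lintegral_lt_top t ht⟩)
    have hS : Measurable fun x => ‖f x‖ₑ * sqrtDiag k t x :=
      hf.measurable.enorm.mul (hk.measurable_sqrtDiag ht)
    rw [← lintegral_add_left hS]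
    refine lintegral_mono fun x => ?_
    rw [← add_mul]
    exact mul_le_mul_left (enorm_sub_le) _

theorem transform_sub {f g : X → ℂ} (hf : IsNice m k f) (hg : IsNice m k g) :
    transform m Φ (f - g) =ᵐ[m] transform m Φ f - transform m Φ g := by
  filter_upwards [hk.ae_integrable_eigen_smul hf, hk.ae_integrable_eigen_smul hg] with z h1 h2
  simp only [transform, Pi.sub_apply, smul_sub]
  exact integral_sub h1 h2

end IsHeatKernel

/-! ### The Plancherel inequality and the semigroup on `L²` -/

namespace IsHeatKernel

variable {X : Type*} [MeasurableSpace X] {m : Measure X} {q : X → ℝ}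
  {Φ : X → X → ℝ} {k : ℝ → X → X → ℝ}

theorem enorm_transform_le (f : X → ℂ) (z : X) :
    ‖transform m Φ f z‖ₑ ≤ ∫⁻ x, ‖Φ z x‖ₑ * ‖f x‖ₑ ∂m := by
  refine (enorm_integral_le_lintegral_enorm _).trans (le_of_eq (lintegral_congr fun y => ?_))
  rw [enorm_smul]

theorem enorm_gaussian_smul {X : Type*} (q : X → ℝ) (t : ℝ) (f : X → ℂ) (z : X) :
    ‖Real.exp (-t * q z) • f z‖ₑ = ENNReal.ofReal (Real.exp (-t * q z)) * ‖f z‖ₑ := by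
  rw [enorm_smul, Real.enorm_eq_ofReal (Real.exp_pos _).le]

variable (hk : IsHeatKernel m q Φ k) [SFinite m]
include hk

/-- The Plancherel computation with a Gaussian regularization. -/
theorem lintegral_gaussian_mul_sq_transform_le {t : ℝ} (ht : 0 < t) {f : X → ℂ}
    (hf : IsNice m k f) :
    ∫⁻ z, ENNReal.ofReal (Real.exp (-t * q z)) * ‖transform m Φ f z‖ₑ ^ 2 ∂m ≤
      ∫⁻ x, ‖f x‖ₑ ^ 2 ∂m := by
  have hfm := hf.measurable
  have hq := hk.measurable_q
  have hfin := (hk.lintegral_gaussian_mul_sq_absTransform_le ht hfm.enorm).trans_lt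
    (ENNReal.pow_lt_top (hf.lintegral_lt_top t ht))
  -- Integrated over `p` first, `G` gives `e^(-tq)` times the squared modulus of the transform;
  -- integrated over `z` first, it gives the quadratic form of `k t`.
  let G : X → X × X → ℂ := fun z p =>
    (Real.exp (-t * q z) : ℂ) * ((Φ z p.1 • f p.1) * (starRingEnd ℂ) (Φ z p.2 • f p.2))
  have hGm : StronglyMeasurable (Function.uncurry G) := by
    refine Measurable.stronglyMeasurable ?_
    have h1 : Measurable fun p : X × X × X => Φ p.1 p.2.1 • f p.2.1 :=
      (hk.measurable_eigen.comp (measurable_fst.prodMk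
        (measurable_fst.comp measurable_snd))).smul (hfm.comp (measurable_fst.comp measurable_snd))
    have h2 : Measurable fun p : X × X × X => Φ p.1 p.2.2 • f p.2.2 :=
      (hk.measurable_eigen.comp (measurable_fst.prodMk
        (measurable_snd.comp measurable_snd))).smul (hfm.comp (measurable_snd.comp measurable_snd))
    have h3 : Measurable fun p : X × X × X => (Real.exp (-t * q p.1) : ℂ) := by fun_prop
    exact h3.mul (h1.mul (Complex.continuous_conj.measurable.comp h2))
  have hGe : ∀ z p, ‖G z p‖ₑ = ENNReal.ofReal (Real.exp (-t * q z)) *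
      ((‖Φ z p.1‖ₑ * ‖f p.1‖ₑ) * (‖Φ z p.2‖ₑ * ‖f p.2‖ₑ)) := by
    intro z p
    have h1 : ‖(Real.exp (-t * q z) : ℂ)‖ₑ = ENNReal.ofReal (Real.exp (-t * q z)) := by
      rw [← ofReal_norm, Complex.norm_real, Real.norm_eq_abs,
        abs_of_pos (Real.exp_pos _)]
    have h2 : ∀ c : ℂ, ‖(starRingEnd ℂ) c‖ₑ = ‖c‖ₑ := fun c => by
      rw [← ofReal_norm, ← ofReal_norm, RCLike.norm_conj]
    simp only [G]
    rw [enorm_mul, enorm_mul, h1, h2, enorm_smul, enorm_smul]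
  have hA : ∀ z, Measurable fun x => ‖Φ z x‖ₑ * ‖f x‖ₑ := fun z =>
    (hk.measurable_eigen_left z).enorm.mul hfm.enorm
  have hGint : Integrable (Function.uncurry G) (m.prod (m.prod m)) := by
    refine ⟨hGm.aestronglyMeasurable, ?_⟩
    rw [HasFiniteIntegral, lintegral_prod _ hGm.measurable.enorm.aemeasurable]
    refine lt_of_eq_of_lt (lintegral_congr fun z => ?_) hfin
    simp only [Function.uncurry, hGe]
    have hm2 : Measurable fun p : X × X => (‖Φ z p.1‖ₑ * ‖f p.1‖ₑ) * (‖Φ z p.2‖ₑ * ‖f p.2‖ₑ) :=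
      ((hA z).comp measurable_fst).mul ((hA z).comp measurable_snd)
    rw [lintegral_const_mul _ hm2,
      lintegral_prod_mul (hA z).aemeasurable (hA z).aemeasurable, sq]
  have hinner : ∀ z, ∫ p, G z p ∂(m.prod m) =
      ((Real.exp (-t * q z) * ‖transform m Φ f z‖ ^ 2 : ℝ) : ℂ) := by
    intro z
    simp only [G]
    rw [integral_const_mul, integral_prod_mul (fun x => Φ z x • f x)
      (fun x => (starRingEnd ℂ) (Φ z x • f x)), integral_conj]
    change _ * (transform m Φ f z * (starRingEnd ℂ) (transform m Φ f z)) = _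
    rw [Complex.mul_conj, Complex.normSq_eq_norm_sq]
    push_cast
    rfl
  have houter : ∀ p : X × X, ∫ z, G z p ∂m = (k t p.1 p.2 : ℂ) *
      (f p.1 * (starRingEnd ℂ) (f p.2)) := by
    intro p
    have : ∀ z, G z p = ((Real.exp (-t * q z) * Φ z p.1 * Φ z p.2 : ℝ) : ℂ) *
        (f p.1 * (starRingEnd ℂ) (f p.2)) := fun z => by
      simp only [G, Complex.real_smul, map_mul, Complex.conj_ofReal]
      push_cast
      ring
    simp_rw [this]
    rw [integral_mul_const, integral_complex_ofReal, hk.integral_eigen t ht]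
  have hswap := integral_integral_swap hGint
  simp_rw [hinner, houter] at hswap
  rw [integral_complex_ofReal] at hswap
  have hreal : Integrable (fun z => Real.exp (-t * q z) * ‖transform m Φ f z‖ ^ 2) m := by
    have h := hGint.integral_prod_left
    have h2 : (fun z => ∫ p, Function.uncurry G (z, p) ∂(m.prod m)) =
        fun z => ((Real.exp (-t * q z) * ‖transform m Φ f z‖ ^ 2 : ℝ) : ℂ) := by
      funext z
      exact hinner z
    rw [h2] at h
    exact_mod_cast h.re
  have hlhs : ∫⁻ z, ENNReal.ofReal (Real.exp (-t * q z)) * ‖transform m Φ f z‖ₑ ^ 2 ∂m =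
      ‖((∫ z, Real.exp (-t * q z) * ‖transform m Φ f z‖ ^ 2 ∂m : ℝ) : ℂ)‖ₑ := by
    have h0 : 0 ≤ ∫ z, Real.exp (-t * q z) * ‖transform m Φ f z‖ ^ 2 ∂m :=
      integral_nonneg fun z => by positivity
    rw [← ofReal_norm, Complex.norm_real, Real.norm_eq_abs, abs_of_nonneg h0,
      ofReal_integral_eq_lintegral_ofReal hreal (Eventually.of_forall fun z => by positivity)]
    refine lintegral_congr fun z => ?_
    rw [ENNReal.ofReal_mul (Real.exp_pos _).le, ENNReal.ofReal_pow (norm_nonneg _),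
      ofReal_norm]
  rw [hlhs, hswap]
  refine (enorm_integral_le_lintegral_enorm _).trans ?_
  have hke : ∀ p : X × X, ‖(k t p.1 p.2 : ℂ) * (f p.1 * (starRingEnd ℂ) (f p.2))‖ₑ =
      ‖f p.1‖ₑ * (ENNReal.ofReal (k t p.1 p.2) * ‖f p.2‖ₑ) := by
    intro p
    have h1 : ‖(k t p.1 p.2 : ℂ)‖ₑ = ENNReal.ofReal (k t p.1 p.2) := by
      rw [← ofReal_norm, Complex.norm_real, Real.norm_eq_abs,
        abs_of_nonneg (hk.nonneg t ht _ _)]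
    have h2 : ∀ c : ℂ, ‖(starRingEnd ℂ) c‖ₑ = ‖c‖ₑ := fun c => by
      rw [← ofReal_norm, ← ofReal_norm, RCLike.norm_conj]
    rw [enorm_mul, enorm_mul, h1, h2]
    ring
  simp_rw [hke]
  have hm3 : Measurable fun p : X × X => ENNReal.ofReal (k t p.1 p.2) * ‖f p.2‖ₑ :=
    (hk.measurable_ofReal_kernel ht).mul (hfm.enorm.comp measurable_snd)
  have hm4 : Measurable fun p : X × X =>
      ‖f p.1‖ₑ * (ENNReal.ofReal (k t p.1 p.2) * ‖f p.2‖ₑ) :=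
    (hfm.enorm.comp measurable_fst).mul hm3
  rw [lintegral_prod _ hm4.aemeasurable]
  have hm5 : ∀ x, Measurable fun y => ENNReal.ofReal (k t x y) * ‖f y‖ₑ := fun x =>
    (hk.measurable_ofReal_kernel_left ht x).mul hfm.enorm
  simp_rw [lintegral_const_mul _ (hm5 _)]
  -- The quadratic form is at most `‖f‖ ‖T|f|‖`, with `T` the operator of `k t`, and Schur's test
  -- bounds this by `‖f‖²`.
  refine (lintegral_mul_le_sqrt_mul_sqrt hfm.enorm.aemeasurable
    (hk.measurable_kernelOp ht hfm.enorm).aemeasurable).trans ?_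
  have hS := hk.lintegral_sq_kernelOp_le ht hfm.enorm
  calc _ ≤ (∫⁻ x, ‖f x‖ₑ ^ 2 ∂m) ^ (1 / 2 : ℝ) * (∫⁻ x, ‖f x‖ₑ ^ 2 ∂m) ^ (1 / 2 : ℝ) := by
        gcongr
    _ = _ := by
      rw [← ENNReal.rpow_add_of_nonneg _ _ (by norm_num) (by norm_num)]
      norm_num

/-- Fatou's lemma removes the Gaussian along `t = 1/(n+1)`. Contractivity suffices for the extension
by continuity; isometry is never needed. -/
theorem lintegral_sq_transform_le {f : X → ℂ} (hf : IsNice m k f) :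
    ∫⁻ z, ‖transform m Φ f z‖ₑ ^ 2 ∂m ≤ ∫⁻ x, ‖f x‖ₑ ^ 2 ∂m := by
  have hm := (hk.measurable_transform hf.measurable).enorm.pow_const 2
  have hlim : ∀ z, Tendsto (fun n : ℕ => ENNReal.ofReal (Real.exp (-(1 / ((n : ℝ) + 1)) * q z)) *
      ‖transform m Φ f z‖ₑ ^ 2) atTop (𝓝 (1 * ‖transform m Φ f z‖ₑ ^ 2)) := by
    intro z
    refine ENNReal.Tendsto.mul_const ?_ (Or.inl one_ne_zero)
    rw [← ENNReal.ofReal_one]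
    refine ENNReal.tendsto_ofReal ?_
    have h := ((tendsto_one_div_add_atTop_nhds_zero_nat (𝕜 := ℝ)).neg.mul_const (q z)).rexp
    simpa using h
  calc ∫⁻ z, ‖transform m Φ f z‖ₑ ^ 2 ∂m
      = ∫⁻ z, liminf (fun n : ℕ => ENNReal.ofReal (Real.exp (-(1 / ((n : ℝ) + 1)) * q z)) *
        ‖transform m Φ f z‖ₑ ^ 2) atTop ∂m :=
        lintegral_congr fun z => by rw [(hlim z).liminf_eq, one_mul]
    _ ≤ liminf (fun n : ℕ => ∫⁻ z, ENNReal.ofReal (Real.exp (-(1 / ((n : ℝ) + 1)) * q z)) *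
        ‖transform m Φ f z‖ₑ ^ 2 ∂m) atTop :=
        lintegral_liminf_le fun n => (hk.measurable_gaussian _).mul hm
    _ ≤ liminf (fun _ : ℕ => ∫⁻ x, ‖f x‖ₑ ^ 2 ∂m) atTop :=
        liminf_le_liminf (Eventually.of_forall fun n =>
          hk.lintegral_gaussian_mul_sq_transform_le (by positivity) hf)
    _ = _ := by simp

theorem eLpNorm_transform_le {f : X → ℂ} (hf : IsNice m k f) :
    eLpNorm (transform m Φ f) 2 m ≤ eLpNorm f 2 m :=
  eLpNorm_two_le_of_lintegral_le (hk.lintegral_sq_transform_le hf)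

theorem memLp_transform {f : X → ℂ} (hf : IsNice m k f) : MemLp (transform m Φ f) 2 m :=
  ⟨(hk.measurable_transform hf.measurable).aestronglyMeasurable,
    (hk.eLpNorm_transform_le hf).trans_lt hf.memLp.2⟩

theorem eLpNorm_transform_sub_le {f g : X → ℂ} (hf : IsNice m k f) (hg : IsNice m k g) :
    eLpNorm (transform m Φ f - transform m Φ g) 2 m ≤ eLpNorm (f - g) 2 m := by
  rw [← eLpNorm_congr_ae (hk.transform_sub hf hg)]
  exact hk.eLpNorm_transform_le (IsNice.sub hk hf hg)

omit [SFinite m] in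
theorem eLpNorm_gaussian_smul_le {t : ℝ} (ht : 0 < t) (f : X → ℂ) :
    eLpNorm (fun z => Real.exp (-t * q z) • f z) 2 m ≤ eLpNorm f 2 m := by
  refine eLpNorm_mono fun z => ?_
  rw [norm_smul, Real.norm_eq_abs, abs_of_pos (Real.exp_pos _)]
  refine mul_le_of_le_one_left (norm_nonneg _) (Real.exp_le_one_iff.2 ?_)
  have := mul_nonneg ht.le (hk.q_nonneg z)
  linarith

omit [SFinite m] in
theorem memLp_gaussian_smul {t : ℝ} (ht : 0 < t) {f : X → ℂ} (hf : MemLp f 2 m) :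
    MemLp (fun z => Real.exp (-t * q z) • f z) 2 m := by
  refine ⟨?_, (hk.eLpNorm_gaussian_smul_le ht f).trans_lt hf.2⟩
  have hq := hk.measurable_q
  have : Measurable fun z => Real.exp (-t * q z) := by fun_prop
  exact this.aestronglyMeasurable.smul hf.1

/-- Cauchy–Schwarz, with half of the Gaussian given to the transform and half to `sqrtDiag`, where
`lintegral_diag` applies. -/
theorem isNice_gaussian_smul_transform {t : ℝ} (ht : 0 < t) {f : X → ℂ} (hf : IsNice m k f) :
    IsNice m k fun z => Real.exp (-t * q z) • transform m Φ f z where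
  measurable := by
    have hq := hk.measurable_q
    have : Measurable fun z => Real.exp (-t * q z) := by fun_prop
    exact this.smul (hk.measurable_transform hf.measurable)
  memLp := hk.memLp_gaussian_smul ht (hk.memLp_transform hf)
  lintegral_lt_top s hs := by
    have hG := hk.measurable_gaussian (t / 2)
    have hA := hk.measurable_absTransform hf.measurable.enorm
    have hS := hk.measurable_sqrtDiag hs
    have hsq : ∀ z, ENNReal.ofReal (Real.exp (-t * q z)) =
        ENNReal.ofReal (Real.exp (-(t / 2) * q z)) ^ 2 := fun z => by
      rw [← ENNReal.ofReal_pow (Real.exp_pos _).le, ← Real.exp_nat_mul]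
      congr 2
      push_cast
      ring
    have hS2 : ∀ z, sqrtDiag k s z ^ 2 = ENNReal.ofReal (k s z z) := fun z => by
      rw [sqrtDiag, ← ENNReal.rpow_natCast, ← ENNReal.rpow_mul]
      norm_num
    have hle : ∀ z, ‖Real.exp (-t * q z) • transform m Φ f z‖ₑ * sqrtDiag k s z ≤
        (ENNReal.ofReal (Real.exp (-(t / 2) * q z)) * ∫⁻ x, ‖Φ z x‖ₑ * ‖f x‖ₑ ∂m) *
        (ENNReal.ofReal (Real.exp (-(t / 2) * q z)) * sqrtDiag k s z) := by
      intro z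
      rw [enorm_gaussian_smul, hsq]
      calc _ ≤ ENNReal.ofReal (Real.exp (-(t / 2) * q z)) ^ 2 *
            (∫⁻ x, ‖Φ z x‖ₑ * ‖f x‖ₑ ∂m) * sqrtDiag k s z := by
            gcongr
            exact enorm_transform_le f z
        _ = _ := by ring
    refine (lintegral_mono hle).trans_lt ((lintegral_mul_le_sqrt_mul_sqrt (hG.mul hA).aemeasurable
      (hG.mul hS).aemeasurable).trans_lt ?_)
    simp only [Pi.mul_apply, mul_pow, ← hsq, hS2]
    refine ENNReal.mul_lt_top (ENNReal.rpow_lt_top_of_nonneg (by norm_num) ?_)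
      (ENNReal.rpow_lt_top_of_nonneg (by norm_num) (hk.lintegral_diag t s ht hs).ne)
    exact ((hk.lintegral_gaussian_mul_sq_absTransform_le ht hf.measurable.enorm).trans_lt
      (ENNReal.pow_lt_top (hf.lintegral_lt_top t ht))).ne

/-- Fubini: by symmetry of `Φ`, the inner integral in `z` is the spectral formula for `k t x y`. -/
theorem transform_gaussian_smul_transform {t : ℝ} (ht : 0 < t) {f : X → ℂ} (hf : IsNice m k f) :
    transform m Φ (fun z => Real.exp (-t * q z) • transform m Φ f z) = heatOp m k t f := by
  funext x
  have hq := hk.measurable_q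
  have hfm := hf.measurable
  let G : X → X → ℂ := fun z y => (Real.exp (-t * q z) * Φ z x * Φ z y) • f y
  have hGm : Measurable (Function.uncurry G) := by
    have h1 : Measurable fun p : X × X => Real.exp (-t * q p.1) * Φ p.1 x * Φ p.1 p.2 := by
      have h2 : Measurable fun p : X × X => Φ p.1 x :=
        (hk.measurable_eigen_right x).comp measurable_fst
      have h3 : Measurable fun p : X × X => Φ p.1 p.2 := hk.measurable_eigen
      fun_prop
    exact h1.smul (hfm.comp measurable_snd)
  have hA : ∀ z, Measurable fun y => ‖Φ z y‖ₑ * ‖f y‖ₑ := fun z =>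
    (hk.measurable_eigen_left z).enorm.mul hfm.enorm
  have hGint : Integrable (Function.uncurry G) (m.prod m) := by
    refine ⟨hGm.aestronglyMeasurable, ?_⟩
    rw [HasFiniteIntegral, lintegral_prod _ hGm.enorm.aemeasurable]
    have hS : sqrtDiag k t x < ∞ := by
      unfold sqrtDiag
      exact ENNReal.rpow_lt_top_of_nonneg (by norm_num) ENNReal.ofReal_ne_top
    refine lt_of_eq_of_lt (lintegral_congr fun z => ?_)
      ((hk.lintegral_gaussian_mul_eigen_mul_absTransform_le ht x hfm.enorm).trans_lt
      (ENNReal.mul_lt_top hS (hf.lintegral_lt_top t ht)))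
    rw [← lintegral_const_mul _ (hA z), ← lintegral_const_mul _ ((hA z).const_mul _)]
    refine lintegral_congr fun y => ?_
    simp only [Function.uncurry, G]
    rw [enorm_smul, enorm_mul, enorm_mul, Real.enorm_eq_ofReal (Real.exp_pos _).le]
    ring
  have hswap := integral_integral_swap hGint
  have h1 : ∀ z, ∫ y, G z y ∂m = Φ x z • (Real.exp (-t * q z) • transform m Φ f z) := by
    intro z
    rw [smul_smul, transform, ← integral_smul, hk.eigen_symm x z]
    refine integral_congr_ae (Eventually.of_forall fun y => ?_)
    simp only [G, smul_smul]
    congr 1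
    ring
  have h2 : ∀ y, ∫ z, G z y ∂m = k t x y • f y := by
    intro y
    simp only [G]
    rw [integral_smul_const, hk.integral_eigen t ht]
  simp_rw [h1, h2] at hswap
  exact hswap

/-- The heat semigroup on `L²` in terms of the transform extended by continuity from a dense class
of functions. -/
theorem exists_approx_heatOp {P : (X → ℂ) → Prop} (hP : ∀ f, P f → IsNice m k f)
    (hdense : ∀ f : X → ℂ, MemLp f 2 m → ∀ ε : ℝ≥0∞, ε ≠ 0 →
      ∃ F, P F ∧ eLpNorm (F - f) 2 m ≤ ε)
    {t : ℝ} (ht : 0 < t) {f : X → ℂ} (hf : MemLp f 2 m) :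
    ∃ g : X → ℂ, MemLp g 2 m ∧
      (∃ F : ℕ → X → ℂ, (∀ n, P (F n)) ∧
        Tendsto (fun n => eLpNorm (F n - f) 2 m) atTop (𝓝 0) ∧
        Tendsto (fun n => eLpNorm (transform m Φ (F n) - g) 2 m) atTop (𝓝 0)) ∧
      ∃ F : ℕ → X → ℂ, (∀ n, P (F n)) ∧
        Tendsto (fun n => eLpNorm (F n - fun z => Real.exp (-t * q z) • g z) 2 m) atTop (𝓝 0) ∧
        Tendsto (fun n => eLpNorm (transform m Φ (F n) - heatOp m k t f) 2 m) atTop (𝓝 0) := by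
  set ε : ℕ → ℝ≥0∞ := fun n => 2⁻¹ ^ n with hε
  have hε0 : ∀ n, ε n ≠ 0 := fun n => pow_ne_zero _ (by simp)
  have hεlim : Tendsto ε atTop (𝓝 0) :=
    ENNReal.tendsto_pow_atTop_nhds_zero_of_lt_one (by simp)
  have hεanti : Antitone ε := fun a b hab => pow_le_pow_right_of_le_one' (by simp) hab
  have hεtop : ∀ n, ε n ≠ ∞ := fun n => ENNReal.pow_ne_top (by simp)
  choose F hFP hFf using fun n => hdense f hf (ε n) (hε0 n)
  have hFn : ∀ n, IsNice m k (F n) := fun n => hP _ (hFP n)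
  have hTm : ∀ n, AEStronglyMeasurable (transform m Φ (F n)) m := fun n =>
    (hk.memLp_transform (hFn n)).1
  have hFF : ∀ a b, eLpNorm (transform m Φ (F a) - transform m Φ (F b)) 2 m ≤ ε a + ε b := by
    intro a b
    refine (hk.eLpNorm_transform_sub_le (hFn a) (hFn b)).trans ?_
    have e : F a - F b = (F a - f) + (f - F b) := by abel
    rw [e]
    refine (eLpNorm_add_le ((hFn a).memLp.sub hf).1 (hf.sub (hFn b).memLp).1 (by norm_num)).trans ?_
    rw [eLpNorm_sub_comm f]
    exact add_le_add (hFf a) (hFf b)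
  obtain ⟨g, hg, hgl⟩ := Lp.cauchy_complete_eLpNorm (by norm_num : (1 : ℝ≥0∞) ≤ 2)
    -- The distances are at most `2 * ε N`; the factor 4 makes the inequality strict, and the
    -- geometric choice of `ε` makes the bounds summable.
    (fun n => hk.memLp_transform (hFn n)) (B := fun N => 4 * ε N) (by
      rw [ENNReal.tsum_mul_left, hε, ENNReal.tsum_geometric]
      refine ENNReal.mul_ne_top (by norm_num) ?_
      simp) (by
      intro N a b ha hb
      calc eLpNorm (transform m Φ (F a) - transform m Φ (F b)) 2 m ≤ ε a + ε b := hFF a b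
        _ ≤ ε N + ε N := add_le_add (hεanti ha) (hεanti hb)
        _ = 2 * ε N := by ring
        _ < 4 * ε N := by
          rw [ENNReal.mul_lt_mul_iff_left (hε0 N) (hεtop N)]
          norm_num)
  refine ⟨g, hg, ⟨F, hFP, tendsto_of_tendsto_of_tendsto_of_le_of_le tendsto_const_nhds hεlim
    (fun _ => zero_le) hFf, hgl⟩, ?_⟩
  have hN : ∀ n, IsNice m k fun z => Real.exp (-t * q z) • transform m Φ (F n) z := fun n =>
    hk.isNice_gaussian_smul_transform ht (hFn n)
  -- Gaussian times the transform of `F n` need not satisfy `P`, so a second approximation is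
  -- required.
  choose H hHP hHf using fun n => hdense _ (hN n).memLp (ε n) (hε0 n)
  have hHn : ∀ n, IsNice m k (H n) := fun n => hP _ (hHP n)
  refine ⟨H, hHP, ?_, ?_⟩
  · have hle : ∀ n, eLpNorm (H n - fun z => Real.exp (-t * q z) • g z) 2 m ≤
        ε n + eLpNorm (transform m Φ (F n) - g) 2 m := by
      intro n
      have e : (H n - fun z => Real.exp (-t * q z) • g z) =
          (H n - fun z => Real.exp (-t * q z) • transform m Φ (F n) z) +
          fun z => Real.exp (-t * q z) • (transform m Φ (F n) - g) z := by
        funext z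
        simp only [Pi.sub_apply, Pi.add_apply, smul_sub]
        ring
      rw [e]
      have hd := (hk.memLp_transform (hFn n)).sub hg
      refine (eLpNorm_add_le ((hHn n).memLp.sub (hN n).memLp).1
        (hk.memLp_gaussian_smul ht hd).1 (by norm_num)).trans ?_
      exact add_le_add (hHf n) (hk.eLpNorm_gaussian_smul_le ht _)
    refine tendsto_of_tendsto_of_tendsto_of_le_of_le tendsto_const_nhds ?_
      (fun _ => zero_le) hle
    simpa using hεlim.add hgl
  · have hle : ∀ n, eLpNorm (transform m Φ (H n) - heatOp m k t f) 2 m ≤ ε n + ε n := by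
      intro n
      -- The first difference is controlled by contractivity of the transform; the second arises
      -- from the exact formula for `F n` and is controlled by contractivity of `heatOp`.
      have e : transform m Φ (H n) - heatOp m k t f =
          (transform m Φ (H n) -
            transform m Φ (fun z => Real.exp (-t * q z) • transform m Φ (F n) z)) +
          heatOp m k t (F n - f) := by
        rw [hk.transform_gaussian_smul_transform ht (hFn n)]
        funext x
        have hi : ∀ g : X → ℂ, MemLp g 2 m → Integrable (fun y => k t x y • g y) m := fun g hg =>
          hk.integrable_kernel_smul ht hg.1 (hk.kernelOp_lt_top_of_lintegral_sq ht hg.1.enorm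
            (MemLp.lintegral_sq_ne_top hg) x)
        have h3 : heatOp m k t (F n - f) x = heatOp m k t (F n) x - heatOp m k t f x := by
          simp only [heatOp, Pi.sub_apply, smul_sub]
          exact integral_sub (hi _ (hFn n).memLp) (hi _ hf)
        simp only [Pi.sub_apply, Pi.add_apply, h3]
        ring
      rw [e]
      have hd := (hFn n).memLp.sub hf
      refine (eLpNorm_add_le ((hk.memLp_transform (hHn n)).sub (hk.memLp_transform (hN n))).1
        (hk.memLp_heatOp ht hd).1 (by norm_num)).trans ?_
      exact add_le_add ((hk.eLpNorm_transform_sub_le (hHn n) (hN n)).trans (hHf n))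
        ((hk.eLpNorm_heatOp_le ht hd).trans (hFf n))
    refine tendsto_of_tendsto_of_tendsto_of_le_of_le tendsto_const_nhds ?_
      (fun _ => zero_le) hle
    simpa using hεlim.add hεlim

end IsHeatKernel

/-! ### Density of compactly supported functions -/

section CompactSupport

theorem eta_lt_top_of_isCompact (ν : Fin d → ℝ) {K : Set (Fin d → ℝ)} (hK : IsCompact K)
    (hKU : K ⊆ orthant d) : eta ν K < ∞ := by
  have hc : ContinuousOn (fun x : Fin d → ℝ => ∏ i, x i ^ (2 * ν i + 1)) K := by
    refine continuousOn_finsetProd _ fun i _ => ?_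
    exact (continuous_apply i).continuousOn.rpow_const fun x hx => Or.inl (hKU hx i).ne'
  obtain ⟨C, hC⟩ := hK.exists_bound_of_continuousOn hc
  rw [eta, withDensity_apply _ hK.measurableSet]
  calc ∫⁻ x in K, ENNReal.ofReal (∏ i, x i ^ (2 * ν i + 1)) ∂(volume.restrict (orthant d))
      ≤ ∫⁻ x in K, ENNReal.ofReal C ∂(volume.restrict (orthant d)) :=
        setLIntegral_mono' hK.measurableSet fun x hx =>
          ENNReal.ofReal_le_ofReal ((Real.le_norm_self _).trans (hC x hx))
    _ < ∞ := by
      rw [setLIntegral_const]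
      exact ENNReal.mul_lt_top ENNReal.ofReal_lt_top
        ((Measure.restrict_apply_le _ _).trans_lt hK.measure_lt_top)

/-- The density `x^(2ν+1)` need not be integrable near the boundary of the orthant, so approximation
is done inside the orthant, itself a locally compact space on which the measure is locally finite;
the approximants are then extended by zero. -/
theorem exists_isCc_eLpNorm_sub_le (ν : Fin d → ℝ) {f : (Fin d → ℝ) → ℂ}
    (hf : MemLp f 2 (eta ν)) {ε : ℝ≥0∞} (hε : ε ≠ 0) :
    ∃ F, IsCc F ∧ eLpNorm (F - f) 2 (eta ν) ≤ ε := by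
  have hU := isOpen_orthant d
  have hemb : MeasurableEmbedding (Subtype.val : orthant d → Fin d → ℝ) :=
    MeasurableEmbedding.subtype_coe hU.measurableSet
  set μ : Measure (orthant d) := (eta ν).comap Subtype.val with hμ
  have hmap : μ.map Subtype.val = eta ν := by
    rw [hμ, hemb.map_comap, Subtype.range_coe]
    exact Measure.restrict_eq_self_of_ae_mem (ae_eta_mem_orthant ν)
  have : LocallyCompactSpace (orthant d) := hU.locallyCompactSpace
  have : IsFiniteMeasureOnCompacts μ := ⟨fun K hK => by
    rw [hμ, hemb.comap_apply]
    refine eta_lt_top_of_isCompact ν (hK.image continuous_subtype_val) ?_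
    rintro _ ⟨x, _, rfl⟩
    exact x.2⟩
  have : IsLocallyFiniteMeasure μ := isLocallyFiniteMeasure_of_isFiniteMeasureOnCompacts
  have hfU : MemLp (f ∘ Subtype.val) 2 μ := by
    rw [← hemb.memLp_map_measure_iff, hmap]
    exact hf
  obtain ⟨g, hgs, hg, hgc, -⟩ := hfU.exists_hasCompactSupport_eLpNorm_sub_le (by norm_num) hε
  have hts := hgs.tsupport_extend_zero_subset continuous_subtype_val
  refine ⟨Subtype.val.extend g 0, ⟨hgs.continuous_extend_zero hU hgc, ?_, ?_⟩, ?_⟩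
  · exact (hgs.isCompact.image continuous_subtype_val).of_isClosed_subset
      (isClosed_tsupport _) hts
  · refine hts.trans ?_
    rintro _ ⟨x, _, rfl⟩
    exact x.2
  · rw [← hmap, hemb.eLpNorm_map_measure]
    have e : (Subtype.val.extend g 0 - f) ∘ Subtype.val = g - f ∘ Subtype.val := by
      funext x
      simp
    rw [e, eLpNorm_sub_comm]
    exact hg

end CompactSupport

/-! ### Specialization to the Bessel semigroup -/

section Main

/-- The order of the Bessel functions in each coordinate. -/
def orderParam (E : Finset (Fin d)) (ν : Fin d → ℝ) (i : Fin d) : ℝ := if i ∈ E then -ν i else ν i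

/-- The exponent of the additional power factor in each coordinate. -/
def powerParam (E : Finset (Fin d)) (ν : Fin d → ℝ) (i : Fin d) : ℝ := if i ∈ E then -ν i else 0

variable {E : Finset (Fin d)} {ν : Fin d → ℝ}

theorem orderParam_sub_powerParam (E : Finset (Fin d)) (ν : Fin d → ℝ) :
    (fun i => orderParam E ν i - 2 * powerParam E ν i) = ν := by
  funext i
  unfold orderParam powerParam
  split_ifs <;> ring

theorem neg_one_lt_orderParam (hν : ν ∈ paramSet E) (i : Fin d) : -1 < orderParam E ν i := by
  unfold orderParam
  split_ifs with h
  · linarith [(hν.1 i h).2]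
  · exact hν.2 i h

theorem lt_zero_of_maxExo_lt (hmax : maxExo E ν < 0) {i : Fin d} (hi : i ∈ E) : ν i < 0 := by
  have h : (ν i : EReal) ≤ maxExo E ν := Finset.le_sup (f := fun i => (ν i : EReal)) hi
  exact_mod_cast h.trans_lt hmax

theorem powerParam_nonneg (hmax : maxExo E ν < 0) (i : Fin d) : 0 ≤ powerParam E ν i := by
  unfold powerParam
  split_ifs with h
  · linarith [lt_zero_of_maxExo_lt hmax h]
  · exact le_rfl

theorem Phi_eq_eigenProd {z x : Fin d → ℝ} (hz : z ∈ orthant d) (hx : x ∈ orthant d) :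
    Phi E ν z x = eigenProd (orderParam E ν) (powerParam E ν) z x := by
  refine Finset.prod_congr rfl fun i _ => ?_
  unfold orderParam powerParam
  split_ifs
  · exact phiExo_eq_eigenfun _ (hz i) (hx i)
  · exact phi_eq_eigenfun _ (hz i) (hx i)

theorem kernel_eq_heatProd (hν : ν ∈ paramSet E) {t : ℝ} (ht : 0 < t) {x y : Fin d → ℝ}
    (hx : x ∈ orthant d) (hy : y ∈ orthant d) :
    kernel E ν t x y = heatProd (orderParam E ν) (powerParam E ν) t x y := by
  refine Finset.prod_congr rfl fun i _ => ?_
  unfold orderParam powerParam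
  split_ifs with h
  · exact kernelExo_eq (hν.1 i h).2 ht (hx i) (hy i)
  · exact kernelCls_eq (hν.2 i h) ht (hx i) (hy i)

/-- Negativity of the exotic parameters gives `α_i = β_i = -ν_i > 0` for `i ∈ E`, as the mass bound
demands. -/
theorem isHeatKernel_eta (hν : ν ∈ paramSet E) (hmax : maxExo E ν < 0) :
    IsHeatKernel (eta ν) (fun z => ∑ i, z i ^ 2)
      (eigenProd (orderParam E ν) (powerParam E ν))
      (heatProd (orderParam E ν) (powerParam E ν)) := by
  have h := isHeatKernel_heatProd (neg_one_lt_orderParam hν) (powerParam_nonneg hmax) fun i => by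
    unfold orderParam powerParam
    split_ifs with hi
    · exact Or.inr ⟨rfl, by linarith [lt_zero_of_maxExo_lt hmax hi]⟩
    · exact Or.inl rfl
  rwa [orderParam_sub_powerParam] at h

theorem hankel_ae_eq_transform (f : (Fin d → ℝ) → ℂ) :
    hankel E ν f =ᵐ[eta ν]
      IsHeatKernel.transform (eta ν) (eigenProd (orderParam E ν) (powerParam E ν)) f := by
  filter_upwards [ae_eta_mem_orthant ν] with z hz
  refine integral_congr_ae ?_
  filter_upwards [ae_eta_mem_orthant ν] with x hx
  simp only [Phi_eq_eigenProd hz hx]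

theorem kernel_smul_ae_eq (hν : ν ∈ paramSet E) {t : ℝ} (ht : 0 < t) (f : (Fin d → ℝ) → ℂ)
    {x : Fin d → ℝ} (hx : x ∈ orthant d) :
    (fun y => kernel E ν t x y • f y) =ᵐ[eta ν]
      fun y => heatProd (orderParam E ν) (powerParam E ν) t x y • f y := by
  filter_upwards [ae_eta_mem_orthant ν] with y hy
  rw [kernel_eq_heatProd hν ht hx hy]

theorem semigroup_eq_heatOp (hν : ν ∈ paramSet E) {t : ℝ} (ht : 0 < t) (f : (Fin d → ℝ) → ℂ)
    {x : Fin d → ℝ} (hx : x ∈ orthant d) :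
    semigroup E ν t f x =
      IsHeatKernel.heatOp (eta ν) (heatProd (orderParam E ν) (powerParam E ν)) t f x :=
  integral_congr_ae (kernel_smul_ae_eq hν ht f hx)

theorem semigroup_ae_eq_heatOp (hν : ν ∈ paramSet E) {t : ℝ} (ht : 0 < t)
    (f : (Fin d → ℝ) → ℂ) : semigroup E ν t f =ᵐ[eta ν]
      IsHeatKernel.heatOp (eta ν) (heatProd (orderParam E ν) (powerParam E ν)) t f := by
  filter_upwards [ae_eta_mem_orthant ν] with x hx
  exact semigroup_eq_heatOp hν ht f hx

theorem IsCc.isNice (hν : ν ∈ paramSet E) (hmax : maxExo E ν < 0) {f : (Fin d → ℝ) → ℂ}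
    (hf : IsCc f) :
    IsHeatKernel.IsNice (eta ν) (heatProd (orderParam E ν) (powerParam E ν)) f := by
  obtain ⟨hc, hs, hsub⟩ := hf
  set K := tsupport f
  have hK : IsCompact K := hs
  have hfin := eta_lt_top_of_isCompact ν hK hsub
  have hmeas : MeasurableSet K := hK.measurableSet
  obtain ⟨C, hC⟩ := hK.exists_bound_of_continuousOn hc.continuousOn
  have hCe : ∀ x ∈ K, ‖f x‖ₑ ≤ ENNReal.ofReal C := fun x hx => by
    rw [← ofReal_norm]
    exact ENNReal.ofReal_le_ofReal (hC x hx)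
  have h0 : ∀ x ∉ K, ‖f x‖ₑ = 0 := fun x hx => by simp [image_eq_zero_of_notMem_tsupport hx]
  have key : ∀ (h : (Fin d → ℝ) → ℝ≥0∞) (B : ℝ≥0∞), B ≠ ∞ → (∀ x ∈ K, h x ≤ B) →
      (∀ x ∉ K, h x = 0) → ∫⁻ x, h x ∂(eta ν) < ∞ := by
    intro h B hB h1 h2
    calc ∫⁻ x, h x ∂(eta ν) ≤ ∫⁻ x, K.indicator (fun _ => B) x ∂(eta ν) := by
          refine lintegral_mono fun x => ?_
          by_cases hx : x ∈ K
          · simpa [hx] using h1 x hx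
          · simp [hx, h2 x hx]
      _ = B * eta ν K := lintegral_indicator_const hmeas B
      _ < ∞ := ENNReal.mul_lt_top hB.lt_top hfin
  refine ⟨hc.measurable, ⟨hc.aestronglyMeasurable, ?_⟩, fun t ht => ?_⟩
  · rw [eLpNorm_two_eq]
    refine ENNReal.rpow_lt_top_of_nonneg (by norm_num) (key _ (ENNReal.ofReal C ^ 2)
      (ENNReal.pow_ne_top ENNReal.ofReal_ne_top) (fun x hx => ?_) fun x hx => ?_).ne
    · exact pow_le_pow_left₀ zero_le (hCe x hx) 2
    · rw [h0 x hx]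
      simp
  · have hk : Continuous fun x => heatProd (orderParam E ν) (powerParam E ν) t x x := by
      have h2 := continuous_heatProd (neg_one_lt_orderParam hν) (powerParam_nonneg hmax) t
      exact h2.comp₂ continuous_id continuous_id
    obtain ⟨D, hD⟩ := hK.exists_bound_of_continuousOn hk.continuousOn
    refine key _ (ENNReal.ofReal C * ENNReal.ofReal D ^ (1 / 2 : ℝ))
      (ENNReal.mul_ne_top ENNReal.ofReal_ne_top
        (ENNReal.rpow_ne_top_of_nonneg (by norm_num) ENNReal.ofReal_ne_top))
      (fun x hx => ?_) fun x hx => ?_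
    · refine mul_le_mul' (hCe x hx) (ENNReal.rpow_le_rpow ?_ (by norm_num))
      exact ENNReal.ofReal_le_ofReal ((Real.le_norm_self _).trans (hD x hx))
    · rw [h0 x hx, zero_mul]

theorem isSemigroupL2_semigroup (hν : ν ∈ paramSet E) (hmax : maxExo E ν < 0) {t : ℝ} (ht : 0 < t)
    {f : (Fin d → ℝ) → ℂ} (hf : MemLp f 2 (eta ν)) :
    IsSemigroupL2 E ν t f (semigroup E ν t f) := by
  have hk := isHeatKernel_eta hν hmax
  obtain ⟨g, hg, ⟨F, hF, hFf, hFg⟩, H, hH, hHg, hHf⟩ := hk.exists_approx_heatOp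
    (P := IsCc) (fun f hf => hf.isNice hν hmax)
    (fun f hf ε hε => exists_isCc_eLpNorm_sub_le ν hf hε) ht hf
  refine ⟨g, ⟨hf, hg, F, hF, hFf, ?_⟩, hk.memLp_gaussian_smul ht hg, ?_, H, hH, hHg, ?_⟩
  · refine hFg.congr fun n => eLpNorm_congr_ae ?_
    exact ((hankel_ae_eq_transform (F n)).sub (ae_eq_refl g)).symm
  · exact (memLp_congr_ae (semigroup_ae_eq_heatOp hν ht f)).2 (hk.memLp_heatOp ht hf)
  · refine hHf.congr fun n => eLpNorm_congr_ae ?_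
    exact ((hankel_ae_eq_transform (H n)).sub (semigroup_ae_eq_heatOp hν ht f)).symm

theorem lintegral_enorm_ne_top {f : (Fin d → ℝ) → ℂ} (hf : MemLp f 1 (eta ν)) :
    ∫⁻ y, ‖f y‖ₑ ∂(eta ν) ≠ ∞ := by
  rw [← eLpNorm_one_eq_lintegral_enorm]
  exact hf.2.ne

/-- Dominated convergence. For `t` in `(t₀/2, 2t₀)` the time `2t₀` lies in `[t, 4t]`, so `C k_(2t₀)`
is a majorant. -/
theorem continuousOn_semigroup (hν : ν ∈ paramSet E) (hmax : maxExo E ν < 0)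
    {f : (Fin d → ℝ) → ℂ} (hf : MemLp f 1 (eta ν)) {x : Fin d → ℝ} (hx : x ∈ orthant d) :
    ContinuousOn (fun t => semigroup E ν t f x) (Ioi 0) := by
  have hk := isHeatKernel_eta hν hmax
  set k := heatProd (orderParam E ν) (powerParam E ν)
  refine ContinuousOn.congr (f := fun t => IsHeatKernel.heatOp (eta ν) k t f x) ?_
    fun t ht => semigroup_eq_heatOp hν ht f hx
  intro t₀ ht₀
  have ht₀ : 0 < t₀ := ht₀
  obtain ⟨C, hC⟩ := hk.comparable
  have hnhds : Ioo (t₀ / 2) (2 * t₀) ∈ 𝓝 t₀ := Ioo_mem_nhds (by linarith) (by linarith)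
  refine ContinuousAt.continuousWithinAt (continuousAt_of_dominated
    (bound := fun y => C * ‖k (2 * t₀) x y • f y‖) ?_ ?_ ?_ ?_)
  · filter_upwards [hnhds] with t ht
    exact ((hk.measurable_kernel t (by linarith [ht.1])).comp
      measurable_prodMk_left).aestronglyMeasurable.smul hf.1
  · filter_upwards [hnhds] with t ht
    have ht0 : 0 < t := by linarith [ht.1]
    filter_upwards with y
    rw [norm_smul, norm_smul, Real.norm_of_nonneg (hk.nonneg t ht0 x y),
      Real.norm_of_nonneg (hk.nonneg (2 * t₀) (by positivity) x y), ← mul_assoc]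
    exact mul_le_mul_of_nonneg_right
      (hC t (2 * t₀) ht0 ht.2.le (by linarith [ht.1]) x y) (norm_nonneg _)
  · exact (hk.integrable_kernel_smul (by positivity) hf.1 (hk.kernelOp_lt_top_of_lintegral
      (by positivity) (lintegral_enorm_ne_top hf) x)).norm.const_mul _
  · filter_upwards with y
    exact (continuousAt_heatProd_time (neg_one_lt_orderParam hν) x y ht₀).smul continuousAt_const

/-- By continuity in time the supremum may be taken over positive rationals. -/
theorem aemeasurable_maximal (hν : ν ∈ paramSet E) (hmax : maxExo E ν < 0)
    {f : (Fin d → ℝ) → ℂ} (hf : MemLp f 1 (eta ν)) : AEMeasurable (maximal E ν f) (eta ν) := by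
  have hk := isHeatKernel_eta hν hmax
  have h1 : AEMeasurable (fun x => ⨆ r : {r : ℚ // 0 < r}, ‖semigroup E ν (r : ℚ) f x‖ₑ)
      (eta ν) := by
    refine AEMeasurable.iSup fun r => ?_
    have hr : (0 : ℝ) < ((r : ℚ) : ℝ) := by exact_mod_cast r.2
    exact ((hk.aestronglyMeasurable_heatOp hr hf.1).congr
      (semigroup_ae_eq_heatOp hν hr f).symm).enorm
  refine h1.congr ?_
  filter_upwards [ae_eta_mem_orthant ν] with x hx
  have hc := continuousOn_semigroup hν hmax hf hx
  refine le_antisymm (iSup_le fun r => ?_) (iSup₂_le fun t ht => ?_)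
  · exact le_iSup₂ (f := fun (t : ℝ) (_ : 0 < t) => ‖semigroup E ν t f x‖ₑ) ((r : ℚ) : ℝ)
      (by exact_mod_cast r.2)
  · refine le_of_forall_lt fun c hlt => ?_
    have hct : ContinuousAt (fun t => ‖semigroup E ν t f x‖ₑ) t :=
      (hc.continuousAt (Ioi_mem_nhds ht)).enorm
    have hev := (hct.eventually (lt_mem_nhds hlt)).and (lt_mem_nhds ht)
    obtain ⟨l, u, hlu, hsub⟩ := mem_nhds_iff_exists_Ioo_subset.1 hev
    obtain ⟨r, hr1, hr2⟩ := exists_rat_btwn (hlu.1.trans hlu.2)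
    have hr := hsub ⟨hr1, hr2⟩
    have hr0 : 0 < r := by exact_mod_cast hr.2
    exact lt_of_lt_of_le hr.1
      (le_iSup (fun r : {r : ℚ // 0 < r} => ‖semigroup E ν (r : ℚ) f x‖ₑ) ⟨r, hr0⟩)

end Main

end ExoticBessel

end

theorem theorem4p1 (d : ℕ) (hd : 1 ≤ d) (E : Finset (Fin d)) (ν : Fin d → ℝ)
    (hν : ν ∈ ExoticBessel.paramSet E) (hmax : ExoticBessel.maxExo E ν < 0) :
    -- the pointwise formula represents `exp(-t 𝔹_{ν,E})` on `L²(dη_ν)`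
    (∀ t : ℝ, 0 < t → ∀ f : (Fin d → ℝ) → ℂ, MemLp f 2 (ExoticBessel.eta ν) →
      (∀ x ∈ ExoticBessel.orthant d,
        Integrable (fun y => ExoticBessel.kernel E ν t x y • f y) (ExoticBessel.eta ν)) ∧
      ExoticBessel.IsSemigroupL2 E ν t f (ExoticBessel.semigroup E ν t f)) ∧
    -- it is well defined on `L¹(dη_ν)`
    (∀ t : ℝ, 0 < t → ∀ f : (Fin d → ℝ) → ℂ, MemLp f 1 (ExoticBessel.eta ν) →
      ∀ x ∈ ExoticBessel.orthant d,
        Integrable (fun y => ExoticBessel.kernel E ν t x y • f y) (ExoticBessel.eta ν)) ∧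
    -- the maximal operator is bounded from `L¹(dη_ν)` to weak `L¹(dη_ν)`
    ∃ C : ℝ≥0, ∀ f : (Fin d → ℝ) → ℂ, MemLp f 1 (ExoticBessel.eta ν) →
      AEMeasurable (ExoticBessel.maximal E ν f) (ExoticBessel.eta ν) ∧
      ∀ s : ℝ, 0 < s →
        ExoticBessel.eta ν {x | ENNReal.ofReal s < ExoticBessel.maximal E ν f x} ≤
          C * eLpNorm f 1 (ExoticBessel.eta ν) / ENNReal.ofReal s := by
  have hk := ExoticBessel.isHeatKernel_eta hν hmax
  refine ⟨fun t ht f hf => ⟨fun x hx => ?_, ExoticBessel.isSemigroupL2_semigroup hν hmax ht hf⟩,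
    fun t ht f hf x hx => ?_, ?_⟩
  · refine Integrable.congr ?_ (ExoticBessel.kernel_smul_ae_eq hν ht f hx).symm
    exact hk.integrable_kernel_smul ht hf.1 (hk.kernelOp_lt_top_of_lintegral_sq ht hf.1.enorm
      (ExoticBessel.MemLp.lintegral_sq_ne_top hf) x)
  · refine Integrable.congr ?_ (ExoticBessel.kernel_smul_ae_eq hν ht f hx).symm
    exact hk.integrable_kernel_smul ht hf.1 (hk.kernelOp_lt_top_of_lintegral ht
      (ExoticBessel.lintegral_enorm_ne_top hf) x)
  · obtain ⟨C, hC⟩ := hk.exists_weakType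
    refine ⟨C, fun f hf => ⟨ExoticBessel.aemeasurable_maximal hν hmax hf, fun s hs => ?_⟩⟩
    -- The abstract weak type bound concerns measurable nonnegative functions; it is applied to
    -- `|g|` for a measurable representative `g` of `f`, whose maximal function dominates that of
    -- `f` on the orthant.
    obtain ⟨g, hg, hfg⟩ := hf.1.aemeasurable
    have hfg' : ∫⁻ y, ‖g y‖ₑ ∂(ExoticBessel.eta ν) = eLpNorm f 1 (ExoticBessel.eta ν) := by
      rw [eLpNorm_congr_ae hfg, eLpNorm_one_eq_lintegral_enorm]
    have h := hC (fun y => ‖g y‖ₑ) hg.enorm (by rw [hfg']; exact hf.2.ne) (ENNReal.ofReal s)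
      ENNReal.ofReal_ne_top
    rw [hfg'] at h
    rw [ENNReal.le_div_iff_mul_le (Or.inl (by simpa using hs)) (Or.inl ENNReal.ofReal_ne_top),
      mul_comm]
    refine le_trans (mul_le_mul_right (measure_mono_ae ?_) _) h
    filter_upwards [ExoticBessel.ae_eta_mem_orthant ν] with x hx hlt
    refine lt_of_lt_of_le (show ENNReal.ofReal s < ExoticBessel.maximal E ν f x from hlt) ?_
    refine iSup₂_mono fun t ht => ?_
    rw [ExoticBessel.semigroup_eq_heatOp hν ht f hx]
    refine (hk.enorm_heatOp_le ht f x).trans (le_of_eq (lintegral_congr_ae ?_))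
    filter_upwards [hfg] with y hy
    rw [hy]
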